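/- **Conventions.** A partial Horn theory with a set of sorts $\mathcal S$ consists of function symbols $\sigma:s_1\times\dots\times s_k\to s$, predicate symbols $R:s_1\times\dots\times s_k$ and Horn sequents $\varphi\vdash_V\psi$ (axioms); derivability is that of partial Horn logic. A restricted term $t|_\varphi$ is a term with a Horn formula; $t\cong t'$ means that each of $t{\downarrow}$, $t'{\downarrow}$ implies $t=t'$. An interpretation $f:\mathbb T\to\mathbb T'$ assigns to function (predicate) symbols restricted terms (formulas) in the variables $x_1:s_1,\dots,x_k:s_k$ and sends axioms to theorems; a morphism of theories is an interpretation up to provable equivalence in $\mathbb T'$. Sorts are $\{ctx,tm\}\times\mathbb N$, and $(ty,n)=(ctx,n+1)$. The theory of contexts $\mathbb T_0$ has symbols $*:(ctx,0)$, $ft_n:(ctx,n+1)\to(ctx,n)$, $ctx_{p,n}:(p,n)\to(ctx,n)$ and axioms $*{\downarrow}$, $x=*$ for $x:(ctx,0)$, $ctx_{ctx,n}(x)=x$. **The theory $\mathbb S$ of substitutions** has symbols $*:(ctx,0)$, $ft_n:(ty,n)\to(ctx,n)$, $ty_n:(tm,n)\to(ty,n)$, $v_{n,i}:(ctx,n)\to(tm,n)$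 for $0\le i<n$, and $subst_{p,n,k}:(ctx,n)\times(p,k)\times(tm,n)^k\to(p,n)$ for $p\in\{ty,tm\}$. Put $ctx_{ty,n}=ft_n$, $ctx_{tm,n}=ft_n\circ ty_n$, and let $Hom_{n,k}(B,A,a_1,\dots,a_k)$ be $\bigwedge_{1\le i\le k}ty_n(a_i)=subst_{ty,n,i-1}(B,ft^{k-i}(A),a_1,\dots,a_{i-1})$. The axioms are: $*{\downarrow}$; $x=*$ for $x:(ctx,0)$; $v_{n,i}(A){\downarrow}$; $subst_{p,n,k}(B,a,\vec a){\downarrow}$ iff $Hom_{n,k}(B,ctx_{p,k}(a),\vec a)$; $ty_n(v_{n,i}(A))=subst_{ty,n,n-i-1}(A,ft^i(A),v_{n,n-1}(A),\dots,v_{n,i+1}(A))$; $ft_n(subst_{ty,n,k}(B,A,\vec a))=B$ if $Hom_{n,k}(B,ft_k(A),\vec a)$; $ty_n(subst_{tm,n,k}(B,a,\vec a))\cong subst_{ty,n,k}(B,ty_k(a),\vec a)$; $subst_{p,n,n}(ctx_{p,n}(a),a,v_{n,n-1},\dots,v_{n,0})=a$, the $v_{n,j}$ being taken at $ctx_{p,n}(a)$;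 $subst_{tm,n,k}(B,v_{k,i}(A),\vec a)=a_{k-i}$ if $Hom_{n,k}(B,A,\vec a)$; and, if $Hom_{n,k}(C,B,\vec b)$ and $Hom_{k,m}(B,ctx_{p,m}(a),\vec a)$, $subst_{p,n,k}(C,subst_{p,k,m}(B,a,\vec a),\vec b)=subst_{p,n,m}(C,a,subst_{tm,n,k}(C,a_1,\vec b),\dots,subst_{tm,n,k}(C,a_m,\vec b))$. **Prestable theories.** Put $L(p,n)=(p,n+1)$. For a theory $\mathbb T$ with an interpretation of $\mathbb T_0$ in it, $L(\mathbb T)$ has the symbols and axioms of $\mathbb T_0$ and symbols $L(\sigma):(ctx,1)\times L(s_1)\times\dots\times L(s_k)\to L(s)$ and $L(R):(ctx,1)\times L(s_1)\times\dots\times L(s_k)$. Say that $x:(p,n+1)$ is over $\Gamma:(ctx,1)$ if $ft^n(ctx_{p,n+1}(x))=\Gamma$. Define $L(\Gamma,x)=x|_{x\text{ over }\Gamma}$, $L(\Gamma,\sigma(\vec t))=L(\sigma)(\Gamma,L(\Gamma,t_1),\dots,L(\Gamma,t_k))$, and similarly for formulas and restricted terms. The further axioms of $L(\mathbb T)$ say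 that if $L(\sigma)(\Gamma,\vec x){\downarrow}$ then it and all $x_i$ are over $\Gamma$; if $L(R)(\Gamma,\vec x)$ then all $x_i$ are over $\Gamma$; and $ctx_{p,n+1}(x)=L(\Gamma,ctx_{p,n}(x))$ for $x:(p,n+1)$ over $\Gamma$. A prestable theory is a theory $\mathbb T$ with an interpretation of $\mathbb T_0$ in $\mathbb T$ and an interpretation $\alpha:L(\mathbb T)\to\mathbb T$ that is compatible with it. A morphism of prestable theories is (represented by) an interpretation $f$, compatible with the maps from $\mathbb T_0$, such that $f\circ\alpha=\alpha\circ L(f)$ up to equivalence, where $L(f)$ sends $L(\sigma)(\Gamma,\vec x)$ to $L(\Gamma,f(\sigma(\vec x)))$ and $L(R)(\Gamma,\vec x)$ to $L(\Gamma,f(R(\vec x)))$ (both also restricted to all $x_i$ being over $\Gamma$). $\mathbb S$ is prestable, with the maps $ctx_{p,n}$ above and with $\alpha$ given by $L(*)(\Gamma)\mapsto\Gamma$, $L(ft_n)(\Gamma,A)\mapsto ft_{n+1}(A)$, $L(ty_n)(\Gamma,a)\mapsto ty_{n+1}(a)$, $L(v_{n,i})(\Gamma,\Delta)\mapsto v_{n+1,i}(\Delta)$,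 $L(subst_{p,n,k})(\Gamma,\Delta,B,\vec a)\mapsto subst_{p,n+1,k+1}(\Delta,B,v_{n+1,n}(\Delta),\vec a)$, the last four restricted to $A$, $a$, $\Delta$, and $\Delta$ and $B$, respectively, being over $\Gamma$. A prestable theory under $\mathbb S$ is a prestable theory with a morphism from $\mathbb S$. **Algebraic dependent type theories.** For a term or formula $t$ of a prestable theory and $\Gamma:(ctx,m)$ let $\Gamma\times t=\alpha L(ft^{m-1}(\Gamma),\alpha L(ft^{m-2}(\Gamma),\dots\alpha L(\Gamma,t)))$. Let $subst^m_{p,n,k}:(ctx,n)\times(p,k+m)\times(tm,n)^k\to(p,n+m)$ be defined by $subst^0_{ctx,n,k}(B,A,\vec a)=B$, $subst^{m+1}_{ctx,n,k}=subst^m_{ty,n,k}$ and, for $p\in\{ty,tm\}$, $subst^m_{p,n,k}(B,a,\vec a)=subst_{p,n+m,k+m}(B',a,a_1',\dots,a_k',v_{n+m,m-1}(B'),\dots,v_{n+m,0}(B'))$, where $B'=subst^m_{ctx,n,k}(B,ctx_{p,k+m}(a),\vec a)$ and $a_i'=subst_{tm,n+m,n}(B',a_i,v_{n+m,n+m-1}(B'),\dots,v_{n+m,m}(B'))$.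 A prestable theory under $\mathbb S$ is an algebraic dependent type theory if, for all its symbols $\sigma:(p_1,n_1)\times\dots\times(p_k,n_k)\to(p,n)$ and $R:(p_1,n_1)\times\dots\times(p_k,n_k)$ and all $l,m\in\mathbb N$, with $\Gamma:(ctx,l)$, $\Delta:(ctx,m)$, $a_1,\dots,a_m:(tm,l)$, $b_i:(p_i,n_i+m)$ and $b_i'=subst^{n_i}_{p_i,l,m}(\Gamma,b_i,\vec a)$, it derives $$(\Delta\times\sigma(\vec b)){\downarrow}\wedge Hom_{l,m}(\Gamma,\Delta,\vec a)\vdash subst^n_{p,l,m}(\Gamma,\Delta\times\sigma(\vec b),\vec a)=\Gamma\times\sigma(\vec b'),\qquad \Delta\times R(\vec b)\wedge Hom_{l,m}(\Gamma,\Delta,\vec a)\vdash\Gamma\times R(\vec b').$$ **Contextual theories.** A contextual theory under $\mathbb S$ is a prestable theory $\mathbb T$ under $\mathbb S$ for which there are sets $\mathcal F_0,\mathcal P_0$ of basic function and predicate symbols, no element of $\mathcal F_0$ having codomain $(ctx,0)$, such that: the symbols of $\mathbb T$ are those of $\mathbb S$ together with $\sigma_m:(ctx,m)\times(p_1,n_1+m)\times\dots\times(p_k,n_k+m)\to(p,n+m)$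 and $R_m:(ctx,m)\times(p_1,n_1+m)\times\dots\times(p_k,n_k+m)$ for all $m\in\mathbb N$ and all $\sigma:(p_1,n_1)\times\dots\times(p_k,n_k)\to(p,n)$ in $\mathcal F_0$ and $R:(p_1,n_1)\times\dots\times(p_k,n_k)$ in $\mathcal P_0$; the axioms of $\mathbb S$ are axioms of $\mathbb T$; $\alpha$ and the interpretation of $\mathbb T_0$ are given on symbols of $\mathbb S$ and $\mathbb T_0$ as in $\mathbb S$, and $\alpha$ sends $L(\sigma_m)(\Gamma,\Delta,\vec x)$ to $\sigma_{m+1}(\Delta,\vec x)|_{ft^m(\Delta)=\Gamma}$ and $L(R_m)(\Gamma,\Delta,\vec x)$ to $R_{m+1}(\Delta,\vec x)\wedge ft^m(\Delta)=\Gamma$; the morphism from $\mathbb S$ is the inclusion. **Lemma.** Every algebraic dependent type theory is isomorphic, as a prestable theory under $\mathbb S$, to a contextual theory under $\mathbb S$ in which every basic function symbol has a signature of the form $\sigma:s_1\times\dots\times s_k\to(p,0)$ with $p\in\{ty,tm\}$. -/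

import Mathlib

universe u v w

namespace PHT

/-! ## Partial Horn theories -/

/-- The list of argument sorts of a symbol. -/
structure Arity (S : Type) where
  len : ℕ
  sort : Fin len → S

/-- A finite `S`-set of variables. -/
structure Ctx (S : Type) where
  Var : Type
  fin : Finite Var
  sort : Var → S

namespace Arity

variable {S : Type}

/-- The variables `x₁ : s₁, …, x_k : s_k`. -/
abbrev ctx (a : Arity S) : Ctx S := ⟨Fin a.len, inferInstance, a.sort⟩

/-- `k` copies of `s`. -/
abbrev rep (k : ℕ) (s : S) : Arity S := ⟨k, fun _ => s⟩

abbrev cons (s : S) (a : Arity S) : Arity S :=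
  ⟨a.len + 1, Fin.cons (α := fun _ => S) s a.sort⟩

/-- An `S`-sorted family over `cons s a` from its head and its tail. -/
def consFam {F : S → Type v} {s : S} {a : Arity S} (t : F s) (ts : ∀ i, F (a.sort i)) :
    ∀ i, F ((cons s a).sort i) :=
  Fin.cases (motive := fun i => F ((cons s a).sort i)) t ts

end Arity

namespace Ctx

variable {S : Type}

abbrev rep (k : ℕ) (s : S) : Ctx S := (Arity.rep k s).ctx

abbrev cons (s : S) (V : Ctx S) : Ctx S :=
  ⟨Option V.Var, haveI := V.fin; inferInstance, fun x => x.elim s V.sort⟩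

abbrev append (V W : Ctx S) : Ctx S :=
  ⟨V.Var ⊕ W.Var, haveI := V.fin; haveI := W.fin; inferInstance, Sum.elim V.sort W.sort⟩

end Ctx

/-- A many-sorted first-order signature with set of sorts `S`. -/
structure Signature (S : Type) where
  Fn : Type u
  fnArity : Fn → Arity S
  fnCod : Fn → S
  Pr : Type u
  prArity : Pr → Arity S

/-- Disjoint union of two signatures. -/
abbrev Signature.sum {S : Type} (A : Signature.{u} S) (B : Signature.{v} S) :
    Signature.{max u v} S where
  Fn := A.Fn ⊕ B.Fn
  fnArity := Sum.elim A.fnArity B.fnArity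
  fnCod := Sum.elim A.fnCod B.fnCod
  Pr := A.Pr ⊕ B.Pr
  prArity := Sum.elim A.prArity B.prArity

inductive Term {S : Type} (A : Signature.{u} S) (V : Ctx S) : S → Type u
  | var (x : V.Var) : Term A V (V.sort x)
  | app (σ : A.Fn) (args : ∀ i, Term A V ((A.fnArity σ).sort i)) : Term A V (A.fnCod σ)

/-- Horn formulas: finite conjunctions of atomic formulas. -/
inductive Formula {S : Type} (A : Signature.{u} S) (V : Ctx S) : Type u
  | eq {s : S} (t t' : Term A V s) : Formula A V
  | rel (R : A.Pr) (args : ∀ i, Term A V ((A.prArity R).sort i)) : Formula A V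
  | top : Formula A V
  | and (φ ψ : Formula A V) : Formula A V

section

variable {S : Type} {A : Signature.{u} S} {V W : Ctx S}

/-- Simultaneous substitution. -/
def Term.subst (θ : ∀ x, Term A W (V.sort x)) : {s : S} → Term A V s → Term A W s
  | _, .var x => θ x
  | _, .app σ args => .app σ (fun i => (args i).subst θ)

/-- Transport along an equality of sorts. -/
def Term.cast {s s' : S} (h : s = s') (t : Term A V s) : Term A V s' := h ▸ t

/-- The variable `x` as a term of a sort `s` that equals the sort of `x`. -/
def Term.varOf {s : S} (x : V.Var) (h : V.sort x = s := by rfl) : Term A V s := h ▸ Term.var x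

/-- `t↓`. -/
def Term.defd {s : S} (t : Term A V s) : Formula A V := .eq t t

def Formula.subst (θ : ∀ x, Term A W (V.sort x)) : Formula A V → Formula A W
  | .eq t t' => .eq (t.subst θ) (t'.subst θ)
  | .rel R args => .rel R (fun i => (args i).subst θ)
  | .top => .top
  | .and φ ψ => .and (φ.subst θ) (ψ.subst θ)

/-- The conjunction `φ₁ ∧ … ∧ φ_n`. -/
def Formula.all : {n : ℕ} → (Fin n → Formula A V) → Formula A V
  | 0, _ => .top
  | _ + 1, φ => .and (φ 0) (Formula.all (fun i => φ i.succ))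

end

/-- A sequent `hyp ⊢_ctx concl`. -/
structure Sequent {S : Type} (A : Signature.{u} S) where
  ctx : Ctx S
  hyp : Formula A ctx
  concl : Formula A ctx

structure Theory (S : Type) where
  sig : Signature.{u} S
  axms : Set (Sequent sig)

/-- `T.Derivable φ ψ`: the sequent `φ ⊢_V ψ` is a theorem of `T`. The rules are those of partial
Horn logic, with simultaneous substitution of *defined* terms and with strictness (a term or an
atomic formula can only be defined, resp. true, if its immediate subterms are defined). -/
inductive Theory.Derivable {S : Type} (T : Theory.{u} S) :
    {V : Ctx S} → Formula T.sig V → Formula T.sig V → Prop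
  | ax (q : Sequent T.sig) (h : q ∈ T.axms) : T.Derivable q.hyp q.concl
  | refl {V : Ctx S} (φ : Formula T.sig V) : T.Derivable φ φ
  | trans {V : Ctx S} {φ ψ χ : Formula T.sig V} :
      T.Derivable φ ψ → T.Derivable ψ χ → T.Derivable φ χ
  | top {V : Ctx S} (φ : Formula T.sig V) : T.Derivable φ .top
  | and_left {V : Ctx S} (φ ψ : Formula T.sig V) : T.Derivable (.and φ ψ) φ
  | and_right {V : Ctx S} (φ ψ : Formula T.sig V) : T.Derivable (.and φ ψ) ψ
  | and_intro {V : Ctx S} {φ ψ χ : Formula T.sig V} :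
      T.Derivable φ ψ → T.Derivable φ χ → T.Derivable φ (.and ψ χ)
  | var_defd {V : Ctx S} (x : V.Var) : T.Derivable .top (Term.var x).defd
  | strict_eq_left {V : Ctx S} {s : S} (t t' : Term T.sig V s) :
      T.Derivable (.eq t t') t.defd
  | strict_eq_right {V : Ctx S} {s : S} (t t' : Term T.sig V s) :
      T.Derivable (.eq t t') t'.defd
  | strict_app {V : Ctx S} (σ : T.sig.Fn)
      (args : ∀ i, Term T.sig V ((T.sig.fnArity σ).sort i)) (i : Fin (T.sig.fnArity σ).len) :
      T.Derivable (Term.app σ args).defd (args i).defd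
  | strict_rel {V : Ctx S} (R : T.sig.Pr)
      (args : ∀ i, Term T.sig V ((T.sig.prArity R).sort i)) (i : Fin (T.sig.prArity R).len) :
      T.Derivable (.rel R args) (args i).defd
  | eq_subst {V W : Ctx S} {χ : Formula T.sig W} (φ : Formula T.sig V)
      (θ θ' : ∀ x, Term T.sig W (V.sort x)) :
      (∀ x, T.Derivable χ (.eq (θ x) (θ' x))) →
      T.Derivable χ (φ.subst θ) → T.Derivable χ (φ.subst θ')
  | subst {V W : Ctx S} {χ : Formula T.sig W} {φ ψ : Formula T.sig V}
      (θ : ∀ x, Term T.sig W (V.sort x)) :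
      T.Derivable φ ψ → (∀ x, T.Derivable χ (θ x).defd) →
      T.Derivable χ (φ.subst θ) → T.Derivable χ (ψ.subst θ)

/-- A restricted term `tm|_cond`. -/
structure RTerm {S : Type} (A : Signature.{u} S) (V : Ctx S) (s : S) where
  tm : Term A V s
  cond : Formula A V

namespace RTerm

variable {S : Type} {A : Signature.{u} S} {V : Ctx S} {s : S}

def ofTerm (t : Term A V s) : RTerm A V s := ⟨t, .top⟩

/-- `t|_φ ↓`. -/
def defd (r : RTerm A V s) : Formula A V := .and r.tm.defd r.cond

/-- `t|_φ = t'|_φ'`. -/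
def eq (r r' : RTerm A V s) : Formula A V := .and (.eq r.tm r'.tm) (.and r.cond r'.cond)

/-- `r|_φ` for a restricted term `r`. -/
def restrict (r : RTerm A V s) (φ : Formula A V) : RTerm A V s := ⟨r.tm, .and r.cond φ⟩

/-- Substitution of restricted terms for the variables of a restricted term. All the
substituted terms are required to be defined, also those whose variable does not occur. -/
def subst {a : Arity S} (r : RTerm A a.ctx s) (θ : ∀ i, RTerm A V (a.sort i)) : RTerm A V s :=
  ⟨r.tm.subst (fun i => (θ i).tm),
   .and (r.cond.subst (fun i => (θ i).tm)) (Formula.all (fun i => (θ i).defd))⟩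

end RTerm

/-- Substitution of restricted terms for the variables of a formula. -/
def Formula.rsubst {S : Type} {A : Signature.{u} S} {V : Ctx S} {a : Arity S}
    (φ : Formula A a.ctx) (θ : ∀ i, RTerm A V (a.sort i)) : Formula A V :=
  .and (φ.subst (fun i => (θ i).tm)) (Formula.all (fun i => (θ i).defd))

/-- Equivalence of formulas. -/
def Theory.FEquiv {S : Type} (T : Theory.{u} S) {V : Ctx S} (φ ψ : Formula T.sig V) : Prop :=
  T.Derivable φ ψ ∧ T.Derivable ψ φ

/-- Equivalence `⊢ r ≅ r'` of restricted terms. -/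
def Theory.REquiv {S : Type} (T : Theory.{u} S) {V : Ctx S} {s : S} (r r' : RTerm T.sig V s) :
    Prop :=
  T.Derivable r.defd (.and (.eq r.tm r'.tm) r'.cond) ∧
  T.Derivable r'.defd (.and (.eq r.tm r'.tm) r.cond)

/-- An assignment of restricted terms (formulas) in the variables `x₁, …, x_k` to the function
(predicate) symbols of a signature. -/
structure SymMap {S : Type} (A : Signature.{u} S) (B : Signature.{v} S) where
  fn : ∀ σ : A.Fn, RTerm B (A.fnArity σ).ctx (A.fnCod σ)
  pr : ∀ R : A.Pr, Formula B (A.prArity R).ctx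

namespace SymMap

variable {S : Type} {A : Signature.{u} S} {B : Signature.{v} S} {C : Signature.{w} S} {V : Ctx S}

/-- Extension to terms. -/
def term (f : SymMap A B) : {s : S} → Term A V s → RTerm B V s
  | _, .var x => RTerm.ofTerm (.var x)
  | _, .app σ args => (f.fn σ).subst (fun i => f.term (args i))

/-- Extension to formulas. -/
def formula (f : SymMap A B) : Formula A V → Formula B V
  | .eq t t' => (f.term t).eq (f.term t')
  | .rel R args => (f.pr R).rsubst (fun i => f.term (args i))
  | .top => .top
  | .and φ ψ => .and (f.formula φ) (f.formula ψ)

/-- Extension to restricted terms. -/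
def rterm (f : SymMap A B) {s : S} (r : RTerm A V s) : RTerm B V s :=
  (f.term r.tm).restrict (f.formula r.cond)

protected def id (A : Signature.{u} S) : SymMap A A where
  fn σ := RTerm.ofTerm (.app σ (fun i => .var (V := (A.fnArity σ).ctx) i))
  pr R := .rel R (fun i => .var (V := (A.prArity R).ctx) i)

/-- `g ∘ f`. -/
def comp (g : SymMap B C) (f : SymMap A B) : SymMap A C where
  fn σ := g.rterm (f.fn σ)
  pr R := g.formula (f.pr R)

end SymMap

/-- `f` is an interpretation of `T` in `T'`. -/
def IsInterp {S : Type} (T : Theory.{u} S) (T' : Theory.{v} S) (f : SymMap T.sig T'.sig) : Prop :=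
  ∀ q ∈ T.axms, T'.Derivable (f.formula q.hyp) (f.formula q.concl)

/-- Equivalence of assignments; morphisms of theories are equivalence classes of interpretations. -/
def SymEquiv {S : Type} {A : Signature.{u} S} (T : Theory.{v} S) (f g : SymMap A T.sig) : Prop :=
  (∀ σ, T.REquiv (f.fn σ) (g.fn σ)) ∧ (∀ R, T.FEquiv (f.pr R) (g.pr R))

section

variable {S : Type} {A : Signature.{u} S} (B : Signature.{v} S) {V : Ctx S}

/-- Terms of `A` are terms of `A.sum B`. -/
def Term.incl : {s : S} → Term A V s → Term (A.sum B) V s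
  | _, .var x => .var x
  | _, .app σ args => .app (A := A.sum B) (Sum.inl σ) (fun i => (args i).incl)

def Formula.incl : Formula A V → Formula (A.sum B) V
  | .eq t t' => .eq (t.incl B) (t'.incl B)
  | .rel R args => .rel (A := A.sum B) (Sum.inl R) (fun i => (args i).incl B)
  | .top => .top
  | .and φ ψ => .and (φ.incl) (ψ.incl)

def RTerm.incl {s : S} (r : RTerm A V s) : RTerm (A.sum B) V s := ⟨r.tm.incl B, r.cond.incl B⟩

def Sequent.incl (q : Sequent A) : Sequent (A.sum B) := ⟨q.ctx, q.hyp.incl B, q.concl.incl B⟩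

end

/-! ## Prestable theories -/

inductive Base
  | ctx
  | tm

/-- The set of sorts `{ctx, tm} × ℕ`. -/
abbrev Srt : Type := Base × ℕ

/-- `(p, n) ↦ (p, n + m)`. -/
abbrev Srt.up (s : Srt) (m : ℕ) : Srt := (s.1, s.2 + m)

/-- `(ctx, n)`. -/
abbrev cx (n : ℕ) : Srt := (Base.ctx, n)

/-- `(tm, n)`. -/
abbrev tmS (n : ℕ) : Srt := (Base.tm, n)

/-- `(ty, n) = (ctx, n + 1)`. -/
abbrev tyS (n : ℕ) : Srt := (Base.ctx, n + 1)

abbrev Arity.up (a : Arity Srt) (m : ℕ) : Arity Srt := ⟨a.len, fun i => (a.sort i).up m⟩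

/-- `(ctx, m) × (p₁, n₁ + m) × … × (p_k, n_k + m)`. -/
abbrev Arity.under (a : Arity Srt) (m : ℕ) : Arity Srt := Arity.cons (cx m) (a.up m)

/-- The variables `Γ` and `x_i` of the arity `a.under m`. -/
def ctxVar {A : Signature.{u} Srt} (a : Arity Srt) (m : ℕ) : Term A (a.under m).ctx (cx m) :=
  Term.varOf (V := (a.under m).ctx) (0 : Fin (a.len + 1))

def argVar {A : Signature.{u} Srt} (a : Arity Srt) (m : ℕ) (i : Fin a.len) :
    Term A (a.under m).ctx ((a.sort i).up m) :=
  Term.varOf (V := (a.under m).ctx) i.succ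

/-- Function symbols of the theory of contexts: `*`, `ft_n` and `ctx_{p,n}`. -/
inductive BaseFn
  | star
  | ft (n : ℕ)
  | ctxOf (p : Base) (n : ℕ)

abbrev baseSig : Signature.{0} Srt where
  Fn := BaseFn
  fnArity
    | .star => Arity.rep 0 (cx 0)
    | .ft n => Arity.rep 1 (cx (n + 1))
    | .ctxOf p n => Arity.rep 1 (p, n)
  fnCod
    | .star => cx 0
    | .ft n => cx n
    | .ctxOf _ n => cx n
  Pr := Empty
  prArity := Empty.elim

namespace BaseTerm

variable {V : Ctx Srt}

def star : Term baseSig V (cx 0) := .app (A := baseSig) BaseFn.star (fun i => Fin.elim0 i)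

def ft (n : ℕ) (t : Term baseSig V (cx (n + 1))) : Term baseSig V (cx n) :=
  .app (A := baseSig) (BaseFn.ft n) (fun _ => t)

def ctxOf (p : Base) (n : ℕ) (t : Term baseSig V (p, n)) : Term baseSig V (cx n) :=
  .app (A := baseSig) (BaseFn.ctxOf p n) (fun _ => t)

end BaseTerm

inductive BaseAx : Sequent baseSig → Prop
  | star : BaseAx ⟨Ctx.rep 0 (cx 0), .top, BaseTerm.star.defd⟩
  | star_unique : BaseAx ⟨Ctx.rep 1 (cx 0), .top, .eq (Term.varOf (0 : Fin 1)) BaseTerm.star⟩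
  | ctx (n : ℕ) : BaseAx ⟨Ctx.rep 1 (cx n), .top,
      .eq (BaseTerm.ctxOf .ctx n (Term.varOf (0 : Fin 1))) (Term.varOf (0 : Fin 1))⟩

/-- The theory of contexts. -/
abbrev baseTheory : Theory.{0} Srt := ⟨baseSig, {q | BaseAx q}⟩

/-- The symbols `L(σ)` and `L(R)`. -/
abbrev liftSig (A : Signature.{u} Srt) : Signature.{u} Srt where
  Fn := A.Fn
  fnArity σ := (A.fnArity σ).under 1
  fnCod σ := (A.fnCod σ).up 1
  Pr := A.Pr
  prArity R := (A.prArity R).under 1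

/-- The signature of `L(T)`: the symbols of the theory of contexts together with the symbols
`L(σ)` and `L(R)`. -/
abbrev LSig (A : Signature.{u} Srt) : Signature.{u} Srt := baseSig.sum (liftSig A)

section

variable {A : Signature.{u} Srt} {V W : Ctx Srt}

/-- `ft_n` in `L(T)`. -/
def lft (n : ℕ) (t : Term (LSig A) W (cx (n + 1))) : Term (LSig A) W (cx n) :=
  .app (A := LSig A) (Sum.inl (BaseFn.ft n)) (fun _ => t)

/-- `ctx_{p,n}` in `L(T)`. -/
def lctx (p : Base) (n : ℕ) (t : Term (LSig A) W (p, n)) : Term (LSig A) W (cx n) :=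
  .app (A := LSig A) (Sum.inl (BaseFn.ctxOf p n)) (fun _ => t)

/-- `ft^n : (ctx, n + 1) → (ctx, 1)` in `L(T)`. -/
def lftIter : (n : ℕ) → Term (LSig A) W (cx (n + 1)) → Term (LSig A) W (cx 1)
  | 0, t => t
  | n + 1, t => lftIter n (lft (n + 1) t)

/-- `ft^n(ctx_{p,n+1}(t)) = Γ`, for `t` of sort `(p, n + 1)`. -/
def isOver (Γ : Term (LSig A) W (cx 1)) {s : Srt} (t : Term (LSig A) W (s.up 1)) :
    Formula (LSig A) W :=
  .eq (lftIter s.2 (lctx s.1 (s.2 + 1) t)) Γ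

/-- `L(Γ, t)`, where the variables `x` of `t` are lifted to `θ x`. -/
def liftTerm (Γ : Term (LSig A) W (cx 1)) (θ : ∀ x, Term (LSig A) W ((V.sort x).up 1)) :
    {s : Srt} → Term A V s → RTerm (LSig A) W (s.up 1)
  | _, .var x => ⟨θ x, isOver Γ (θ x)⟩
  | _, .app σ args =>
    ⟨.app (A := LSig A) (Sum.inr σ)
      (Arity.consFam (F := Term (LSig A) W) Γ (fun i => (liftTerm Γ θ (args i)).tm)),
     Formula.all (fun i => (liftTerm Γ θ (args i)).cond)⟩

/-- `L(Γ, φ)`. -/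
def liftFormula (Γ : Term (LSig A) W (cx 1)) (θ : ∀ x, Term (LSig A) W ((V.sort x).up 1)) :
    Formula A V → Formula (LSig A) W
  | .eq t t' => (liftTerm Γ θ t).eq (liftTerm Γ θ t')
  | .rel R args =>
    .and
      (.rel (A := LSig A) (Sum.inr R)
        (Arity.consFam (F := Term (LSig A) W) Γ (fun i => (liftTerm Γ θ (args i)).tm)))
      (Formula.all (fun i => (liftTerm Γ θ (args i)).cond))
  | .top => .top
  | .and φ ψ => .and (liftFormula Γ θ φ) (liftFormula Γ θ ψ)

/-- `L(Γ, t|_φ)`. -/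
def liftRTerm (Γ : Term (LSig A) W (cx 1)) (θ : ∀ x, Term (LSig A) W ((V.sort x).up 1))
    {s : Srt} (r : RTerm A V s) : RTerm (LSig A) W (s.up 1) :=
  (liftTerm Γ θ r.tm).restrict (liftFormula Γ θ r.cond)

/-- `ft^{n_i}(ctx_{p_i,n_i+1}(x_i)) = Γ` for every variable `x_i` of the arity `a.under 1`. -/
def overAll (A : Signature.{u} Srt) (a : Arity Srt) : Formula (LSig A) (a.under 1).ctx :=
  Formula.all (fun i => isOver (s := a.sort i) (ctxVar a 1) (argVar a 1 i))

end

/-- The axioms of `L(T)`, for a theory `T` with signature `A` and a map `base` from the theory of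
contexts. -/
inductive LAx {A : Signature.{u} Srt} (base : SymMap baseSig A) : Sequent (LSig A) → Prop
  | base (q : Sequent baseSig) (h : BaseAx q) : LAx base (q.incl (liftSig A))
  | ctx (p : Base) (n : ℕ) : LAx base
      ⟨((Arity.rep 1 ((p, n) : Srt)).under 1).ctx,
       isOver (s := (p, n)) (ctxVar _ 1) (argVar (Arity.rep 1 ((p, n) : Srt)) 1 0),
       (RTerm.ofTerm (lctx p (n + 1) (argVar (Arity.rep 1 ((p, n) : Srt)) 1 0))).eq
         (liftRTerm (ctxVar _ 1) (argVar (Arity.rep 1 ((p, n) : Srt)) 1)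
           (base.fn (BaseFn.ctxOf p n)))⟩
  | fn_cod (σ : A.Fn) : LAx base
      ⟨((A.fnArity σ).under 1).ctx,
       (Term.app (A := LSig A) (Sum.inr σ)
         (fun i => .var (V := ((A.fnArity σ).under 1).ctx) i)).defd,
       isOver (s := A.fnCod σ) (ctxVar _ 1)
         (.app (A := LSig A) (Sum.inr σ) (fun i => .var (V := ((A.fnArity σ).under 1).ctx) i))⟩
  | fn_arg (σ : A.Fn) (i : Fin (A.fnArity σ).len) : LAx base
      ⟨((A.fnArity σ).under 1).ctx,
       (Term.app (A := LSig A) (Sum.inr σ)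
         (fun i => .var (V := ((A.fnArity σ).under 1).ctx) i)).defd,
       isOver (s := (A.fnArity σ).sort i) (ctxVar _ 1) (argVar _ 1 i)⟩
  | pr_arg (R : A.Pr) (i : Fin (A.prArity R).len) : LAx base
      ⟨((A.prArity R).under 1).ctx,
       .rel (A := LSig A) (Sum.inr R) (fun i => .var (V := ((A.prArity R).under 1).ctx) i),
       isOver (s := (A.prArity R).sort i) (ctxVar _ 1) (argVar _ 1 i)⟩

/-- The theory `L(T)`. -/
abbrev LTheory (T : Theory.{u} Srt) (base : SymMap baseSig T.sig) : Theory.{u} Srt :=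
  ⟨LSig T.sig, {q | LAx base q}⟩

/-- The map `L(f)`. The condition `overAll` is redundant for the variables that occur in the
value of `f`. -/
def LMap {A : Signature.{u} Srt} {B : Signature.{v} Srt} (f : SymMap A B) :
    SymMap (LSig A) (LSig B) where
  fn
    | .inl b => RTerm.ofTerm (.app (A := LSig B) (Sum.inl b)
        (fun i => .var (V := (baseSig.fnArity b).ctx) i))
    | .inr σ => (liftRTerm (ctxVar _ 1) (argVar _ 1) (f.fn σ)).restrict (overAll B (A.fnArity σ))
  pr
    | .inl e => e.elim
    | .inr R => .and (liftFormula (ctxVar _ 1) (argVar _ 1) (f.pr R)) (overAll B (A.prArity R))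

/-- The data of a prestable theory: a theory `T`, a map to `T` from the theory of contexts, and
a map `L(T) → T`. -/
structure PrestableData where
  thy : Theory.{u} Srt
  base : SymMap baseSig thy.sig
  alpha : SymMap (LSig thy.sig) thy.sig

/-- `P` is a prestable theory: `base` is an interpretation, so `thy` is a theory under the theory
of contexts, and `alpha : L(T) → T` is a morphism of theories under the theory of contexts. -/
structure IsPrestable (P : PrestableData.{u}) : Prop where
  base_interp : IsInterp baseTheory P.thy P.base
  alpha_interp : IsInterp (LTheory P.thy P.base) P.thy P.alpha
  alpha_base : ∀ b : BaseFn, P.thy.REquiv (P.alpha.fn (Sum.inl b)) (P.base.fn b)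

/-- `f` is a morphism of prestable theories. -/
structure IsPrestableHom (P : PrestableData.{u}) (Q : PrestableData.{v})
    (f : SymMap P.thy.sig Q.thy.sig) : Prop where
  interp : IsInterp P.thy Q.thy f
  base : SymEquiv Q.thy (f.comp P.base) Q.base
  alpha : SymEquiv Q.thy (f.comp P.alpha) (Q.alpha.comp (LMap f))

namespace PrestableData

variable (P : PrestableData.{u})

/-- `ft^m(Γ) : (ctx, 1)` for the first variable `Γ : (ctx, m + 1)`, in `L(T)`. -/
def headCtx (A : Signature.{u} Srt) (a : Arity Srt) (m : ℕ) :
    Term (LSig A) (a.under (m + 1)).ctx (cx 1) :=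
  lftIter m (ctxVar a (m + 1))

/-- The variables of `a.under m`, lifted to those of `a.under (m + 1)`. -/
def liftVars (A : Signature.{u} Srt) (a : Arity Srt) (m : ℕ) :
    ∀ x, Term (LSig A) (a.under (m + 1)).ctx (((a.under m).sort x).up 1) :=
  Fin.cases
    (motive := fun x => Term (LSig A) (a.under (m + 1)).ctx (((a.under m).sort x).up 1))
    (ctxVar a (m + 1)) (argVar a (m + 1))

/-- The restricted term `Γ × r = αL(ft^{m-1}(Γ), αL(ft^{m-2}(Γ), … αL(Γ, r)))` in the variables
`Γ : (ctx, m)` and `x_i : (p_i, n_i + m)`. -/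
def times {a : Arity Srt} {s : Srt} (r : RTerm P.thy.sig a.ctx s) :
    (m : ℕ) → RTerm P.thy.sig (a.under m).ctx (s.up m)
  | 0 => ⟨r.tm.subst (argVar a 0), r.cond.subst (argVar a 0)⟩
  | m + 1 => P.alpha.rterm
      (liftRTerm (headCtx P.thy.sig a m) (liftVars P.thy.sig a m) (times r m))

/-- The formula `Γ × φ`. -/
def timesFormula {a : Arity Srt} (φ : Formula P.thy.sig a.ctx) :
    (m : ℕ) → Formula P.thy.sig (a.under m).ctx
  | 0 => φ.subst (argVar a 0)
  | m + 1 => P.alpha.formula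
      (liftFormula (headCtx P.thy.sig a m) (liftVars P.thy.sig a m) (timesFormula φ m))

end PrestableData

/-! ## The theory of substitutions -/

inductive Cls
  | ty
  | tm

/-- The sort `(p, n)` for `p ∈ {ty, tm}`. -/
abbrev Cls.sort : Cls → ℕ → Srt
  | .ty, n => tyS n
  | .tm, n => tmS n

inductive SubstFn
  | star
  | ft (n : ℕ)
  | ty (n : ℕ)
  | v (n : ℕ) (i : Fin n)
  | subst (p : Cls) (n k : ℕ)

abbrev substSig : Signature.{0} Srt where
  Fn := SubstFn
  fnArity
    | .star => Arity.rep 0 (cx 0)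
    | .ft n => Arity.rep 1 (tyS n)
    | .ty n => Arity.rep 1 (tmS n)
    | .v n _ => Arity.rep 1 (cx n)
    | .subst p n k => Arity.cons (cx n) (Arity.cons (p.sort k) (Arity.rep k (tmS n)))
  fnCod
    | .star => cx 0
    | .ft n => cx n
    | .ty n => tyS n
    | .v n _ => tmS n
    | .subst p n _ => p.sort n
  Pr := Empty
  prArity := Empty.elim

namespace SubT

/-- Terms of the theory of substitutions. -/
abbrev Tm (V : Ctx Srt) (s : Srt) : Type := Term substSig V s

variable {V : Ctx Srt}

def star : Tm V (cx 0) := .app (A := substSig) SubstFn.star (fun i => Fin.elim0 i)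

def ft (n : ℕ) (t : Tm V (cx (n + 1))) : Tm V (cx n) :=
  .app (A := substSig) (SubstFn.ft n) (fun _ => t)

def ty (n : ℕ) (t : Tm V (tmS n)) : Tm V (tyS n) :=
  .app (A := substSig) (SubstFn.ty n) (fun _ => t)

def v (n : ℕ) (i : Fin n) (t : Tm V (cx n)) : Tm V (tmS n) :=
  .app (A := substSig) (SubstFn.v n i) (fun _ => t)

/-- `subst_{p,n,k}(B, t, a₁, …, a_k)`. -/
def subst (p : Cls) (n k : ℕ) (B : Tm V (cx n)) (t : Tm V (p.sort k))
    (a : Fin k → Tm V (tmS n)) : Tm V (p.sort n) :=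
  .app (A := substSig) (SubstFn.subst p n k)
    (Arity.consFam (F := Tm V) B
      (Arity.consFam (F := Tm V) (a := Arity.rep k (tmS n)) t a))

/-- `ft^i_n : (ctx, n + i) → (ctx, n)`. -/
def ftIter (n : ℕ) : (i : ℕ) → Tm V (cx (n + i)) → Tm V (cx n)
  | 0, t => t
  | i + 1, t => ftIter n i (ft (n + i) t)

/-- `ft^n : (ctx, n + 1) → (ctx, 1)`. -/
def ftOne : (n : ℕ) → Tm V (cx (n + 1)) → Tm V (cx 1)
  | 0, t => t
  | n + 1, t => ftOne n (ft (n + 1) t)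

/-- `ctx_{p,n}` for `p ∈ {ty, tm}`. -/
def ctxOf : (p : Cls) → (n : ℕ) → Tm V (p.sort n) → Tm V (cx n)
  | .ty, n, t => ft n t
  | .tm, n, t => ft n (ty n t)

/-- `Hom_{n,k}(B, A, a₁, …, a_k)`. -/
def hom (n : ℕ) : (k : ℕ) → Tm V (cx n) → Tm V (cx k) → (Fin k → Tm V (tmS n)) →
    Formula substSig V
  | 0, _, _, _ => .top
  | k + 1, B, A, a =>
    .and (hom n k B (ft k A) (fun i => a i.castSucc))
      (.eq (ty n (a (Fin.last k))) (subst .ty n k B A (fun i => a i.castSucc)))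

/-- The variables `v_{n,n-1}(A), …, v_{n,n-j}(A)`. -/
def vars (n j : ℕ) (h : j ≤ n) (A : Tm V (cx n)) (r : Fin j) : Tm V (tmS n) :=
  v n (Fin.castLE h r).rev A

end SubT

/-- The names of the axioms of the theory of substitutions. -/
inductive SubstAxName
  | star
  | star_unique
  | def_var (n : ℕ) (i : Fin n)
  | def_subst (p : Cls) (n k : ℕ)
  | def_subst_conv (p : Cls) (n k : ℕ)
  | type_var (j i : ℕ)
  | type_subst_ty (n k : ℕ)
  | type_subst_tm (n k : ℕ)
  | type_subst_tm_conv (n k : ℕ)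
  | subst_var (p : Cls) (n : ℕ)
  | var_subst (n k : ℕ) (i : Fin k)
  | subst_subst (p : Cls) (n k m : ℕ)

open SubT in
/-- The axioms of the theory of substitutions. -/
def substAx : SubstAxName → Sequent substSig
  | .star =>
    ⟨Ctx.rep 0 (cx 0), .top, star.defd⟩
  | .star_unique =>
    ⟨Ctx.rep 1 (cx 0), .top, .eq (Term.varOf (0 : Fin 1)) star⟩
  | .def_var n i =>
    ⟨Ctx.rep 1 (cx n), .top, (v n i (Term.varOf (0 : Fin 1))).defd⟩
  | .def_subst p n k =>
    let V := Ctx.cons (cx n) (Ctx.cons (p.sort k) (Ctx.rep k (tmS n)))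
    let B : Tm V (cx n) := Term.varOf none
    let t : Tm V (p.sort k) := Term.varOf (some none)
    let a : Fin k → Tm V (tmS n) := fun i => Term.varOf (some (some i))
    ⟨V, hom n k B (ctxOf p k t) a, (subst p n k B t a).defd⟩
  | .def_subst_conv p n k =>
    let V := Ctx.cons (cx n) (Ctx.cons (p.sort k) (Ctx.rep k (tmS n)))
    let B : Tm V (cx n) := Term.varOf none
    let t : Tm V (p.sort k) := Term.varOf (some none)
    let a : Fin k → Tm V (tmS n) := fun i => Term.varOf (some (some i))
    ⟨V, (subst p n k B t a).defd, hom n k B (ctxOf p k t) a⟩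
  -- Here the index `n` is `j + 1 + i`.
  | .type_var j i =>
    let V := Ctx.rep 1 (cx (j + 1 + i))
    let A : Tm V (cx (j + 1 + i)) := Term.varOf (0 : Fin 1)
    ⟨V, .top,
      .eq (ty (j + 1 + i) (v (j + 1 + i) ⟨i, by omega⟩ A))
        (subst .ty (j + 1 + i) j A (ftIter (j + 1) i A)
          (vars (j + 1 + i) j (by omega) A))⟩
  | .type_subst_ty n k =>
    let V := Ctx.cons (cx n) (Ctx.cons (tyS k) (Ctx.rep k (tmS n)))
    let B : Tm V (cx n) := Term.varOf none
    let A : Tm V (tyS k) := Term.varOf (some none)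
    let a : Fin k → Tm V (tmS n) := fun i => Term.varOf (some (some i))
    ⟨V, hom n k B (ft k A) a, .eq (ft n (subst .ty n k B A a)) B⟩
  | .type_subst_tm n k =>
    let V := Ctx.cons (cx n) (Ctx.cons (tmS k) (Ctx.rep k (tmS n)))
    let B : Tm V (cx n) := Term.varOf none
    let t : Tm V (tmS k) := Term.varOf (some none)
    let a : Fin k → Tm V (tmS n) := fun i => Term.varOf (some (some i))
    ⟨V, (ty n (subst .tm n k B t a)).defd,
      .eq (ty n (subst .tm n k B t a)) (subst .ty n k B (ty k t) a)⟩
  | .type_subst_tm_conv n k =>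
    let V := Ctx.cons (cx n) (Ctx.cons (tmS k) (Ctx.rep k (tmS n)))
    let B : Tm V (cx n) := Term.varOf none
    let t : Tm V (tmS k) := Term.varOf (some none)
    let a : Fin k → Tm V (tmS n) := fun i => Term.varOf (some (some i))
    ⟨V, (subst .ty n k B (ty k t) a).defd,
      .eq (ty n (subst .tm n k B t a)) (subst .ty n k B (ty k t) a)⟩
  | .subst_var p n =>
    let V := Ctx.rep 1 (p.sort n)
    let t : Tm V (p.sort n) := Term.varOf (0 : Fin 1)
    ⟨V, .top,
      .eq (subst p n n (ctxOf p n t) t (vars n n le_rfl (ctxOf p n t))) t⟩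
  | .var_subst n k i =>
    let V := Ctx.cons (cx n) (Ctx.cons (cx k) (Ctx.rep k (tmS n)))
    let B : Tm V (cx n) := Term.varOf none
    let A : Tm V (cx k) := Term.varOf (some none)
    let a : Fin k → Tm V (tmS n) := fun i => Term.varOf (some (some i))
    ⟨V, hom n k B A a, .eq (subst .tm n k B (v k i A) a) (a i.rev)⟩
  | .subst_subst p n k m =>
    let V := Ctx.cons (cx n) (Ctx.cons (cx k) (Ctx.cons (p.sort m)
      (Ctx.append (Ctx.rep k (tmS n)) (Ctx.rep m (tmS k)))))
    let C : Tm V (cx n) := Term.varOf none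
    let B : Tm V (cx k) := Term.varOf (some none)
    let t : Tm V (p.sort m) := Term.varOf (some (some none))
    let b : Fin k → Tm V (tmS n) := fun i => Term.varOf (some (some (some (Sum.inl i))))
    let a : Fin m → Tm V (tmS k) := fun i => Term.varOf (some (some (some (Sum.inr i))))
    ⟨V, .and (hom n k C B b) (hom k m B (ctxOf p m t) a),
      .eq (subst p n k C (subst p k m B t a) b)
        (subst p n m C t (fun i => subst .tm n k C (a i) b))⟩

/-- The theory of substitutions. -/
abbrev substTheory : Theory.{0} Srt := ⟨substSig, Set.range substAx⟩

/-- The map to the theory of substitutions from the theory of contexts. -/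
def substBase : SymMap baseSig substSig where
  fn
    | .star => RTerm.ofTerm SubT.star
    | .ft n => RTerm.ofTerm (SubT.ft n (Term.varOf (0 : Fin 1)))
    | .ctxOf .ctx _ => RTerm.ofTerm (Term.varOf (0 : Fin 1))
    | .ctxOf .tm n => RTerm.ofTerm (SubT.ctxOf .tm n (Term.varOf (0 : Fin 1)))
  pr := Empty.rec

/-- `L(subst_{p,n,k})(Γ, Δ, t, a₁, …, a_k)` is interpreted as
`subst_{p,n+1,k+1}(Δ, t, v_{n+1,n}(Δ), a₁, …, a_k)` restricted to `ft^n(Δ) = Γ` and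
`ft^k(ctx_{p,k+1}(t)) = Γ`. -/
def substAlphaSubst {V : Ctx Srt} (p : Cls) (n k : ℕ) (Γ : SubT.Tm V (cx 1))
    (Δ : SubT.Tm V (cx (n + 1))) (t : SubT.Tm V (p.sort (k + 1)))
    (a : Fin k → SubT.Tm V (tmS (n + 1))) : RTerm substSig V (p.sort (n + 1)) :=
  ⟨SubT.subst p (n + 1) (k + 1) Δ t
     (Fin.cons (α := fun _ => SubT.Tm V (tmS (n + 1))) (SubT.v (n + 1) (Fin.last n) Δ) a),
   .and (.eq (SubT.ftOne n Δ) Γ) (.eq (SubT.ftOne k (SubT.ctxOf p (k + 1) t)) Γ)⟩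

/-- The map `L(𝕊) → 𝕊` for the theory `𝕊` of substitutions. -/
def substAlpha : SymMap (LSig substSig) substSig where
  fn
    | .inl b => substBase.fn b
    | .inr .star => RTerm.ofTerm (ctxVar (Arity.rep 0 (cx 0)) 1)
    | .inr (.ft n) =>
      let Γ : SubT.Tm _ (cx 1) := ctxVar (Arity.rep 1 (tyS n)) 1
      let A : SubT.Tm _ (tyS (n + 1)) := argVar (Arity.rep 1 (tyS n)) 1 0
      ⟨SubT.ft (n + 1) A, .eq (SubT.ftOne n (SubT.ft (n + 1) A)) Γ⟩
    | .inr (.ty n) =>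
      let Γ : SubT.Tm _ (cx 1) := ctxVar (Arity.rep 1 (tmS n)) 1
      let t : SubT.Tm _ (tmS (n + 1)) := argVar (Arity.rep 1 (tmS n)) 1 0
      ⟨SubT.ty (n + 1) t, .eq (SubT.ftOne n (SubT.ctxOf .tm (n + 1) t)) Γ⟩
    | .inr (.v n i) =>
      let Γ : SubT.Tm _ (cx 1) := ctxVar (Arity.rep 1 (cx n)) 1
      let Δ : SubT.Tm _ (cx (n + 1)) := argVar (Arity.rep 1 (cx n)) 1 0
      ⟨SubT.v (n + 1) i.castSucc Δ, .eq (SubT.ftOne n Δ) Γ⟩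
    | .inr (.subst .ty n k) =>
      let ar := Arity.cons (cx n) (Arity.cons (tyS k) (Arity.rep k (tmS n)))
      substAlphaSubst .ty n k (ctxVar ar 1) (argVar ar 1 (0 : Fin (k + 2)))
        (argVar ar 1 (0 : Fin (k + 1)).succ) (fun i => argVar ar 1 i.succ.succ)
    | .inr (.subst .tm n k) =>
      let ar := Arity.cons (cx n) (Arity.cons (tmS k) (Arity.rep k (tmS n)))
      substAlphaSubst .tm n k (ctxVar ar 1) (argVar ar 1 (0 : Fin (k + 2)))
        (argVar ar 1 (0 : Fin (k + 1)).succ) (fun i => argVar ar 1 i.succ.succ)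
  pr
    | .inl e => e.elim
    | .inr e => e.elim

/-- The prestable theory of substitutions. -/
def substPrestable : PrestableData.{0} := ⟨substTheory, substBase, substAlpha⟩

/-! ## Algebraic dependent type theories -/

namespace SubT

variable {V : Ctx Srt}

/-- The terms `wk^{j,0}_{tm,n}(B, a₁), …, wk^{j,0}_{tm,n}(B, a_k), v_{j-1}(B), …, v_0(B)`. -/
def liftArgs (n k j : ℕ) (B : Tm V (cx (n + j))) (a : Fin k → Tm V (tmS n)) :
    Fin (k + j) → Tm V (tmS (n + j)) :=
  Fin.addCases (motive := fun _ => Tm V (tmS (n + j)))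
    (fun i => subst .tm (n + j) n B (a i) (vars (n + j) n (Nat.le_add_right n j) B))
    (fun i => v (n + j) (Fin.natAdd n i).rev B)

/-- `subst^j_{ctx,n,k} : (ctx, n) × (ctx, k + j) × (tm, n)^k → (ctx, n + j)`. -/
def substCtx (n k : ℕ) (B : Tm V (cx n)) (a : Fin k → Tm V (tmS n)) :
    (j : ℕ) → Tm V (cx (k + j)) → Tm V (cx (n + j))
  | 0, _ => B
  | j + 1, A =>
    let B' := substCtx n k B a j (ft (k + j) A)
    subst .ty (n + j) (k + j) B' A (liftArgs n k j B' a)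

/-- `subst^j_{tm,n,k} : (ctx, n) × (tm, k + j) × (tm, n)^k → (tm, n + j)`. -/
def substTm (n k : ℕ) (B : Tm V (cx n)) (a : Fin k → Tm V (tmS n)) (j : ℕ)
    (t : Tm V (tmS (k + j))) : Tm V (tmS (n + j)) :=
  let B' := substCtx n k B a j (ctxOf .tm (k + j) t)
  subst .tm (n + j) (k + j) B' t (liftArgs n k j B' a)

/-- `subst^j_{p,n,k}` for a sort `s = (p, j)`, with `p ∈ {ctx, tm}`. -/
def substUp (n k : ℕ) (B : Tm V (cx n)) : (s : Srt) → Tm V (s.up k) →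
    (Fin k → Tm V (tmS n)) → Tm V (s.up n)
  | (.ctx, j), t, a =>
    (substCtx n k B a j (t.cast (congrArg cx (Nat.add_comm j k)))).cast
      (congrArg cx (Nat.add_comm n j))
  | (.tm, j), t, a =>
    (substTm n k B a j (t.cast (congrArg tmS (Nat.add_comm j k)))).cast
      (congrArg tmS (Nat.add_comm n j))

end SubT

section

variable (T : PrestableData.{u}) (f : SymMap substSig T.thy.sig)

/-- The variables `Γ : (ctx, l)`, `Δ : (ctx, m)`, `a_i : (tm, l)` for `1 ≤ i ≤ m`, and
`b_i : (p_i, n_i + m)`. -/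
abbrev commCtx (ar : Arity Srt) (l m : ℕ) : Ctx Srt :=
  Ctx.cons (cx l) (Ctx.cons (cx m) (Ctx.append (Ctx.rep m (tmS l)) (ar.up m).ctx))

namespace Comm

variable {A : Signature.{u} Srt} (ar : Arity Srt) (l m : ℕ)

def Γ : Term A (commCtx ar l m) (cx l) := Term.varOf (V := commCtx ar l m) none

def Δ : Term A (commCtx ar l m) (cx m) := Term.varOf (V := commCtx ar l m) (some none)

def a (i : Fin m) : Term A (commCtx ar l m) (tmS l) :=
  Term.varOf (V := commCtx ar l m) (some (some (.inl i)))

def b (i : Fin ar.len) : Term A (commCtx ar l m) ((ar.sort i).up m) :=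
  Term.varOf (V := commCtx ar l m) (some (some (.inr i)))

/-- The arguments of `Δ × σ(b₁, …, b_k)`. -/
def args : ∀ i, RTerm A (commCtx ar l m) ((ar.under m).sort i) :=
  Arity.consFam (F := RTerm A (commCtx ar l m)) (a := ar.up m)
    (RTerm.ofTerm (Δ ar l m)) (fun i => RTerm.ofTerm (b ar l m i))

/-- The arguments of `Γ × σ(b'₁, …, b'_k)`, where
`b'_i = subst^{n_i}_{p_i,l,m}(Γ, b_i, a₁, …, a_m)`. -/
def args' (f : SymMap substSig A) : ∀ i, RTerm A (commCtx ar l m) ((ar.under l).sort i) :=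
  Arity.consFam (F := RTerm A (commCtx ar l m)) (a := ar.up l)
    (RTerm.ofTerm (Γ ar l m))
    (fun i => f.term (SubT.substUp l m (Γ ar l m) (ar.sort i) (b ar l m i) (a ar l m)))

/-- `subst^n_{p,l,m}(Γ, r, a₁, …, a_m)` for a restricted term `r`. -/
def substOf (f : SymMap substSig A) (s : Srt) (r : RTerm A (commCtx ar l m) (s.up m)) :
    RTerm A (commCtx ar l m) (s.up l) :=
  let V := Arity.cons (cx l) (Arity.cons (s.up m) (Arity.rep m (tmS l)))
  (f.term (SubT.substUp l m (Term.varOf (V := V.ctx) (0 : Fin (m + 2))) s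
      (Term.varOf (V := V.ctx) (0 : Fin (m + 1)).succ)
      (fun i => Term.varOf (V := V.ctx) i.succ.succ))).subst
    (Arity.consFam (F := RTerm A (commCtx ar l m)) (RTerm.ofTerm (Γ ar l m))
      (Arity.consFam (F := RTerm A (commCtx ar l m)) (a := Arity.rep m (tmS l)) r
        (fun i => RTerm.ofTerm (a ar l m i))))

end Comm

/-- Substitution commutes with the function symbol `σ`. -/
def SubstCommFn (σ : T.thy.sig.Fn) : Prop :=
  ∀ l m : ℕ,
    let ar := T.thy.sig.fnArity σ
    let σx := RTerm.ofTerm (.app σ (fun i => .var (V := ar.ctx) i))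
    let Δσ := (T.times σx m).subst (Comm.args ar l m)
    let Γσ' := (T.times σx l).subst (Comm.args' ar l m f)
    T.thy.Derivable
      (.and Δσ.defd
        (f.formula (SubT.hom l m (Comm.Γ ar l m) (Comm.Δ ar l m) (Comm.a ar l m))))
      ((Comm.substOf ar l m f (T.thy.sig.fnCod σ) Δσ).eq Γσ')

/-- Substitution commutes with the predicate symbol `R`. -/
def SubstCommPr (R : T.thy.sig.Pr) : Prop :=
  ∀ l m : ℕ,
    let ar := T.thy.sig.prArity R
    let Rx := Formula.rel R (fun i => .var (V := ar.ctx) i)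
    T.thy.Derivable
      (.and ((T.timesFormula Rx m).rsubst (Comm.args ar l m))
        (f.formula (SubT.hom l m (Comm.Γ ar l m) (Comm.Δ ar l m) (Comm.a ar l m))))
      ((T.timesFormula Rx l).rsubst (Comm.args' ar l m f))

/-- The prestable theory `T` with the map `f` from the theory of substitutions is an algebraic
dependent type theory. -/
structure IsADTT : Prop where
  prestable : IsPrestable T
  hom : IsPrestableHom substPrestable T f
  comm_fn : ∀ σ, SubstCommFn T f σ
  comm_pr : ∀ R, SubstCommPr T f R

end

/-! ## Contextual theories -/

/-- Basic function symbols and basic predicate symbols of a contextual theory. -/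
structure BasicSymbols where
  sig : Signature.{u} Srt
  cod_ne : ∀ σ, sig.fnCod σ ≠ cx 0

/-- The symbols `σ_m` and `R_m`. -/
abbrev indexedSig (A : Signature.{u} Srt) : Signature.{u} Srt where
  Fn := A.Fn × ℕ
  fnArity q := (A.fnArity q.1).under q.2
  fnCod q := (A.fnCod q.1).up q.2
  Pr := A.Pr × ℕ
  prArity q := (A.prArity q.1).under q.2

/-- The data of a contextual theory under the theory of substitutions: the basic symbols, and a
set of axioms that contains the axioms of the theory of substitutions. -/
structure ContextualData where
  basic : BasicSymbols.{u}
  axms : Set (Sequent (substSig.sum (indexedSig basic.sig)))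
  subst_axms : ∀ c, (substAx c).incl (indexedSig basic.sig) ∈ axms

namespace ContextualData

variable (C : ContextualData.{u})

abbrev sig : Signature.{u} Srt := substSig.sum (indexedSig C.basic.sig)

/-- The first argument `Γ : (ctx, 1)` of `L(σ_m)` and `L(R_m)`. -/
def liftΓ (a : Arity Srt) (m : ℕ) : Term substSig ((a.under m).under 1).ctx (cx 1) :=
  ctxVar (a.under m) 1

/-- The second argument `Δ : (ctx, m + 1)` of `L(σ_m)` and `L(R_m)`. -/
def liftΔ (a : Arity Srt) (m : ℕ) : Term substSig ((a.under m).under 1).ctx (cx (m + 1)) :=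
  argVar (a.under m) 1 (0 : Fin (a.len + 1))

/-- The arguments `Δ, x₁, …, x_k` of `σ_{m+1}` and `R_{m+1}`. -/
def liftArgs (a : Arity Srt) (m : ℕ) :
    ∀ i, Term C.sig ((a.under m).under 1).ctx ((a.under (m + 1)).sort i) :=
  Arity.consFam (F := Term C.sig ((a.under m).under 1).ctx) (a := a.up (m + 1))
    ((liftΔ a m).incl _) (fun i => argVar (a.under m) 1 i.succ)

/-- `ft^m(Δ) = Γ`. -/
def liftCond (a : Arity Srt) (m : ℕ) : Formula C.sig ((a.under m).under 1).ctx :=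
  Formula.incl _ (.eq (SubT.ftOne m (liftΔ a m)) (liftΓ a m))

/-- The map `L(T) → T`; it sends `L(σ_m)(Γ, Δ, x₁, …, x_k)` to `σ_{m+1}(Δ, x₁, …, x_k)` and
`L(R_m)(Γ, Δ, x₁, …, x_k)` to `R_{m+1}(Δ, x₁, …, x_k)`, both restricted to `ft^m(Δ) = Γ`, and is
defined on the symbols of the theory of substitutions as it is for that theory. -/
def alpha : SymMap (LSig C.sig) C.sig where
  fn
    | .inl b => (substBase.fn b).incl _
    | .inr (.inl τ) => (substAlpha.fn (.inr τ)).incl _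
    | .inr (.inr (σ, m)) =>
      ⟨.app (A := C.sig) (Sum.inr (σ, m + 1)) (C.liftArgs (C.basic.sig.fnArity σ) m),
       C.liftCond (C.basic.sig.fnArity σ) m⟩
  pr
    | .inl e => e.elim
    | .inr (.inl e) => e.elim
    | .inr (.inr (R, m)) =>
      .and (.rel (A := C.sig) (Sum.inr (R, m + 1)) (C.liftArgs (C.basic.sig.prArity R) m))
        (C.liftCond (C.basic.sig.prArity R) m)

def toPrestable : PrestableData.{u} where
  thy := ⟨C.sig, C.axms⟩
  base := ⟨fun b => (substBase.fn b).incl _, Empty.rec⟩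
  alpha := C.alpha

/-- The inclusion of the theory of substitutions. -/
def inclusion : SymMap substSig C.toPrestable.thy.sig where
  fn τ := RTerm.ofTerm (.app (A := C.sig) (Sum.inl τ)
    (fun i => .var (V := (substSig.fnArity τ).ctx) i))
  pr := Empty.rec

/-- `C` is a contextual theory under the theory of substitutions. -/
structure IsContextual : Prop where
  prestable : IsPrestable C.toPrestable
  hom : IsPrestableHom substPrestable C.toPrestable C.inclusion

end ContextualData

/-- `T` and `T'`, with maps `f` and `f'` from the theory of substitutions, are isomorphic as
prestable theories under the theory of substitutions. -/
def IsoUnderSubst (T : PrestableData.{u}) (f : SymMap substSig T.thy.sig)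
    (T' : PrestableData.{v}) (f' : SymMap substSig T'.thy.sig) : Prop :=
  ∃ (g : SymMap T.thy.sig T'.thy.sig) (h : SymMap T'.thy.sig T.thy.sig),
    IsPrestableHom T T' g ∧ IsPrestableHom T' T h ∧
    SymEquiv T'.thy (g.comp f) f' ∧ SymEquiv T.thy (h.comp f') f ∧
    SymEquiv T.thy (h.comp g) (SymMap.id T.thy.sig) ∧
    SymEquiv T'.thy (g.comp h) (SymMap.id T'.thy.sig)

end PHT

-- The argument is semantic. Partial Horn logic is sound and complete for partial structures
-- (`Theory.derivable_iff`), so an equivalence of assignments becomes an equation between reducts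
-- `M.pull f` of models, and an interpretation is an assignment along which reducts of models are
-- models.
--
-- The mathematical core is a way to cut an operation `σ` with values in `(p, n)` into operations
-- with values in `(ty, 0)` and `(tm, 0)`. A value `u = σ(x)` consists of pieces: the successive
-- types of its context and, if `u` is a term, `u` itself. A piece lives over an initial segment `τ`
-- of the context of `u`, of some length `j`. The basic symbol for this piece takes `x` and `j`
-- further terms and returns the piece with these terms substituted for the variables of `τ`; in a
-- context `Δ` it is interpreted by `subst(Δ, piece of Δ × σ(x), variables of Δ, a₁, …, a_j)`.
-- Conversely, the piece is recovered from its symbol: weaken `x` to the context `τ` and insert the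
-- variables of `τ`. Since substitution commutes with `σ`, the value of `τ × σ` at the weakened
-- arguments is the weakening of `u` along `τ`, and weakening followed by substitution along the
-- diagonal is the identity (`SOps.mem_sub_of_subP`). The segment `τ` is itself built from earlier
-- pieces, so induction on `j` expresses `σ` through the basic symbols (`exists_fnTerm`). The
-- resulting term may be defined where `σ` is not, so a predicate for the domain of `σ` is added;
-- predicate symbols of the theory are kept.
--
-- The axioms of the contextual theory are all sequents whose interpretation in `T` is a theorem.
-- Hence the interpretation `partMap` is conservative and the reducts of models of `T` along it
-- detect derivability (`IsADTT.detects`). On these reducts `fnMap` recovers the given model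
-- (`pull_pull_fnMap`), which makes the two interpretations mutually inverse.
--
-- It remains to treat `α`. In a structure for `L(T)` the elements over a fixed `γ` form a structure
-- for `T`, its slice; `L(Γ, t)` is evaluated as `t` in the slice (`Str.mem_evR_liftTerm`), and
-- `L(f)` acts on slices as `f` (`Str.slice_pull_LMap`). Compatibility with `α` thus says that a
-- symbol with index `m + 1` in a model is the symbol with index `m` in a slice
-- (`IsADTT.mem_partMap_fn_succ`). Slices of models of `T` need not be models of `T`, because the
-- axioms of `L(T)` do not include liftings of the axioms of `T`. The reconstruction therefore only
-- uses the properties collected in `Good`, which pass from a model to its slices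
-- (`IsADTT.slice_good`): the substitution operations again satisfy the axioms, and weakening in a
-- slice is, in the model, substitution of the first variable.

universe u'

namespace PHT

/-! ## Partial structures -/

/-- A family of partial elements as a partial family. -/
def partFamily {ι : Type*} {α : ι → Type*} (f : ∀ i, Part (α i)) : Part (∀ i, α i) :=
  ⟨∀ i, (f i).Dom, fun h i => (f i).get (h i)⟩

theorem mem_partFamily {ι : Type*} {α : ι → Type*} {f : ∀ i, Part (α i)} {y : ∀ i, α i} :
    y ∈ partFamily f ↔ ∀ i, y i ∈ f i := by
  constructor
  · rintro ⟨h, rfl⟩ i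
    exact Part.get_mem _
  · intro h
    exact ⟨fun i => (h i).1, funext fun i => (h i).2⟩

/-- A partial structure of the signature `A` on the family of sets `K`. -/
@[ext]
structure Str {S : Type} (A : Signature.{u} S) (K : S → Type v) where
  fn : ∀ σ, (∀ i, K ((A.fnArity σ).sort i)) → Part (K (A.fnCod σ))
  pr : ∀ R, (∀ i, K ((A.prArity R).sort i)) → Prop

namespace Str

variable {S : Type} {A : Signature.{u} S} {B : Signature.{w} S} {K : S → Type v} {V W : Ctx S}

/-- The value of a term. -/
def ev (M : Str A K) (ρ : ∀ x, K (V.sort x)) : {s : S} → Term A V s → Part (K s)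
  | _, .var x => Part.some (ρ x)
  | _, .app σ args => (partFamily fun i => M.ev ρ (args i)).bind (M.fn σ)

/-- Satisfaction of a formula. -/
def sat (M : Str A K) (ρ : ∀ x, K (V.sort x)) : Formula A V → Prop
  | .eq t t' => ∃ y, y ∈ M.ev ρ t ∧ y ∈ M.ev ρ t'
  | .rel R args => ∃ ys, (∀ i, ys i ∈ M.ev ρ (args i)) ∧ M.pr R ys
  | .top => True
  | .and φ ψ => M.sat ρ φ ∧ M.sat ρ ψ

/-- The value of a restricted term. -/
def evR (M : Str A K) (ρ : ∀ x, K (V.sort x)) {s : S} (r : RTerm A V s) : Part (K s) :=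
  Part.assert (M.sat ρ r.cond) fun _ => M.ev ρ r.tm

variable (M : Str A K) (ρ : ∀ x, K (V.sort x))

@[simp] theorem ev_var (x : V.Var) : M.ev ρ (.var x) = Part.some (ρ x) := rfl

theorem mem_ev_app {σ : A.Fn} {args : ∀ i, Term A V ((A.fnArity σ).sort i)}
    {y : K (A.fnCod σ)} :
    y ∈ M.ev ρ (.app σ args) ↔ ∃ ys, (∀ i, ys i ∈ M.ev ρ (args i)) ∧ y ∈ M.fn σ ys := by
  rw [ev, Part.mem_bind_iff]
  simp only [mem_partFamily]

theorem ev_app {σ : A.Fn} {args : ∀ i, Term A V ((A.fnArity σ).sort i)}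
    {ys : ∀ i, K ((A.fnArity σ).sort i)} (h : ∀ i, ys i ∈ M.ev ρ (args i)) :
    M.ev ρ (.app σ args) = M.fn σ ys := by
  rw [ev, Part.eq_some_iff.2 (mem_partFamily.2 h), Part.bind_some]

theorem ev_app_vars (σ : A.Fn) (ys : ∀ i, K ((A.fnArity σ).sort i)) :
    M.ev (V := (A.fnArity σ).ctx) ys (.app σ fun i => .var (V := (A.fnArity σ).ctx) i) =
      M.fn σ ys :=
  M.ev_app _ fun _ => Part.mem_some _

theorem mem_evR {s : S} {r : RTerm A V s} {y : K s} :
    y ∈ M.evR ρ r ↔ y ∈ M.ev ρ r.tm ∧ M.sat ρ r.cond := by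
  rw [evR, Part.mem_assert_iff]
  exact ⟨fun ⟨h, h'⟩ => ⟨h', h⟩, fun ⟨h, h'⟩ => ⟨h', h⟩⟩

@[simp] theorem sat_eq {s : S} (t t' : Term A V s) :
    M.sat ρ (.eq t t') ↔ ∃ y, y ∈ M.ev ρ t ∧ y ∈ M.ev ρ t' := Iff.rfl
@[simp] theorem sat_rel (R : A.Pr) (args : ∀ i, Term A V ((A.prArity R).sort i)) :
    M.sat ρ (.rel R args) ↔ ∃ ys, (∀ i, ys i ∈ M.ev ρ (args i)) ∧ M.pr R ys := Iff.rfl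
@[simp] theorem sat_top : M.sat ρ .top ↔ True := Iff.rfl
@[simp] theorem sat_and (φ ψ : Formula A V) : M.sat ρ (.and φ ψ) ↔ M.sat ρ φ ∧ M.sat ρ ψ := Iff.rfl
@[simp] theorem sat_defd {s : S} (t : Term A V s) : M.sat ρ t.defd ↔ ∃ y, y ∈ M.ev ρ t := by
  simp [Term.defd]

theorem sat_rel_iff {R : A.Pr} {args : ∀ i, Term A V ((A.prArity R).sort i)}
    {ys : ∀ i, K ((A.prArity R).sort i)} (h : ∀ i, ys i ∈ M.ev ρ (args i)) :
    M.sat ρ (.rel R args) ↔ M.pr R ys := by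
  rw [sat_rel]
  refine ⟨fun ⟨zs, hz, hp⟩ => ?_, fun hp => ⟨ys, h, hp⟩⟩
  rwa [show ys = zs from funext fun i => Part.mem_unique (h i) (hz i)]

@[simp] theorem sat_all {n : ℕ} (φ : Fin n → Formula A V) :
    M.sat ρ (Formula.all φ) ↔ ∀ i, M.sat ρ (φ i) := by
  induction n with
  | zero => simp [Formula.all]
  | succ n ih => simp [Formula.all, ih, Fin.forall_fin_succ]

@[simp] theorem evR_ofTerm {s : S} (t : Term A V s) : M.evR ρ (.ofTerm t) = M.ev ρ t :=
  Part.ext fun y => by simp [mem_evR, RTerm.ofTerm]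

theorem sat_rdefd {s : S} (r : RTerm A V s) : M.sat ρ r.defd ↔ ∃ y, y ∈ M.evR ρ r := by
  simp [RTerm.defd, mem_evR]

theorem sat_req {s : S} (r r' : RTerm A V s) :
    M.sat ρ (r.eq r') ↔ ∃ y, y ∈ M.evR ρ r ∧ y ∈ M.evR ρ r' := by
  simp only [RTerm.eq, mem_evR, sat_and, sat_eq]
  constructor
  · rintro ⟨⟨y, h, h'⟩, c, c'⟩
    exact ⟨y, ⟨h, c⟩, h', c'⟩
  · rintro ⟨y, ⟨h, c⟩, h', c'⟩
    exact ⟨⟨y, h, h'⟩, c, c'⟩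

theorem mem_evR_restrict {s : S} {r : RTerm A V s} {φ : Formula A V} {y : K s} :
    y ∈ M.evR ρ (r.restrict φ) ↔ y ∈ M.evR ρ r ∧ M.sat ρ φ := by
  simp [mem_evR, RTerm.restrict, and_assoc]

/-! ### Substitution -/

variable {M} in
theorem ev_subst {ρ : ∀ x, K (W.sort x)} {θ : ∀ x, Term A W (V.sort x)}
    {ρ' : ∀ x, K (V.sort x)} (h : ∀ x, ρ' x ∈ M.ev ρ (θ x)) :
    ∀ {s : S} (t : Term A V s), M.ev ρ (t.subst θ) = M.ev ρ' t
  | _, .var x => Part.eq_some_iff.2 (h x)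
  | _, .app σ args => by
    simp only [Term.subst, ev]
    congr 2
    funext i
    exact ev_subst h (args i)

variable {M} in
theorem sat_subst {ρ : ∀ x, K (W.sort x)} {θ : ∀ x, Term A W (V.sort x)}
    {ρ' : ∀ x, K (V.sort x)} (h : ∀ x, ρ' x ∈ M.ev ρ (θ x)) (φ : Formula A V) :
    M.sat ρ (φ.subst θ) ↔ M.sat ρ' φ := by
  induction φ with
  | eq t t' => simp only [Formula.subst, sat_eq, ev_subst h]
  | rel R args => simp only [Formula.subst, sat_rel, ev_subst h]
  | top => rfl
  | and φ ψ h1 h2 => simp only [Formula.subst, sat_and, h1, h2]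

theorem mem_evR_subst {a : Arity S} {s : S} {r : RTerm A a.ctx s}
    {θ : ∀ i, RTerm A V (a.sort i)} {y : K s} :
    y ∈ M.evR ρ (r.subst θ) ↔
      ∃ ys : ∀ i, K (a.sort i), (∀ i, ys i ∈ M.evR ρ (θ i)) ∧ y ∈ M.evR (V := a.ctx) ys r := by
  rw [mem_evR]
  simp only [RTerm.subst, sat_and, sat_all, sat_rdefd]
  constructor
  · rintro ⟨h, h', h''⟩
    choose ys hys using h''
    have e : ∀ x : a.ctx.Var, ys x ∈ M.ev ρ (θ x).tm := fun x => ((M.mem_evR ρ).1 (hys x)).1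
    rw [ev_subst (V := a.ctx) e] at h
    rw [sat_subst (V := a.ctx) e] at h'
    exact ⟨ys, hys, (M.mem_evR _).2 ⟨h, h'⟩⟩
  · rintro ⟨ys, hys, h⟩
    have e : ∀ x : a.ctx.Var, ys x ∈ M.ev ρ (θ x).tm := fun x => ((M.mem_evR ρ).1 (hys x)).1
    rw [ev_subst (V := a.ctx) e, sat_subst (V := a.ctx) e]
    obtain ⟨h1, h2⟩ := (M.mem_evR _).1 h
    exact ⟨h1, h2, fun i => ⟨_, hys i⟩⟩

theorem evR_subst {a : Arity S} {s : S} {r : RTerm A a.ctx s}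
    {θ : ∀ i, RTerm A V (a.sort i)} {ys : ∀ i, K (a.sort i)} (h : ∀ i, ys i ∈ M.evR ρ (θ i)) :
    M.evR ρ (r.subst θ) = M.evR (V := a.ctx) ys r := by
  refine Part.ext fun y => ?_
  rw [mem_evR_subst]
  refine ⟨fun ⟨zs, hz, hp⟩ => ?_, fun hp => ⟨ys, h, hp⟩⟩
  rwa [show ys = zs from funext fun i => Part.mem_unique (h i) (hz i)]

theorem sat_rsubst {a : Arity S} {φ : Formula A a.ctx} {θ : ∀ i, RTerm A V (a.sort i)} :
    M.sat ρ (φ.rsubst θ) ↔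
      ∃ ys : ∀ i, K (a.sort i), (∀ i, ys i ∈ M.evR ρ (θ i)) ∧ M.sat (V := a.ctx) ys φ := by
  simp only [Formula.rsubst, sat_and, sat_all, sat_rdefd]
  constructor
  · rintro ⟨h', h''⟩
    choose ys hys using h''
    have e : ∀ x : a.ctx.Var, ys x ∈ M.ev ρ (θ x).tm := fun x => ((M.mem_evR ρ).1 (hys x)).1
    rw [sat_subst (V := a.ctx) e] at h'
    exact ⟨ys, hys, h'⟩
  · rintro ⟨ys, hys, h⟩
    have e : ∀ x : a.ctx.Var, ys x ∈ M.ev ρ (θ x).tm := fun x => ((M.mem_evR ρ).1 (hys x)).1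
    rw [sat_subst (V := a.ctx) e]
    exact ⟨h, fun i => ⟨_, hys i⟩⟩

/-- The reduct of a structure along an assignment. -/
def pull (M : Str B K) (f : SymMap A B) : Str A K where
  fn σ ys := M.evR (V := (A.fnArity σ).ctx) ys (f.fn σ)
  pr R ys := M.sat (V := (A.prArity R).ctx) ys (f.pr R)

/-- Substitution of restricted terms requires all substituted terms to be defined, which is exactly
the strictness of evaluation in the reduct. No argument can be lost because its variable does not
occur. -/
theorem evR_term (M : Str B K) (f : SymMap A B) (ρ : ∀ x, K (V.sort x)) :
    ∀ {s : S} (t : Term A V s), M.evR ρ (f.term t) = (M.pull f).ev ρ t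
  | _, .var x => by simp [SymMap.term]
  | _, .app σ args => Part.ext fun y => by
    simp only [SymMap.term, mem_evR_subst, mem_ev_app, evR_term M f ρ (args _)]
    rfl

theorem sat_formula (M : Str B K) (f : SymMap A B) (ρ : ∀ x, K (V.sort x)) (φ : Formula A V) :
    M.sat ρ (f.formula φ) ↔ (M.pull f).sat ρ φ := by
  induction φ with
  | eq t t' => simp only [SymMap.formula, sat_req, sat_eq, evR_term]
  | rel R args =>
    simp only [SymMap.formula, sat_rsubst, sat_rel, evR_term]
    rfl
  | top => rfl
  | and φ ψ h1 h2 => simp only [SymMap.formula, sat_and, h1, h2]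

theorem evR_rterm (M : Str B K) (f : SymMap A B) (ρ : ∀ x, K (V.sort x)) {s : S}
    (r : RTerm A V s) : M.evR ρ (f.rterm r) = (M.pull f).evR ρ r := Part.ext fun y => by
  rw [SymMap.rterm, mem_evR_restrict, evR_term, sat_formula, mem_evR]

/-- Together with `pull_id`, this turns equations between composite interpretations into equations
between iterated reducts of a single structure. -/
theorem pull_comp {C : Signature.{u'} S} (M : Str C K) (g : SymMap B C) (f : SymMap A B) :
    M.pull (g.comp f) = (M.pull g).pull f := by
  ext σ ys
  · simp only [pull, SymMap.comp, evR_rterm]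
  · simp only [pull, SymMap.comp, sat_formula]

theorem pull_id : M.pull (SymMap.id A) = M := by
  refine Str.ext (funext fun σ => funext fun ys => ?_) (funext fun R => funext fun ys => ?_)
  · exact (M.evR_ofTerm (V := (A.fnArity σ).ctx) ys _).trans (M.ev_app_vars σ ys)
  · exact propext (M.sat_rel_iff (V := (A.prArity R).ctx) ys fun i => Part.mem_some _)

/-! ### Extensions of signatures -/

/-- The reduct of a structure of a disjoint union. -/
def inl (M : Str (A.sum B) K) : Str A K where
  fn σ := M.fn (.inl σ)
  pr R := M.pr (.inl R)

theorem ev_incl (M : Str (A.sum B) K) (ρ : ∀ x, K (V.sort x)) :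
    ∀ {s : S} (t : Term A V s), M.ev ρ (t.incl B) = M.inl.ev ρ t
  | _, .var x => rfl
  | _, .app σ args => by
    simp only [Term.incl, ev]
    congr 2
    funext i
    exact ev_incl M ρ (args i)

theorem sat_incl (M : Str (A.sum B) K) (ρ : ∀ x, K (V.sort x)) (φ : Formula A V) :
    M.sat ρ (φ.incl B) ↔ M.inl.sat ρ φ := by
  induction φ with
  | eq t t' => simp only [Formula.incl, sat_eq, ev_incl]
  | rel R args =>
    have e : ∀ i, M.ev ρ ((args i).incl B) = M.inl.ev ρ (args i) := fun i => ev_incl M ρ _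
    change (∃ ys : ∀ i, K ((A.prArity R).sort i), (∀ i, ys i ∈ M.ev ρ ((args i).incl B)) ∧ _) ↔ _
    simp only [e]
    rfl
  | top => rfl
  | and φ ψ h1 h2 => simp only [Formula.incl, sat_and, h1, h2]

theorem evR_incl (M : Str (A.sum B) K) (ρ : ∀ x, K (V.sort x)) {s : S} (r : RTerm A V s) :
    M.evR ρ (r.incl B) = M.inl.evR ρ r := Part.ext fun y => by
  simp only [RTerm.incl, mem_evR, ev_incl, sat_incl]

/-- `M` is a model of `T`. -/
def Models {T : Theory.{u} S} (M : Str T.sig K) : Prop :=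
  ∀ q ∈ T.axms, ∀ ρ : ∀ x, K (q.ctx.sort x), M.sat ρ q.hyp → M.sat ρ q.concl

end Str

/-! ## Soundness and completeness -/

namespace Theory

variable {S : Type} {T : Theory.{u} S} {V W : Ctx S}

theorem Derivable.sound {φ ψ : Formula T.sig V} (h : T.Derivable φ ψ) {K : S → Type v}
    {M : Str T.sig K} (hM : M.Models) (ρ : ∀ x, K (V.sort x)) : M.sat ρ φ → M.sat ρ ψ := by
  induction h with
  | ax q hq => exact hM q hq ρ
  | refl φ => exact id
  | trans _ _ h1 h2 => exact fun h => h2 ρ (h1 ρ h)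
  | top φ => exact fun _ => trivial
  | and_left φ ψ => exact And.left
  | and_right φ ψ => exact And.right
  | and_intro _ _ h1 h2 => exact fun h => ⟨h1 ρ h, h2 ρ h⟩
  | var_defd x => exact fun _ => (M.sat_defd ρ _).2 ⟨_, Part.mem_some _⟩
  | strict_eq_left t t' => exact fun ⟨y, h, _⟩ => (M.sat_defd ρ _).2 ⟨y, h⟩
  | strict_eq_right t t' => exact fun ⟨y, _, h⟩ => (M.sat_defd ρ _).2 ⟨y, h⟩
  | strict_app σ args i =>
    intro h
    obtain ⟨y, h⟩ := (M.sat_defd ρ _).1 h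
    obtain ⟨ys, h, -⟩ := (M.mem_ev_app ρ).1 h
    exact (M.sat_defd ρ _).2 ⟨_, h i⟩
  | strict_rel R args i => exact fun ⟨ys, h, _⟩ => (M.sat_defd ρ _).2 ⟨_, h i⟩
  | eq_subst φ θ θ' _ _ h1 h2 =>
    intro h
    choose ys hy hy' using fun x => h1 x ρ h
    exact (Str.sat_subst hy' φ).2 ((Str.sat_subst hy φ).1 (h2 ρ h))
  | subst θ _ _ _ h1 h2 h3 =>
    intro h
    choose ys hy using fun x => (M.sat_defd ρ _).1 (h2 x ρ h)
    exact (Str.sat_subst hy _).2 (h1 ys ((Str.sat_subst hy _).1 (h3 ρ h)))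

/-- Replacement applied to the formula `x₀ = x₁`, where both variables stand for `t` and only the
first is replaced by `t'`. Transitivity below replaces only the second variable. -/
theorem Derivable.symm {χ : Formula T.sig V} {s : S} {t t' : Term T.sig V s}
    (h : T.Derivable χ (.eq t t')) : T.Derivable χ (.eq t' t) := by
  have hr : T.Derivable χ (.eq t t) := h.trans (.strict_eq_left _ _)
  exact Derivable.eq_subst (V := (Arity.rep 2 s).ctx)
    (.eq (.var (V := (Arity.rep 2 s).ctx) (0 : Fin 2)) (.var (V := (Arity.rep 2 s).ctx) (1 : Fin 2)))
    (fun _ => t) (fun i : Fin 2 => if i = 0 then t' else t)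
    (fun i : Fin 2 => by
      by_cases e : i = 0
      · simpa [e] using h
      · simpa [e] using hr) hr

theorem Derivable.eq_trans {χ : Formula T.sig V} {s : S} {t t' t'' : Term T.sig V s}
    (h : T.Derivable χ (.eq t t')) (h' : T.Derivable χ (.eq t' t'')) :
    T.Derivable χ (.eq t t'') := by
  have hr : T.Derivable χ (.eq t t) := h.trans (.strict_eq_left _ _)
  exact Derivable.eq_subst (V := (Arity.rep 2 s).ctx)
    (.eq (.var (V := (Arity.rep 2 s).ctx) (0 : Fin 2)) (.var (V := (Arity.rep 2 s).ctx) (1 : Fin 2)))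
    (fun i : Fin 2 => if i = 0 then t else t') (fun i : Fin 2 => if i = 0 then t else t'')
    (fun i : Fin 2 => by
      by_cases e : i = 0
      · simpa [e] using hr
      · simpa [e] using h') h

/-- Replacement in `σ(x) = σ(y)` over two copies of the variables, of which only the second copy is
changed; the starting point is that `σ` is defined at the old arguments. -/
theorem Derivable.app_congr {χ : Formula T.sig V} {σ : T.sig.Fn}
    {args args' : ∀ i, Term T.sig V ((T.sig.fnArity σ).sort i)}
    (h : ∀ i, T.Derivable χ (.eq (args i) (args' i)))
    (hd : T.Derivable χ (Term.app σ args).defd) :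
    T.Derivable χ (.eq (.app σ args) (.app σ args')) := by
  let a := (T.sig.fnArity σ).ctx
  exact Derivable.eq_subst (V := a.append a)
    (.eq (.app σ fun i => .var (V := a.append a) (.inl i))
      (.app σ fun i => .var (V := a.append a) (.inr i)))
    (Sum.rec args args) (Sum.rec args args')
    (Sum.rec (fun i => (h i).trans (.strict_eq_left _ _)) h) hd

theorem Derivable.rel_congr {χ : Formula T.sig V} {R : T.sig.Pr}
    {args args' : ∀ i, Term T.sig V ((T.sig.prArity R).sort i)}
    (h : ∀ i, T.Derivable χ (.eq (args i) (args' i)))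
    (hd : T.Derivable χ (.rel R args)) : T.Derivable χ (.rel R args') := by
  let a := (T.sig.prArity R).ctx
  exact Derivable.eq_subst (V := a) (.rel R fun i => .var (V := a) i) args args' h hd

theorem _root_.PHT.Term.subst_var {A : Signature.{u} S} :
    ∀ {s : S} (t : Term A V s), t.subst (fun x => .var x) = t
  | _, .var x => rfl
  | _, .app σ args => by
    simp only [Term.subst]
    congr 1
    funext i
    exact Term.subst_var (args i)

theorem _root_.PHT.Formula.subst_var {A : Signature.{u} S} (φ : Formula A V) :
    φ.subst (fun x => .var x) = φ := by
  induction φ with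
  | eq t t' => simp only [Formula.subst, Term.subst_var]
  | rel R args => simp only [Formula.subst, Term.subst_var]
  | top => rfl
  | and φ ψ h1 h2 => simp only [Formula.subst, h1, h2]

/-! ### The term model of a Horn formula -/

section TermModel

variable (φ : Formula T.sig V)

/-- Terms that are defined under `φ`, up to equality under `φ`. -/
def termSetoid (s : S) : Setoid {t : Term T.sig V s // T.Derivable φ t.defd} where
  r t t' := T.Derivable φ (.eq t.1 t'.1)
  iseqv := ⟨fun t => t.2, fun h => h.symm, fun h h' => h.eq_trans h'⟩

def TermCarrier (s : S) : Type u := Quotient (termSetoid φ s)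

variable {φ} in
def TermCarrier.mk {s : S} (t : Term T.sig V s) (h : T.Derivable φ t.defd) : TermCarrier φ s :=
  Quotient.mk (termSetoid φ s) ⟨t, h⟩

variable {φ} in
theorem TermCarrier.mk_eq {s : S} {t t' : Term T.sig V s} {h : T.Derivable φ t.defd}
    {h' : T.Derivable φ t'.defd} :
    TermCarrier.mk t h = TermCarrier.mk t' h' ↔ T.Derivable φ (.eq t t') :=
  Quotient.eq (r := termSetoid φ s)

variable {φ} in
noncomputable def TermCarrier.rep {s : S} (x : TermCarrier φ s) : Term T.sig V s :=
  (Quotient.out x).1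

variable {φ} in
theorem TermCarrier.rep_defd {s : S} (x : TermCarrier φ s) : T.Derivable φ x.rep.defd :=
  (Quotient.out x).2

variable {φ} in
theorem TermCarrier.mk_rep {s : S} (x : TermCarrier φ s) : mk x.rep x.rep_defd = x :=
  Quotient.out_eq x

variable {φ} in
theorem TermCarrier.rep_mk {s : S} (t : Term T.sig V s) (h : T.Derivable φ t.defd) :
    T.Derivable φ (.eq (mk t h).rep t) :=
  mk_eq.1 (mk_rep (mk t h))

/-- Operations and predicates are computed on chosen representatives, and an operation is defined
when definedness is derivable from `φ`. Congruence makes the choice of representatives irrelevant.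
-/
noncomputable def termModel : Str T.sig (TermCarrier φ) where
  fn σ ys := ⟨T.Derivable φ (Term.app σ fun i => (ys i).rep).defd, fun h => .mk _ h⟩
  pr R ys := T.Derivable φ (.rel R fun i => (ys i).rep)

/-- By induction on the term: the representative of the value of an argument is provably equal to
the substituted argument. In the converse direction, strictness provides the definedness of the
arguments. -/
theorem mem_ev_termModel (ρ : ∀ x, TermCarrier φ (W.sort x)) :
    ∀ {s : S} (t : Term T.sig W s) (y : TermCarrier φ s), y ∈ (termModel φ).ev ρ t ↔
      ∃ h : T.Derivable φ (t.subst fun x => (ρ x).rep).defd, .mk _ h = y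
  | _, .var x, y => by
    simp only [Str.ev_var, Part.mem_some_iff, Term.subst, TermCarrier.mk_rep]
    exact ⟨fun h => ⟨(ρ x).rep_defd, h.symm⟩, fun ⟨_, h⟩ => h.symm⟩
  | _, .app σ args, y => by
    rw [Str.mem_ev_app]
    constructor
    · rintro ⟨ys, h, hd, hy⟩
      choose hd' hy' using fun i => (mem_ev_termModel ρ (args i) (ys i)).1 (h i)
      have hc := Derivable.app_congr (args' := fun i => (args i).subst fun x => (ρ x).rep)
        (fun i => by rw [← hy' i]; exact TermCarrier.rep_mk _ (hd' i)) hd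
      exact ⟨hc.trans (.strict_eq_right _ _), hy ▸ TermCarrier.mk_eq.2 hc.symm⟩
    · rintro ⟨hd, rfl⟩
      have hd' : ∀ i, T.Derivable φ ((args i).subst fun x => (ρ x).rep).defd :=
        fun i => Derivable.trans hd (.strict_app _ _ i)
      have hc := Derivable.app_congr (args' := fun i => (TermCarrier.mk _ (hd' i)).rep)
        (fun i => (TermCarrier.rep_mk _ (hd' i)).symm) hd
      exact ⟨fun i => .mk _ (hd' i), fun i => (mem_ev_termModel ρ (args i) _).2 ⟨hd' i, rfl⟩,
        hc.trans (.strict_eq_right _ _), TermCarrier.mk_eq.2 hc.symm⟩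

theorem sat_termModel (ρ : ∀ x, TermCarrier φ (W.sort x)) (χ : Formula T.sig W) :
    (termModel φ).sat ρ χ ↔ T.Derivable φ (χ.subst fun x => (ρ x).rep) := by
  induction χ with
  | eq t t' =>
    simp only [Str.sat_eq, mem_ev_termModel]
    constructor
    · rintro ⟨y, ⟨h, rfl⟩, h', e⟩
      exact (TermCarrier.mk_eq.1 e).symm
    · intro h
      have h1 := h.trans (.strict_eq_left _ _)
      have h2 := h.trans (.strict_eq_right _ _)
      exact ⟨.mk _ h1, ⟨h1, rfl⟩, h2, TermCarrier.mk_eq.2 (Derivable.symm h)⟩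
  | rel R args =>
    simp only [Str.sat_rel, mem_ev_termModel]
    constructor
    · rintro ⟨ys, h, hp⟩
      choose hd hy using h
      refine Derivable.rel_congr (fun i => ?_) hp
      rw [← hy i]
      exact TermCarrier.rep_mk _ (hd i)
    · intro h
      have hd : ∀ i, T.Derivable φ ((args i).subst fun x => (ρ x).rep).defd :=
        fun i => Derivable.trans h (.strict_rel _ _ i)
      exact ⟨fun i => .mk _ (hd i), fun i => ⟨hd i, rfl⟩,
        Derivable.rel_congr (fun i => (TermCarrier.rep_mk _ (hd i)).symm) h⟩
  | top => exact ⟨fun _ => .top _, fun _ => trivial⟩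
  | and χ χ' h1 h2 =>
    rw [Str.sat_and, h1, h2]
    exact ⟨fun h => .and_intro h.1 h.2,
      fun h => ⟨h.trans (.and_left _ _), h.trans (.and_right _ _)⟩⟩

/-- Satisfaction in the term model is derivability from `φ` of a substitution instance, so an axiom
holds by the substitution rule; the substituted representatives are defined under `φ`, as that rule
requires. -/
theorem termModel_models : (termModel φ).Models := by
  intro q hq ρ h
  rw [sat_termModel] at h ⊢
  exact .subst _ (.ax q hq) (fun x => (ρ x).rep_defd) h

end TermModel

/-- Completeness of partial Horn logic. -/
theorem derivable_iff {φ ψ : Formula T.sig V} :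
    T.Derivable φ ψ ↔ ∀ (K : S → Type u) (M : Str T.sig K), M.Models →
      ∀ ρ, M.sat ρ φ → M.sat ρ ψ := by
  refine ⟨fun h K M hM ρ => h.sound hM ρ, fun h => ?_⟩
  -- The generic valuation sends each variable to its own class. Its representatives are provably
  -- equal to the variables, so satisfaction at this valuation is derivability of the formula
  -- itself.
  let ρ : ∀ x, TermCarrier φ (V.sort x) := fun x => .mk (.var x) ((Derivable.top _).trans (.var_defd x))
  have e : ∀ x, T.Derivable φ (.eq (.var x) (ρ x).rep) := fun x => (TermCarrier.rep_mk _ _).symm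
  have h1 := h _ _ (termModel_models φ) ρ <| (sat_termModel φ ρ φ).2 <|
    .eq_subst φ _ _ e (by rw [Formula.subst_var]; exact .refl φ)
  have h2 := Derivable.eq_subst ψ _ (fun x => .var x) (fun x => (e x).symm)
    ((sat_termModel φ ρ ψ).1 h1)
  rwa [Formula.subst_var] at h2

/-! ### Classes of structures that detect derivability -/

variable (T) in
/-- A class of structures that detects derivability. -/
def Detects (𝓜 : ∀ K : S → Type u, Str T.sig K → Prop) : Prop :=
  ∀ (V : Ctx S) (φ ψ : Formula T.sig V), T.Derivable φ ψ ↔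
    ∀ (K : S → Type u) (M : Str T.sig K), 𝓜 K M → ∀ ρ, M.sat ρ φ → M.sat ρ ψ

theorem models_detects : T.Detects fun _ M => M.Models := fun _ _ _ => derivable_iff

section

variable {𝓜 : ∀ K : S → Type u, Str T.sig K → Prop} (h𝓜 : T.Detects 𝓜)
include h𝓜

theorem Detects.rEquiv_iff {s : S} {r r' : RTerm T.sig V s} :
    T.REquiv r r' ↔ ∀ (K : S → Type u) (M : Str T.sig K), 𝓜 K M →
      ∀ ρ, M.evR ρ r = M.evR ρ r' := by
  rw [REquiv, h𝓜, h𝓜]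
  simp only [Str.sat_rdefd, Str.sat_and, Str.sat_eq]
  constructor
  · rintro ⟨h1, h2⟩ K M hM ρ
    refine Part.ext fun y => ⟨fun h => ?_, fun h => ?_⟩
    · obtain ⟨⟨z, hz, hz'⟩, hc⟩ := h1 K M hM ρ ⟨y, h⟩
      rw [Str.mem_evR] at h ⊢
      rw [Part.mem_unique h.1 hz]
      exact ⟨hz', hc⟩
    · obtain ⟨⟨z, hz, hz'⟩, hc⟩ := h2 K M hM ρ ⟨y, h⟩
      rw [Str.mem_evR] at h ⊢
      rw [Part.mem_unique h.1 hz']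
      exact ⟨hz, hc⟩
  · intro h
    constructor
    · rintro K M hM ρ ⟨y, hy⟩
      have hy' := hy
      rw [h K M hM ρ] at hy'
      rw [Str.mem_evR] at hy hy'
      exact ⟨⟨y, hy.1, hy'.1⟩, hy'.2⟩
    · rintro K M hM ρ ⟨y, hy⟩
      have hy' := hy
      rw [← h K M hM ρ] at hy'
      rw [Str.mem_evR] at hy hy'
      exact ⟨⟨y, hy'.1, hy.1⟩, hy'.2⟩

theorem Detects.fEquiv_iff {φ ψ : Formula T.sig V} :
    T.FEquiv φ ψ ↔ ∀ (K : S → Type u) (M : Str T.sig K), 𝓜 K M →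
      ∀ ρ, (M.sat ρ φ ↔ M.sat ρ ψ) := by
  rw [FEquiv, h𝓜, h𝓜]
  exact ⟨fun h K M hM ρ => ⟨h.1 K M hM ρ, h.2 K M hM ρ⟩,
    fun h => ⟨fun K M hM ρ => (h K M hM ρ).1, fun K M hM ρ => (h K M hM ρ).2⟩⟩

/-- This is the form in which compatibility conditions are checked. For the contextual theory the
detecting class consists only of reducts of models of `T`, so its other models need not be
understood. -/
theorem Detects.symEquiv_iff {A : Signature.{w} S} {f g : SymMap A T.sig} :
    SymEquiv T f g ↔ ∀ (K : S → Type u) (M : Str T.sig K), 𝓜 K M → M.pull f = M.pull g := by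
  rw [SymEquiv]
  simp only [h𝓜.rEquiv_iff, h𝓜.fEquiv_iff]
  constructor
  · rintro ⟨h1, h2⟩ K M hM
    exact Str.ext (funext fun σ => funext fun ys => h1 σ K M hM ys)
      (funext fun R => funext fun ys => propext (h2 R K M hM ys))
  · intro h
    exact ⟨fun σ K M hM ρ => congrFun (congrFun (congrArg Str.fn (h K M hM)) σ) ρ,
      fun R K M hM ρ => iff_of_eq (congrFun (congrFun (congrArg Str.pr (h K M hM)) R) ρ)⟩

theorem Detects.isInterp_iff {T' : Theory.{w} S} {f : SymMap T'.sig T.sig} :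
    IsInterp T' T f ↔ ∀ (K : S → Type u) (M : Str T.sig K), 𝓜 K M →
      Str.Models (T := T') (M.pull f) := by
  rw [IsInterp]
  simp only [h𝓜 _ _ _, Str.sat_formula]
  exact ⟨fun h K M hM q hq => h q hq K M hM, fun h q hq K M hM => h K M hM q hq⟩

end

end Theory

/-! ## Slices of structures of lifted signatures -/

theorem Arity.consFam_eta {S : Type} {F : S → Type v} {s : S} {a : Arity S}
    (ys : ∀ i, F ((Arity.cons s a).sort i)) :
    ys = Arity.consFam (F := F) (s := s) (a := a) (ys (0 : Fin (a.len + 1)))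
      (fun i => ys (Fin.succ i)) := by
  funext i
  refine Fin.cases ?_ (fun i => ?_) i <;> rfl

theorem Arity.exists_consFam {S : Type} {F : S → Type v} {s : S} {a : Arity S}
    {Q : (∀ i, F ((Arity.cons s a).sort i)) → Prop} :
    (∃ ys, Q ys) ↔ ∃ (y : F s) (ys : ∀ i, F (a.sort i)), Q (Arity.consFam (F := F) y ys) := by
  constructor
  · rintro ⟨ys, h⟩
    rw [Arity.consFam_eta ys] at h
    exact ⟨_, _, h⟩
  · rintro ⟨y, ys, h⟩
    exact ⟨_, h⟩

namespace Str

variable {A : Signature.{u} Srt} {B : Signature.{w} Srt} {K : Srt → Type v} {V W : Ctx Srt}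

/-- The value of `ft^n`. -/
def ftV (N : Str (LSig A) K) : (n : ℕ) → K (cx (n + 1)) → Part (K (cx 1))
  | 0, x => Part.some x
  | n + 1, x => (N.fn (.inl (.ft (n + 1))) fun _ => x).bind (N.ftV n)

/-- `x` is over `γ`. -/
def IsOver (N : Str (LSig A) K) (γ : K (cx 1)) (s : Srt) (x : K (s.up 1)) : Prop :=
  ∃ c ∈ N.fn (.inl (.ctxOf s.1 (s.2 + 1))) (fun _ => x), γ ∈ N.ftV s.2 c

variable (N : Str (LSig A) K) {ρ : ∀ x, K (W.sort x)}

theorem mem_ev_lft {n : ℕ} {t : Term (LSig A) W (cx (n + 1))} {y : K (cx n)} :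
    y ∈ N.ev ρ (lft n t) ↔ ∃ x ∈ N.ev ρ t, y ∈ N.fn (.inl (.ft n)) fun _ => x := by
  refine (N.mem_ev_app ρ).trans ⟨fun ⟨ys, h, hy⟩ => ⟨ys (0 : Fin 1), h (0 : Fin 1), ?_⟩,
    fun ⟨x, h, hy⟩ => ⟨fun _ => x, fun _ => h, hy⟩⟩
  rwa [show (fun _ => ys (0 : Fin 1)) = ys from
    funext fun i : Fin 1 => by rw [Subsingleton.elim i 0]]

variable {N} in
theorem mem_ev_lctx {p : Base} {n : ℕ} {t : Term (LSig A) W (p, n)} {x : K (p, n)}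
    (hx : x ∈ N.ev ρ t) :
    N.ev ρ (lctx p n t) = N.fn (.inl (.ctxOf p n)) fun _ => x :=
  N.ev_app ρ fun _ => hx

theorem mem_ev_lftIter {n : ℕ} {t : Term (LSig A) W (cx (n + 1))} {y : K (cx 1)} :
    y ∈ N.ev ρ (lftIter n t) ↔ ∃ x ∈ N.ev ρ t, y ∈ N.ftV n x := by
  induction n with
  | zero => simp [lftIter, ftV]
  | succ n ih =>
    simp only [lftIter, ih, mem_ev_lft, ftV]
    constructor
    · rintro ⟨x, ⟨z, h, hx⟩, hy⟩
      exact ⟨z, h, Part.mem_bind_iff.2 ⟨x, hx, hy⟩⟩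
    · rintro ⟨x, hx, h⟩
      obtain ⟨z, hz, hy⟩ := Part.mem_bind_iff.1 h
      exact ⟨z, ⟨x, hx, hz⟩, hy⟩

theorem sat_isOver {Γ : Term (LSig A) W (cx 1)} {s : Srt} {t : Term (LSig A) W (s.up 1)}
    {γ : K (cx 1)} {x : K (s.up 1)} (hγ : γ ∈ N.ev ρ Γ) (hx : x ∈ N.ev ρ t) :
    N.sat ρ (isOver Γ t) ↔ N.IsOver γ s x := by
  simp only [isOver, sat_eq, mem_ev_lftIter, mem_ev_lctx hx, IsOver]
  constructor
  · rintro ⟨y, h, hy⟩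
    rwa [Part.mem_unique hγ hy]
  · intro h
    exact ⟨γ, h, hγ⟩

/-- The lifted operations only relate elements over their first argument. -/
structure LRegular (N : Str (LSig A) K) : Prop where
  fn_cod : ∀ σ γ xs z, z ∈ N.fn (.inr σ) (Arity.consFam (F := K) γ xs) → N.IsOver γ (A.fnCod σ) z
  fn_arg : ∀ σ γ xs z i, z ∈ N.fn (.inr σ) (Arity.consFam (F := K) γ xs) →
    N.IsOver γ ((A.fnArity σ).sort i) (xs i)
  pr_arg : ∀ R γ xs i, N.pr (.inr R) (Arity.consFam (F := K) γ xs) →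
    N.IsOver γ ((A.prArity R).sort i) (xs i)

variable {N} in
theorem lRegular_of_models {T : Theory.{u} Srt} {base : SymMap baseSig T.sig}
    {N : Str (LSig T.sig) K} (hN : Models (T := LTheory T base) N) : N.LRegular where
  fn_cod σ γ xs z h := by
    have h1 := hN _ (LAx.fn_cod (A := T.sig) (base := base) σ) (Arity.consFam (F := K) γ xs)
    have h2 : z ∈ N.ev (V := ((T.sig.fnArity σ).under 1).ctx)
      (Arity.consFam (F := K) γ xs) (.app (A := LSig T.sig) (Sum.inr σ)
         (fun i => .var (V := ((T.sig.fnArity σ).under 1).ctx) i)) :=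
      (Part.ext_iff.1 (N.ev_app_vars (Sum.inr σ) (Arity.consFam (F := K) γ xs)) z).2 h
    exact (N.sat_isOver (Part.mem_some _) h2).1 (h1 ((N.sat_defd _ _).2 ⟨z, h2⟩))
  fn_arg σ γ xs z i h := by
    have h1 := hN _ (LAx.fn_arg (A := T.sig) (base := base) σ i) (Arity.consFam (F := K) γ xs)
    have h2 : z ∈ N.ev (V := ((T.sig.fnArity σ).under 1).ctx)
      (Arity.consFam (F := K) γ xs) (.app (A := LSig T.sig) (Sum.inr σ)
         (fun i => .var (V := ((T.sig.fnArity σ).under 1).ctx) i)) :=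
      (Part.ext_iff.1 (N.ev_app_vars (Sum.inr σ) (Arity.consFam (F := K) γ xs)) z).2 h
    exact (N.sat_isOver (Part.mem_some _) (Part.mem_some _)).1 (h1 ((N.sat_defd _ _).2 ⟨z, h2⟩))
  pr_arg R γ xs i h := by
    have h1 := hN _ (LAx.pr_arg (A := T.sig) (base := base) R i) (Arity.consFam (F := K) γ xs)
    exact (N.sat_isOver (Part.mem_some _) (Part.mem_some _)).1
      (h1 ⟨_, fun i => Part.mem_some _, h⟩)

/-- The elements `x : (p, n + 1)` with the property `P` as elements of the sort `(p, n)`. -/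
abbrev SliceCarrier (P : ∀ s : Srt, K (s.up 1) → Prop) (s : Srt) : Type v :=
  {x : K (s.up 1) // P s x}

/-- The structure with the operations `L(σ)(γ, -)`. -/
def slice (γ : K (cx 1)) (P : ∀ s : Srt, K (s.up 1) → Prop) : Str A (SliceCarrier P) where
  fn σ ys := (N.fn (.inr σ) (Arity.consFam (F := K) γ fun i => (ys i).1)).bind
    fun z => Part.assert (P _ z) fun h => Part.some ⟨z, h⟩
  pr R ys := N.pr (.inr R) (Arity.consFam (F := K) γ fun i => (ys i).1)

variable {N} {γ : K (cx 1)} {P : ∀ s : Srt, K (s.up 1) → Prop}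

theorem mem_slice_fn {σ : A.Fn} {ys : ∀ i, SliceCarrier P ((A.fnArity σ).sort i)}
    {z : SliceCarrier P (A.fnCod σ)} : z ∈ (N.slice γ P).fn σ ys ↔
      z.1 ∈ N.fn (.inr σ) (Arity.consFam (F := K) γ fun i => (ys i).1) := by
  simp only [slice, Part.mem_bind_iff, Part.mem_assert_iff, Part.mem_some_iff]
  constructor
  · rintro ⟨a, h, h', rfl⟩
    exact h
  · intro h
    exact ⟨_, h, z.2, rfl⟩

section

variable (hN : N.LRegular) (hP : ∀ s x, P s x ↔ N.IsOver γ s x)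
  {Γ : Term (LSig A) W (cx 1)} (hΓ : γ ∈ N.ev ρ Γ)
  {θ : ∀ x, Term (LSig A) W ((V.sort x).up 1)}
  {ρ' : ∀ x, SliceCarrier P (V.sort x)} (hθ : ∀ x, (ρ' x).1 ∈ N.ev ρ (θ x))

include hP hΓ

section
include hN hθ

/-- A variable takes its value in the slice, so the condition that it be over `Γ` holds. For an
application, regularity puts the value over `γ`, so the codomain restriction built into the slice
discards nothing. -/
theorem mem_evR_liftTerm :
    ∀ {s : Srt} (t : Term A V s) {y : K (s.up 1)}, y ∈ N.evR ρ (liftTerm Γ θ t) ↔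
      ∃ h : P s y, ⟨y, h⟩ ∈ (N.slice γ P).ev ρ' t
  | _, .var x, y => by
    rw [mem_evR, ev_var]
    simp only [Part.mem_some_iff]
    constructor
    · rintro ⟨h, -⟩
      have e := Part.mem_unique h (hθ x)
      exact ⟨e ▸ (ρ' x).2, Subtype.ext e⟩
    · rintro ⟨h, e⟩
      obtain rfl : y = (ρ' x).1 := congrArg Subtype.val e
      exact ⟨hθ x, (N.sat_isOver hΓ (hθ x)).2 ((hP _ _).1 (ρ' x).2)⟩
  | _, .app σ args, y => by
    refine (N.mem_evR ρ).trans <| (and_congr (N.mem_ev_app ρ) (N.sat_all ρ _)).trans <|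
      Iff.trans ?_ (exists_congr fun h => (mem_ev_app _ _).symm)
    constructor
    · rintro ⟨⟨ys, h, hy⟩, hc⟩
      obtain ⟨z, zs, rfl⟩ : ∃ z zs, ys = Arity.consFam (F := K) z zs :=
        ⟨_, _, Arity.consFam_eta ys⟩
      have h0 : z ∈ N.ev ρ Γ := h (0 : Fin (_ + 1))
      have h1 : ∀ i, zs i ∈ N.evR ρ (liftTerm Γ θ (args i)) :=
        fun i => (N.mem_evR ρ).2 ⟨h (Fin.succ i), hc i⟩
      obtain rfl := Part.mem_unique hΓ h0
      choose h2 h3 using fun i => (mem_evR_liftTerm (args i)).1 (h1 i)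
      exact ⟨(hP _ _).2 (hN.fn_cod σ _ _ _ hy), fun i => ⟨zs i, h2 i⟩, h3, mem_slice_fn.2 hy⟩
    · rintro ⟨h, ys, hys, hy⟩
      have h1 : ∀ i, (ys i).1 ∈ N.evR ρ (liftTerm Γ θ (args i)) :=
        fun i => (mem_evR_liftTerm (args i)).2 ⟨(ys i).2, hys i⟩
      refine ⟨⟨Arity.consFam (F := K) γ fun i => (ys i).1, fun i => ?_, mem_slice_fn.1 hy⟩,
        fun i => ((N.mem_evR ρ).1 (h1 i)).2⟩
      refine Fin.cases hΓ (fun i => ((N.mem_evR ρ).1 (h1 i)).1) i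

theorem sat_liftFormula (φ : Formula A V) :
    N.sat ρ (liftFormula Γ θ φ) ↔ (N.slice γ P).sat ρ' φ := by
  induction φ with
  | eq t t' =>
    simp only [liftFormula, sat_req, sat_eq, mem_evR_liftTerm hN hP hΓ hθ]
    exact ⟨fun ⟨y, ⟨h, h'⟩, _, h''⟩ => ⟨⟨y, h⟩, h', h''⟩,
      fun ⟨y, h', h''⟩ => ⟨y.1, ⟨y.2, h'⟩, y.2, h''⟩⟩
  | rel R args =>
    refine (and_congr Iff.rfl (N.sat_all ρ _)).trans ?_
    constructor
    · rintro ⟨⟨ys, h, hy⟩, hc⟩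
      obtain ⟨z, zs, rfl⟩ : ∃ z zs, ys = Arity.consFam (F := K) z zs :=
        ⟨_, _, Arity.consFam_eta ys⟩
      have h0 : z ∈ N.ev ρ Γ := h (0 : Fin (_ + 1))
      have h1 : ∀ i, zs i ∈ N.evR ρ (liftTerm Γ θ (args i)) :=
        fun i => (N.mem_evR ρ).2 ⟨h (Fin.succ i), hc i⟩
      obtain rfl := Part.mem_unique hΓ h0
      choose h2 h3 using fun i => (mem_evR_liftTerm hN hP hΓ hθ (args i)).1 (h1 i)
      exact ⟨fun i => ⟨zs i, h2 i⟩, h3, hy⟩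
    · rintro ⟨ys, hys, hy⟩
      have h1 : ∀ i, (ys i).1 ∈ N.evR ρ (liftTerm Γ θ (args i)) :=
        fun i => (mem_evR_liftTerm hN hP hΓ hθ (args i)).2 ⟨(ys i).2, hys i⟩
      refine ⟨⟨Arity.consFam (F := K) γ fun i => (ys i).1, fun i => ?_, hy⟩,
        fun i => ((N.mem_evR ρ).1 (h1 i)).2⟩
      refine Fin.cases hΓ (fun i => ((N.mem_evR ρ).1 (h1 i)).1) i
  | top => rfl
  | and φ ψ h1 h2 => simp only [liftFormula, sat_and, h1, h2]

theorem mem_evR_liftRTerm {s : Srt} {r : RTerm A V s} {y : K (s.up 1)} :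
    y ∈ N.evR ρ (liftRTerm Γ θ r) ↔ ∃ h : P s y, ⟨y, h⟩ ∈ (N.slice γ P).evR ρ' r := by
  simp only [liftRTerm, mem_evR_restrict, mem_evR_liftTerm hN hP hΓ hθ,
    sat_liftFormula hN hP hΓ hθ, mem_evR (N.slice γ P), exists_and_right]

end

end

theorem sat_overAll {a : Arity Srt} {xs : ∀ i, K ((a.sort i).up 1)} :
    N.sat (V := (a.under 1).ctx) (Arity.consFam (F := K) γ xs) (overAll A a) ↔
      ∀ i, N.IsOver γ (a.sort i) (xs i) := by
  rw [overAll, sat_all]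
  exact forall_congr' fun i => N.sat_isOver (Part.mem_some _) (Part.mem_some _)

/-! ### Reducts along `L(f)` and their slices -/

section

variable {N : Str (LSig B) K} (hN : N.LRegular) (hP : ∀ s x, P s x ↔ N.IsOver γ s x)
  (f : SymMap A B)

theorem pull_LMap_inl (b : BaseFn) : (N.pull (LMap f)).fn (.inl b) = N.fn (.inl b) := by
  funext ys
  exact (N.evR_ofTerm (V := (baseSig.fnArity b).ctx) ys _).trans
    (N.ev_app_vars (Sum.inl b) ys)

theorem pull_LMap_over : (N.pull (LMap f)).IsOver = N.IsOver := by
  have e : (N.pull (LMap f)).ftV = N.ftV := by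
    funext n
    induction n with
    | zero => rfl
    | succ n ih =>
      funext x
      simp only [ftV, ih]
      exact congrArg (·.bind (N.ftV n)) (congrFun (pull_LMap_inl f (.ft (n + 1))) fun _ => x)
  funext γ s x
  simp only [IsOver, e]
  rw [show (N.pull (LMap f)).fn (.inl (.ctxOf s.1 (s.2 + 1))) (fun _ => x) = _ from
    congrFun (pull_LMap_inl f (.ctxOf s.1 (s.2 + 1))) fun _ => x]
  rfl

include hN hP

theorem mem_pull_LMap_inr {σ : A.Fn} {xs : ∀ i, K (((A.fnArity σ).sort i).up 1)}
    {y : K ((A.fnCod σ).up 1)} :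
    y ∈ (N.pull (LMap f)).fn (.inr σ) (Arity.consFam (F := K) γ xs) ↔
      ∃ (hx : ∀ i, P _ (xs i)) (hy : P _ y),
        (⟨y, hy⟩ : SliceCarrier P _) ∈ ((N.slice γ P).pull f).fn σ fun i => ⟨xs i, hx i⟩ := by
  have : y ∈ (N.pull (LMap f)).fn (.inr σ) (Arity.consFam (F := K) γ xs) ↔
      y ∈ N.evR (V := ((A.fnArity σ).under 1).ctx) (Arity.consFam (F := K) γ xs)
        (liftRTerm (ctxVar _ 1) (argVar _ 1) (f.fn σ)) ∧
      N.sat (V := ((A.fnArity σ).under 1).ctx) (Arity.consFam (F := K) γ xs)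
        (overAll B (A.fnArity σ)) := mem_evR_restrict _ _
  rw [this, sat_overAll]
  constructor
  · rintro ⟨h, h'⟩
    have hx : ∀ i, P _ (xs i) := fun i => (hP _ _).2 (h' i)
    obtain ⟨hy, h⟩ := (mem_evR_liftRTerm hN hP (V := (A.fnArity σ).ctx) (Part.mem_some _)
      (ρ' := fun i => ⟨xs i, hx i⟩) fun i => Part.mem_some _).1 h
    exact ⟨hx, hy, h⟩
  · rintro ⟨hx, hy, h⟩
    exact ⟨(mem_evR_liftRTerm hN hP (V := (A.fnArity σ).ctx) (Part.mem_some _)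
      (ρ' := fun i => ⟨xs i, hx i⟩) fun i => Part.mem_some _).2 ⟨hy, h⟩,
      fun i => (hP _ _).1 (hx i)⟩

theorem pull_LMap_inr_pr {R : A.Pr} {xs : ∀ i, K (((A.prArity R).sort i).up 1)} :
    (N.pull (LMap f)).pr (.inr R) (Arity.consFam (F := K) γ xs) ↔
      ∃ hx : ∀ i, P _ (xs i),
        ((N.slice γ P).pull f).pr R fun i => (⟨xs i, hx i⟩ : SliceCarrier P _) := by
  have : (N.pull (LMap f)).pr (.inr R) (Arity.consFam (F := K) γ xs) ↔
      N.sat (V := ((A.prArity R).under 1).ctx) (Arity.consFam (F := K) γ xs)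
        (liftFormula (ctxVar _ 1) (argVar _ 1) (f.pr R)) ∧
      N.sat (V := ((A.prArity R).under 1).ctx) (Arity.consFam (F := K) γ xs)
        (overAll B (A.prArity R)) := Iff.rfl
  rw [this, sat_overAll]
  constructor
  · rintro ⟨h, h'⟩
    have hx : ∀ i, P _ (xs i) := fun i => (hP _ _).2 (h' i)
    exact ⟨hx, (sat_liftFormula hN hP (V := (A.prArity R).ctx) (Part.mem_some _)
      (ρ' := fun i => ⟨xs i, hx i⟩) (fun i => Part.mem_some _) _).1 h⟩
  · rintro ⟨hx, h⟩
    exact ⟨(sat_liftFormula hN hP (V := (A.prArity R).ctx) (Part.mem_some _)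
      (ρ' := fun i => ⟨xs i, hx i⟩) (fun i => Part.mem_some _) _).2 h,
      fun i => (hP _ _).1 (hx i)⟩

/-- On elements of the slice the extra condition in `L(f)`, that all arguments be over `γ`, is
automatic. Statements about `L(f)` thereby reduce to statements about `f` in slices. -/
theorem slice_pull_LMap : (N.pull (LMap f)).slice γ P = (N.slice γ P).pull f := by
  refine Str.ext (funext fun σ => funext fun ys => Part.ext fun y => ?_)
    (funext fun R => funext fun ys => propext ?_)
  · rw [mem_slice_fn, mem_pull_LMap_inr hN hP]
    exact ⟨fun ⟨_, _, h⟩ => h, fun h => ⟨fun i => (ys i).2, y.2, h⟩⟩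
  · exact (pull_LMap_inr_pr hN hP f).trans ⟨fun ⟨_, h⟩ => h, fun h => ⟨fun i => (ys i).2, h⟩⟩

end

end Str

/-! ## Models of the theory of substitutions -/

/-- The operations of a model of the theory of substitutions; `w n j A` is the variable
`v_{n,n-1-j}(A)`. -/
structure SOps (K : Srt → Type v) where
  star : K (cx 0)
  ft : ∀ n, K (cx (n + 1)) → K (cx n)
  ty : ∀ n, K (tmS n) → K (cx (n + 1))
  w : ∀ n, Fin n → K (cx n) → K (tmS n)
  sub : ∀ (p : Cls) (n k : ℕ), K (cx n) → K (p.sort k) → (Fin k → K (tmS n)) → Part (K (p.sort n))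

namespace SOps

variable {K : Srt → Type v} (X : SOps K)

def ctxOf : (p : Cls) → (n : ℕ) → K (p.sort n) → K (cx n)
  | .ty, n, t => X.ft n t
  | .tm, n, t => X.ft n (X.ty n t)

def cxOf : (s : Srt) → K s → K (cx s.2)
  | (.ctx, _), x => x
  | (.tm, n), x => X.ft n (X.ty n x)

/-- `ft^{n-m} : (ctx, n) → (ctx, m)`. -/
def ftTo (m : ℕ) : (n : ℕ) → m ≤ n → K (cx n) → K (cx m)
  | 0, h, x => (Nat.le_zero.1 h) ▸ x
  | n + 1, h, x => if h' : m ≤ n then ftTo m n h' (X.ft n x)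
    else (show n + 1 = m by omega) ▸ x

@[simp] theorem ftTo_self {n : ℕ} (h : n ≤ n) (x : K (cx n)) : X.ftTo n n h x = x := by
  cases n with
  | zero => rfl
  | succ n => rw [ftTo, dif_neg (by omega)]

theorem ftTo_succ {m n : ℕ} (h : m ≤ n) (h' : m ≤ n + 1) (x : K (cx (n + 1))) :
    X.ftTo m (n + 1) h' x = X.ftTo m n h (X.ft n x) := by
  rw [ftTo, dif_pos h]

theorem ftTo_ftTo {k m n : ℕ} (h : k ≤ m) (h' : m ≤ n) (x : K (cx n)) :
    X.ftTo k m h (X.ftTo m n h' x) = X.ftTo k n (h.trans h') x := by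
  induction n, h' using Nat.le_induction with
  | base => simp
  | succ n h' ih => rw [X.ftTo_succ h', ih, X.ftTo_succ]

theorem ft_ftTo {m n : ℕ} (h : m + 1 ≤ n) (x : K (cx n)) :
    X.ft m (X.ftTo (m + 1) n h x) = X.ftTo m n (by omega) x := by
  rw [← X.ftTo_ftTo (Nat.le_succ m) h, X.ftTo_succ le_rfl, ftTo_self]

/-- The variables `v_{n,n-1}(A), …, v_{n,n-m}(A)`. -/
def wv (n m : ℕ) (h : m ≤ n) (A : K (cx n)) (r : Fin m) : K (tmS n) := X.w n (r.castLE h) A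

def Hom (n : ℕ) : (k : ℕ) → K (cx n) → K (cx k) → (Fin k → K (tmS n)) → Prop
  | 0, _, _, _ => True
  | k + 1, B, A, a => Hom n k B (X.ft k A) (fun i => a i.castSucc) ∧
      X.ty n (a (Fin.last k)) ∈ X.sub .ty n k B A (fun i => a i.castSucc)

/-- The axioms of the theory of substitutions. -/
structure IsModel : Prop where
  star_unique (x : K (cx 0)) : x = X.star
  sub_dom (p : Cls) {n k : ℕ} {B : K (cx n)} {t : K (p.sort k)} {a : Fin k → K (tmS n)} :
    (X.sub p n k B t a).Dom ↔ X.Hom n k B (X.ctxOf p k t) a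
  ty_w {n : ℕ} (j : Fin n) (A : K (cx n)) :
    X.ty n (X.w n j A) ∈ X.sub .ty n j A (X.ftTo (j + 1) n j.2 A) (X.wv n j j.2.le A)
  sub_ft {n k : ℕ} {B : K (cx n)} {t : K (cx (k + 1))} {a : Fin k → K (tmS n)}
    {y : K (cx (n + 1))} : y ∈ X.sub .ty n k B t a → X.ft n y = B
  ty_sub {n k : ℕ} {B : K (cx n)} {t : K (tmS k)} {a : Fin k → K (tmS n)} {y : K (tmS n)} :
    y ∈ X.sub .tm n k B t a → X.ty n y ∈ X.sub .ty n k B (X.ty k t) a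
  sub_id (p : Cls) {n : ℕ} (t : K (p.sort n)) :
    t ∈ X.sub p n n (X.ctxOf p n t) t (X.wv n n le_rfl (X.ctxOf p n t))
  sub_w {n k : ℕ} {B : K (cx n)} {A : K (cx k)} {a : Fin k → K (tmS n)} (j : Fin k) :
    X.Hom n k B A a → a j ∈ X.sub .tm n k B (X.w k j A) a
  sub_sub (p : Cls) {n k m : ℕ} {C : K (cx n)} {B : K (cx k)} {t : K (p.sort m)}
    {b : Fin k → K (tmS n)} {a : Fin m → K (tmS k)} {y : K (p.sort k)} :
    X.Hom n k C B b → y ∈ X.sub p k m B t a →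
    ∃ c : Fin m → K (tmS n), (∀ i, c i ∈ X.sub .tm n k C (a i) b) ∧
      ∃ z, z ∈ X.sub p n k C y b ∧ z ∈ X.sub p n m C t c

end SOps

namespace SOps.IsModel

variable {K : Srt → Type v} {X : SOps K} (hX : X.IsModel)
include hX

theorem ctxOf_sub {p : Cls} {n k : ℕ} {B : K (cx n)} {t : K (p.sort k)} {a : Fin k → K (tmS n)}
    {y : K (p.sort n)} (h : y ∈ X.sub p n k B t a) : X.ctxOf p n y = B := by
  cases p with
  | ty => exact hX.sub_ft h
  | tm => exact hX.sub_ft (hX.ty_sub h)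

theorem ft_ty_w {n : ℕ} (j : Fin n) (A : K (cx n)) : X.ft n (X.ty n (X.w n j A)) = A :=
  hX.sub_ft (hX.ty_w j A)

/-- Each component of `Hom` is the typing axiom of the corresponding variable, since a truncation of
a truncation is a truncation. -/
theorem hom_wv {n m : ℕ} (h : m ≤ n) (A : K (cx n)) :
    X.Hom n m A (X.ftTo m n h A) (X.wv n m h A) := by
  induction m with
  | zero => trivial
  | succ m ih =>
    refine ⟨?_, hX.ty_w (n := n) ⟨m, h⟩ A⟩
    rw [X.ft_ftTo]
    exact ih (by omega)

end SOps.IsModel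

/-! ### Slices -/

namespace SOps

variable {K : Srt → Type v} (X : SOps K) {γ : K (cx 1)} {P : ∀ s : Srt, K (s.up 1) → Prop}

/-- `x` is over `γ`. -/
def IsOver (γ : K (cx 1)) (s : Srt) (x : K (s.up 1)) : Prop :=
  X.ftTo 1 (s.2 + 1) (by omega) (X.cxOf (s.up 1) x) = γ

open Str (SliceCarrier)

/-- An element of a slice as an element of the given model. -/
def sliceVal : (p : Cls) → (n : ℕ) → SliceCarrier P (p.sort n) → K (p.sort (n + 1))
  | .ty, _, x => x.1
  | .tm, _, x => x.1

section

variable (hX : X.IsModel) (hP : ∀ s x, P s x ↔ X.IsOver γ s x)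

/-- The model of elements over `γ`. -/
def slice : SOps (SliceCarrier P) where
  star := ⟨γ, (hP _ _).2 (X.ftTo_self _ _)⟩
  ft n x := ⟨X.ft (n + 1) x.1, (hP (cx n) _).2 (by
    rw [← (hP (cx (n + 1)) _).1 x.2]
    exact (X.ftTo_succ (by omega) (by omega) _).symm)⟩
  ty n x := ⟨X.ty (n + 1) x.1, (hP (cx (n + 1)) _).2 (by
    rw [← (hP (tmS n) _).1 x.2]
    exact X.ftTo_succ (n := n + 1) (by omega) (by omega) _)⟩
  -- Variables are counted from the beginning of the context. The variable of `γ` has index `0`, and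
  -- those of the slice are shifted by one.
  w n j A := ⟨X.w (n + 1) j.succ A.1, (hP (tmS n) _).2 (by
    rw [← (hP (cx n) _).1 A.2]
    simp only [IsOver, cxOf, hX.ft_ty_w])⟩
  sub
  | .ty, n, k, B, t, a => (X.sub .ty (n + 1) (k + 1) B.1 t.1
      (Fin.cons (α := fun _ => K (tmS (n + 1))) (X.w (n + 1) 0 B.1) fun i => (a i).1)).bind
    fun z => Part.assert (P (tyS n) z) fun h => Part.some ⟨z, h⟩
  | .tm, n, k, B, t, a => (X.sub .tm (n + 1) (k + 1) B.1 t.1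
      (Fin.cons (α := fun _ => K (tmS (n + 1))) (X.w (n + 1) 0 B.1) fun i => (a i).1)).bind
    fun z => Part.assert (P (tmS n) z) fun h => Part.some ⟨z, h⟩

/-- The list of terms `v_{n,n}(B), a₁, …, a_k`. -/
def consW {n k : ℕ} (B : SliceCarrier P (cx n)) (a : Fin k → SliceCarrier P (tmS n)) :
    Fin (k + 1) → K (tmS (n + 1)) :=
  Fin.cons (α := fun _ => K (tmS (n + 1))) (X.w (n + 1) 0 B.1) fun i => (a i).1

theorem mem_slice_sub {p : Cls} {n k : ℕ} {B : SliceCarrier P (cx n)}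
    {t : SliceCarrier P (p.sort k)} {a : Fin k → SliceCarrier P (tmS n)}
    {z : SliceCarrier P (p.sort n)} :
    z ∈ (X.slice hX hP).sub p n k B t a ↔
      sliceVal p n z ∈ X.sub p (n + 1) (k + 1) B.1 (sliceVal p k t) (X.consW B a) := by
  cases p
  all_goals
    refine Part.mem_bind_iff.trans ⟨?_, fun h => ⟨_, h, ?_⟩⟩
    · rintro ⟨a, h, h'⟩
      obtain ⟨h', h''⟩ := Part.mem_assert_iff.1 h'
      rw [Part.mem_some_iff.1 h'']
      exact h
    · exact Part.mem_assert_iff.2 ⟨z.2, Part.mem_some _⟩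

include hX hP in
-- The result of a substitution has the target context `B` as its context, and `B` is over `γ`; no
-- substitution between elements of the slice leaves it.
theorem exists_slice_sub {p : Cls} {n k : ℕ} {B : SliceCarrier P (cx n)}
    {t : SliceCarrier P (p.sort k)} {a : Fin k → SliceCarrier P (tmS n)}
    {y : K (p.sort (n + 1))}
    (h : y ∈ X.sub p (n + 1) (k + 1) B.1 (sliceVal p k t) (X.consW B a)) :
    ∃ z, sliceVal (P := P) p n z = y := by
  have hB := (hP _ _).1 B.2
  cases p
  · refine ⟨⟨y, (hP (tyS n) _).2 ?_⟩, rfl⟩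
    rw [← hB, IsOver, X.ftTo_succ (n := n + 1) (by omega)]
    exact congrArg _ (hX.sub_ft h)
  · refine ⟨⟨y, (hP (tmS n) _).2 ?_⟩, rfl⟩
    rw [← hB, IsOver]
    exact congrArg _ (hX.ctxOf_sub h)

theorem slice_ctxOf {p : Cls} {n : ℕ} (t : SliceCarrier P (p.sort n)) :
    ((X.slice hX hP).ctxOf p n t).1 = X.ctxOf p (n + 1) (sliceVal p n t) := by
  cases p <;> rfl

theorem slice_cxOf {s : Srt} (t : SliceCarrier P s) :
    ((X.slice hX hP).cxOf s t).1 = X.cxOf (s.up 1) t.1 := by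
  obtain ⟨⟨⟩, n⟩ := s <;> rfl

theorem slice_ftTo {m n : ℕ} (h : m ≤ n) (x : SliceCarrier P (cx n)) :
    ((X.slice hX hP).ftTo m n h x).1 = X.ftTo (m + 1) (n + 1) (by omega) x.1 := by
  induction n, h using Nat.le_induction with
  | base => simp
  | succ n h ih =>
    rw [ftTo_succ _ h, ih, X.ftTo_succ (n := n + 1) (by omega)]
    rfl

theorem consW_castSucc {n k : ℕ} (B : SliceCarrier P (cx n))
    (a : Fin (k + 1) → SliceCarrier P (tmS n)) :
    (fun i => X.consW B a i.castSucc) = X.consW B fun i => a i.castSucc := by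
  funext i
  refine Fin.cases rfl (fun i => ?_) i
  rfl

theorem consW_wv {n m : ℕ} (h : m ≤ n) (B : SliceCarrier P (cx n)) :
    X.consW B ((X.slice hX hP).wv n m h B) = X.wv (n + 1) (m + 1) (by omega) B.1 := by
  funext i
  refine Fin.cases rfl (fun i => ?_) i
  rfl

include hX in
theorem ty_w_zero {n : ℕ} (B : SliceCarrier P (cx n)) (a : Fin 0 → K (tmS (n + 1))) :
    X.ty (n + 1) (X.w (n + 1) 0 B.1) ∈
      X.sub .ty (n + 1) 0 B.1 (X.ftTo 1 (n + 1) (by omega) B.1) a := by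
  rw [Subsingleton.elim a (X.wv (n + 1) 0 (by omega) B.1)]
  exact hX.ty_w (n := n + 1) 0 B.1

/-- The additional component on the right is the first variable of `B`. Its typing condition always
holds, because the truncations of `A` and of `B` to length one are both `γ`; the other components
correspond one to one. -/
theorem slice_hom {n k : ℕ} (B : SliceCarrier P (cx n)) (A : SliceCarrier P (cx k))
    (a : Fin k → SliceCarrier P (tmS n)) :
    (X.slice hX hP).Hom n k B A a ↔ X.Hom (n + 1) (k + 1) B.1 A.1 (X.consW B a) := by
  induction k with
  | zero =>
    refine ⟨fun _ => ⟨trivial, ?_⟩, fun _ => trivial⟩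
    have hA : A.1 = X.ftTo 1 (n + 1) (by omega) B.1 := by
      have h1 : X.ftTo 1 1 le_rfl A.1 = γ := (hP (cx 0) _).1 A.2
      rw [ftTo_self] at h1
      exact h1.trans ((hP (cx n) _).1 B.2).symm
    rw [hA]
    exact X.ty_w_zero hX B _
  | succ k ih =>
    rw [Hom, Hom, ih, mem_slice_sub, consW_castSucc]
    rfl

/-- This is not a formal consequence of prestability, since the axioms of `L(T)` do not include
liftings of the axioms of `T`. Each axiom in the slice is the same axiom of `X` one level higher,
with the first variable put in front of every list of terms. -/
theorem slice_isModel : (X.slice hX hP).IsModel where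
  star_unique x := Subtype.ext <| by
    have h1 : X.ftTo 1 1 le_rfl x.1 = γ := (hP (cx 0) _).1 x.2
    rwa [ftTo_self] at h1
  sub_dom p {n k B t a} := by
    rw [slice_hom, slice_ctxOf, ← hX.sub_dom]
    constructor
    · intro h
      exact ((X.mem_slice_sub hX hP).1 (Part.get_mem h)).1
    · intro h
      obtain ⟨z, hz⟩ := X.exists_slice_sub hX hP (Part.get_mem h)
      exact ((X.mem_slice_sub hX hP (z := z)).2 (hz ▸ Part.get_mem h)).1
  ty_w {n} j A := by
    rw [mem_slice_sub, consW_wv]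
    have := hX.ty_w (n := n + 1) j.succ A.1
    rw [show sliceVal Cls.ty _ ((X.slice hX hP).ftTo (j + 1) n j.2 A) = _ from
      X.slice_ftTo hX hP j.2 A]
    exact this
  sub_ft {n k B t a y} h := Subtype.ext (hX.sub_ft ((X.mem_slice_sub hX hP (p := .ty)).1 h))
  ty_sub {n k B t a y} h :=
    (X.mem_slice_sub hX hP (p := .ty)).2 (hX.ty_sub ((X.mem_slice_sub hX hP (p := .tm)).1 h))
  sub_id p {n} t := by
    rw [mem_slice_sub, consW_wv, slice_ctxOf]
    exact hX.sub_id p _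
  sub_w {n k B A a} j h :=
    (X.mem_slice_sub hX hP (p := .tm)).2 (hX.sub_w j.succ ((X.slice_hom hX hP _ _ _).1 h))
  sub_sub p {n k m C B t b a y} h h' := by
    obtain ⟨c, hc, z, hz, hz'⟩ := hX.sub_sub p ((X.slice_hom hX hP _ _ _).1 h)
      ((X.mem_slice_sub hX hP).1 h')
    -- The first variable of `B` is sent to the first entry of the next list, which is the first
    -- variable of `C`. So the composite list again has the form required in the slice.
    have h0 : c 0 = X.w (n + 1) 0 C.1 :=
      Part.mem_unique (hc 0) (hX.sub_w 0 ((X.slice_hom hX hP _ _ _).1 h))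
    choose c' hc' using fun i : Fin m =>
      X.exists_slice_sub hX hP (p := .tm) (t := a i) (hc i.succ)
    have ec : c = X.consW C c' := by
      funext i
      refine Fin.cases h0 (fun i => (hc' i).symm) i
    rw [ec] at hz'
    obtain ⟨z', rfl⟩ := X.exists_slice_sub hX hP hz'
    refine ⟨c', fun i => (X.mem_slice_sub hX hP (p := .tm)).2 ?_, z',
      (X.mem_slice_sub hX hP).2 hz, (X.mem_slice_sub hX hP).2 hz'⟩
    rw [hc' i]
    exact hc i.succ

end

end SOps

/-! ### Substitution under variables -/

open Str (SliceCarrier)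

/-- Transport along an equality of sorts. -/
def castS {S : Type} {K : S → Type v} {s s' : S} (h : s = s') (x : K s) : K s' := h ▸ x

namespace SOps

variable {K : Srt → Type v} (X : SOps K)

/-- `c` is the list of the weakenings of `a₁, …, a_k` followed by the last `i` variables. -/
def IsLift {n k : ℕ} (a : Fin k → K (tmS n)) (i : ℕ) {nn kk : ℕ} (hn : nn = n + i)
    (hk : kk = k + i) (B' : K (cx nn)) (c : Fin kk → K (tmS nn)) : Prop :=
  (∀ r : Fin k, c ⟨r, by omega⟩ ∈ X.sub .tm nn n B' (a r) (X.wv nn n (by omega) B')) ∧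
    ∀ r : Fin i, c ⟨k + r, by omega⟩ = X.w nn ⟨n + r, by omega⟩ B'

/-- The graph of `subst^i_{ctx,n,k}(B, -, a₁, …, a_k)`. -/
def SubC {n k : ℕ} (B : K (cx n)) (a : Fin k → K (tmS n)) :
    ∀ (i : ℕ) {nn kk : ℕ}, nn = n + i → kk = k + i → K (cx kk) → K (cx nn) → Prop
  | 0, _, _, hn, _, _, y => y = hn.symm ▸ B
  | i + 1, nn + 1, kk + 1, _, _, A, y => ∃ B',
      SubC B a i (nn := nn) (kk := kk) (by omega) (by omega) (X.ft kk A) B' ∧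
      ∃ c, X.IsLift a i (nn := nn) (kk := kk) (by omega) (by omega) B' c ∧
        y ∈ X.sub .ty nn kk B' A c
  | _ + 1, 0, _, _, _, _, _ => False
  | _ + 1, _, 0, _, _, _, _ => False

/-- The graph of `subst^i_{p,n,k}(B, -, a₁, …, a_k)` for `p ∈ {ty, tm}`. -/
def SubP {n k : ℕ} (B : K (cx n)) (a : Fin k → K (tmS n)) (p : Cls) (i : ℕ) {nn kk : ℕ}
    (hn : nn = n + i) (hk : kk = k + i) (t : K (p.sort kk)) (y : K (p.sort nn)) : Prop :=
  ∃ B', X.SubC B a i hn hk (X.ctxOf p kk t) B' ∧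
    ∃ c, X.IsLift a i hn hk B' c ∧ y ∈ X.sub p nn kk B' t c

/-- The graph of `subst^i_{p,n,k}(B, -, a₁, …, a_k)` for a sort `(p, i)`. -/
def SubUp {n k : ℕ} (B : K (cx n)) (a : Fin k → K (tmS n)) :
    (s : Srt) → K (s.up k) → K (s.up n) → Prop
  | (.ctx, i), t, y => X.SubC B a i (Nat.add_comm i n) (Nat.add_comm i k) t y
  | (.tm, i), t, y => X.SubP B a .tm i (Nat.add_comm i n) (Nat.add_comm i k) t y

/-- A context of length `i + 1` over the base is a type over the preceding context. The lengths `nn`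
and `kk` are free indices tied by equations, so that `n + i` and `i + n` can both be used without
transport. -/
theorem subC_succ {n k i : ℕ} (B : K (cx n)) (a : Fin k → K (tmS n)) {nn kk : ℕ}
    (hn : nn + 1 = n + (i + 1)) (hk : kk + 1 = k + (i + 1)) (A : K (cx (kk + 1)))
    (y : K (cx (nn + 1))) : X.SubC B a (i + 1) hn hk A y ↔
      X.SubP B a .ty i (nn := nn) (kk := kk) (by omega) (by omega) A y := Iff.rfl

/-- The list of terms `v_{m,m-1}(Δ), …, v_{m,0}(Δ), a₁, …, a_j`. -/
def args (m j : ℕ) {nn : ℕ} (h : nn = m + j) (Δ : K (cx m)) (a : Fin j → K (tmS m)) (r : Fin nn) :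
    K (tmS m) :=
  if hr : r < m then X.w m ⟨r, hr⟩ Δ else a ⟨r - m, by omega⟩

theorem args_left {m j nn : ℕ} (h : nn = m + j) (Δ : K (cx m)) (a : Fin j → K (tmS m)) (r : Fin nn)
    (hr : r < m) : X.args m j h Δ a r = X.w m ⟨r, hr⟩ Δ := dif_pos hr

theorem args_right {m j nn : ℕ} (h : nn = m + j) (Δ : K (cx m)) (a : Fin j → K (tmS m)) (r : Fin j)
    (hr : m + r < nn) : X.args m j h Δ a ⟨m + r, hr⟩ = a r := by
  rw [args, dif_neg (by simp)]
  congr 1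
  exact Fin.ext (by simp)

variable {X} (hX : X.IsModel)
include hX

theorem SubC.ftTo_eq {n k : ℕ} {B : K (cx n)} {a : Fin k → K (tmS n)} {i nn kk : ℕ}
    {hn : nn = n + i} {hk : kk = k + i} {x : K (cx kk)} {y : K (cx nn)}
    (h : X.SubC B a i hn hk x y) : X.ftTo n nn (by omega) y = B := by
  induction i generalizing nn kk with
  | zero =>
    obtain rfl : nn = n := hn
    obtain rfl : y = B := h
    exact X.ftTo_self _ _
  | succ i ih =>
    obtain ⟨nn, rfl⟩ : ∃ m, nn = m + 1 := ⟨n + i, hn⟩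
    obtain ⟨kk, rfl⟩ : ∃ m, kk = m + 1 := ⟨k + i, hk⟩
    obtain ⟨B', h, c, hc, hy⟩ := (X.subC_succ ..).1 h
    rw [X.ftTo_succ (by omega), hX.sub_ft hy]
    exact ih h

theorem SubUp.ftTo_eq {n k : ℕ} {B : K (cx n)} {a : Fin k → K (tmS n)} {s : Srt}
    {x : K (s.up k)} {y : K (s.up n)} (h : X.SubUp B a s x y) :
    X.ftTo n (s.2 + n) (Nat.le_add_left _ _) (X.cxOf (s.up n) y) = B := by
  obtain ⟨⟨⟩, i⟩ := s
  · exact SubC.ftTo_eq hX h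
  · obtain ⟨B', h, c, hc, hy⟩ := h
    exact (congrArg _ (hX.ctxOf_sub hy)).trans (SubC.ftTo_eq hX h)

theorem SubC.ft {n k : ℕ} {B : K (cx n)} {a : Fin k → K (tmS n)} {i nn kk : ℕ}
    {hn : nn + 1 = n + (i + 1)} {hk : kk + 1 = k + (i + 1)} {x : K (cx (kk + 1))}
    {y : K (cx (nn + 1))} (h : X.SubC B a (i + 1) hn hk x y) :
    X.SubC B a i (nn := nn) (kk := kk) (by omega) (by omega) (X.ft kk x) (X.ft nn y) := by
  obtain ⟨B', h, c, hc, hy⟩ := (X.subC_succ ..).1 h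
  rw [hX.sub_ft hy]
  exact h

theorem SubC.ftTo {n k : ℕ} {B : K (cx n)} {a : Fin k → K (tmS n)} {i nn kk j nj kj : ℕ}
    {hn : nn = n + i} {hk : kk = k + i} {x : K (cx kk)} {y : K (cx nn)}
    (h : X.SubC B a i hn hk x y) (hj : j ≤ i) (hnj : nj = n + j) (hkj : kj = k + j) :
    X.SubC B a j hnj hkj (X.ftTo kj kk (by omega) x) (X.ftTo nj nn (by omega) y) := by
  induction i, hj using Nat.le_induction generalizing nn kk with
  | base =>
    obtain rfl : nj = nn := by omega
    obtain rfl : kj = kk := by omega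
    simpa using h
  | succ i hj ih =>
    obtain ⟨nn, rfl⟩ : ∃ m, nn = m + 1 := ⟨n + i, hn⟩
    obtain ⟨kk, rfl⟩ : ∃ m, kk = m + 1 := ⟨k + i, hk⟩
    rw [X.ftTo_succ (by omega), X.ftTo_succ (by omega)]
    exact ih (SubC.ft hX h)

omit hX in
theorem isLift_zero {n : ℕ} {a : Fin 0 → K (tmS n)} {i nn kk : ℕ} {hn : nn = n + i}
    {hk : kk = 0 + i} {B' : K (cx nn)} {c : Fin kk → K (tmS nn)} :
    X.IsLift a i hn hk B' c ↔ ∀ r : Fin kk, c r = X.w nn ⟨n + r, by omega⟩ B' := by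
  obtain rfl : kk = i := by omega
  simp only [IsLift, IsEmpty.forall_iff, true_and]
  refine forall_congr' fun r => ?_
  rw [show (⟨0 + r, by omega⟩ : Fin kk) = r from Fin.ext (by simp)]

/-- Here `W` is `τ` followed by a weakened copy of its own first `i` types, and the morphism is a
diagonal: all variables of `τ` followed by the first `i` of them again. By associativity of
substitution, the type required for a repeated variable is the one given by its typing axiom. -/
theorem hom_args_wv {j i nn kk : ℕ} {τ : K (cx j)} {a : Fin 0 → K (tmS j)} (hi : i ≤ j)
    {hn : nn = j + i} {hk : kk = 0 + i} {W : K (cx nn)}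
    (h : X.SubC τ a i hn hk (X.ftTo kk j (by omega) τ) W) :
    X.Hom j nn τ W (X.args j i hn τ (X.wv j i hi τ)) := by
  induction i generalizing nn kk with
  | zero =>
    obtain rfl : nn = j := hn
    obtain rfl : W = τ := h
    convert hX.hom_wv le_rfl W using 1
    · simp
    · funext r
      rw [args_left _ _ _ _ _ r.2]
      rfl
  | succ i ih =>
    obtain ⟨nn, rfl⟩ : ∃ m, nn = m + 1 := ⟨j + i, hn⟩
    obtain ⟨kk, rfl⟩ : ∃ m, kk = m + 1 := ⟨0 + i, hk⟩
    have hW := SubC.ft hX h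
    rw [X.ft_ftTo] at hW
    have h1 := ih (by omega) hW
    obtain ⟨B', h, c, hc, hy⟩ := (X.subC_succ ..).1 h
    rw [isLift_zero] at hc
    have e : (fun r : Fin nn => X.args j (i + 1) hn τ (X.wv j (i + 1) hi τ) r.castSucc) =
        X.args j i (by omega) τ (X.wv j i (by omega) τ) := rfl
    rw [Hom, e]
    refine ⟨h1, ?_⟩
    rw [hX.sub_ft hy] at h1
    obtain ⟨d, hd, z, hz, hz'⟩ := hX.sub_sub .ty h1 hy
    -- The list used for weakening consists of the last variables of `B'`, and the diagonal sends
    -- these back to the first variables of `τ`.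
    have ed : d = X.wv j kk (by omega) τ := by
      funext r
      have h2 := hd r
      rw [hc] at h2
      rw [Part.mem_unique h2 (hX.sub_w _ h1)]
      exact X.args_right (by omega) τ (X.wv j i (by omega) τ) ⟨r, by omega⟩ _
    rw [ed] at hz'
    have h3 := hX.ty_w (n := j) ⟨kk, by omega⟩ τ
    have h4 : X.args j (i + 1) hn τ (X.wv j (i + 1) hi τ) (Fin.last nn) =
        X.w j ⟨kk, by omega⟩ τ := by
      rw [args, dif_neg (by simp; omega)]
      simp only [wv]
      congr 1
      exact Fin.ext (by simp; omega)
    rw [h4, Part.mem_unique h3 hz']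
    exact hz

/-- Weakening followed by the substitution of the variables for themselves. -/
theorem mem_sub_of_subP {p : Cls} {j nn kk : ℕ} (e : kk = j) {τ : K (cx j)}
    {a : Fin 0 → K (tmS j)} {hn : nn = j + j} {hk : kk = 0 + j} {t : K (p.sort kk)}
    {y : K (p.sort nn)} (h : X.SubP τ a p j hn hk t y) (hτ : X.ctxOf p kk t = castS (congrArg cx e.symm) τ) :
    castS (congrArg p.sort e) t ∈ X.sub p j nn τ y (X.args j j hn τ (X.wv j j le_rfl τ)) := by
  subst e
  obtain rfl : X.ctxOf p kk t = τ := hτ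
  obtain ⟨W, h, c, hc, hy⟩ := h
  rw [isLift_zero] at hc
  -- The full diagonal: all of `τ` has been copied.
  have h1 := hom_args_wv hX le_rfl (W := W) (hn := hn) (hk := hk) (by rwa [X.ftTo_self])
  obtain ⟨d, hd, z, hz, hz'⟩ := hX.sub_sub p h1 hy
  have ed : d = X.wv kk kk le_rfl (X.ctxOf p kk t) := by
    funext r
    have h2 := hd r
    rw [hc] at h2
    rw [Part.mem_unique h2 (hX.sub_w _ h1)]
    exact X.args_right (by omega) _ (X.wv kk kk le_rfl _) r _
  -- What remains after composing is the substitution of the variables of the context of `t` for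
  -- themselves, which is the identity by `sub_id`.
  rw [ed] at hz'
  obtain rfl := Part.mem_unique hz' (hX.sub_id p t)
  exact hz

/-! ### Weakening in a slice as substitution of the first variable -/

section

variable {γ : K (cx 1)} {P : ∀ s : Srt, K (s.up 1) → Prop} (hP : ∀ s x, P s x ↔ X.IsOver γ s x)

omit hX in
theorem consW_args (hX : X.IsModel) {m j nn : ℕ} (h : nn = m + j) (Δ : SliceCarrier P (cx m))
    (a : Fin j → SliceCarrier P (tmS m)) :
    X.consW Δ ((X.slice hX hP).args m j h Δ a) =
      X.args (m + 1) j (nn := nn + 1) (by omega) Δ.1 fun r => (a r).1 := by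
  funext r
  refine Fin.cases ?_ (fun r => ?_) r
  · rw [args_left _ _ _ _ _ (by simp)]
    rfl
  · change ((X.slice hX hP).args m j h Δ a r).1 = _
    by_cases hr : (r : ℕ) < m
    · rw [args_left _ _ _ _ _ hr, args_left _ _ _ _ _ (by simpa using hr)]
      rfl
    · rw [args, dif_neg hr, args, dif_neg (by simpa using hr)]
      congr 2
      exact Fin.ext (by simp)

/-- The weakening to `B'` of the first variable of `τ` is the first variable of `B'`, since `B'`
extends `τ`. This is precisely the entry that the slice prepends to its lists of terms. -/
theorem isLift_one {n : ℕ} {τ : SliceCarrier P (cx n)} {i nn kk : ℕ} {hn : nn = n + i}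
    {hk : kk = 0 + i} {B' : SliceCarrier P (cx nn)} {c : Fin (kk + 1) → K (tmS (nn + 1))}
    (hB : X.ftTo (n + 1) (nn + 1) (by omega) B'.1 = τ.1)
    (h : X.IsLift (fun _ : Fin 1 => X.w (n + 1) 0 τ.1) i (nn := nn + 1) (kk := kk + 1)
      (by omega) (by omega) B'.1 c) :
    ∃ c', (X.slice hX hP).IsLift Fin.elim0 i hn hk B' c' ∧ c = X.consW B' c' := by
  refine ⟨fun r => (X.slice hX hP).w nn ⟨n + r, by omega⟩ B', isLift_zero.2 fun _ => rfl, ?_⟩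
  funext r
  refine Fin.cases ?_ (fun r => ?_) r
  · have h1 := hX.hom_wv (n := nn + 1) (m := n + 1) (by omega) B'.1
    rw [hB] at h1
    exact Part.mem_unique (h.1 0) (hX.sub_w 0 h1)
  · have h1 := h.2 ⟨r, by omega⟩
    have h2 : c r.succ = c ⟨1 + r, by omega⟩ := congrArg c (Fin.ext (by simp; omega))
    refine (h2.trans h1).trans ?_
    change _ = X.w (nn + 1) (Fin.succ _) B'.1
    congr 1
    exact Fin.ext (by simp; omega)

/-- In the slice `γ` plays the role of the empty context, so weakening along `τ` there is
substitution along the morphism from `τ` to `γ` given by the first variable. The commutation axiom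
for contexts of length one thereby yields weakening in slices. -/
theorem SubC.slice {n : ℕ} {τ : SliceCarrier P (cx n)} {i nn kk : ℕ} {hn : nn = n + i}
    {hk : kk = 0 + i} {x : SliceCarrier P (cx kk)} {y : K (cx (nn + 1))}
    (h : X.SubC (n := n + 1) τ.1 (fun _ : Fin 1 => X.w (n + 1) 0 τ.1) i (nn := nn + 1) (kk := kk + 1)
      (by omega) (by omega) x.1 y) :
    ∃ y', y'.1 = y ∧ (X.slice hX hP).SubC (n := n) τ Fin.elim0 i hn hk x y' := by
  induction i generalizing nn kk with
  | zero =>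
    obtain rfl : nn = n := hn
    obtain rfl : y = τ.1 := h
    exact ⟨τ, rfl, rfl⟩
  | succ i ih =>
    obtain ⟨nn, rfl⟩ : ∃ m, nn = m + 1 := ⟨n + i, hn⟩
    obtain ⟨kk, rfl⟩ : ∃ m, kk = m + 1 := ⟨0 + i, hk⟩
    obtain ⟨B', h, c, hc, hy⟩ := (X.subC_succ ..).1 h
    obtain ⟨B', rfl, h'⟩ := ih (nn := nn) (kk := kk) (hn := by omega) (hk := by omega)
      (x := (X.slice hX hP).ft kk x) h
    obtain ⟨c', hc', rfl⟩ := isLift_one hX hP (SubC.ftTo_eq hX h) hc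
    obtain ⟨z, rfl⟩ := X.exists_slice_sub hX hP (p := .ty) (t := x) hy
    exact ⟨z, rfl, ((X.slice hX hP).subC_succ ..).2
      ⟨B', h', c', hc', (X.mem_slice_sub hX hP (p := .ty)).2 hy⟩⟩

theorem SubUp.slice {n : ℕ} {τ : SliceCarrier P (cx n)} {s : Srt} {x : SliceCarrier P (s.up 0)}
    {y : K (s.up (n + 1))}
    (h : X.SubUp (n := n + 1) τ.1 (fun _ : Fin 1 => X.w (n + 1) 0 τ.1) s x.1 y) :
    ∃ y', y'.1 = y ∧ (X.slice hX hP).SubUp (n := n) τ Fin.elim0 s x y' := by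
  obtain ⟨⟨⟩, i⟩ := s
  · exact SubC.slice hX hP h
  · obtain ⟨B', h, c, hc, hy⟩ := h
    obtain ⟨B', rfl, h'⟩ := SubC.slice hX hP (kk := i + 0) (nn := i + n) (hn := by omega)
      (hk := by omega) (x := (X.slice hX hP).ctxOf .tm (i + 0) x) h
    obtain ⟨c', hc', rfl⟩ := isLift_one hX hP (SubC.ftTo_eq hX h) hc
    obtain ⟨z, rfl⟩ := X.exists_slice_sub hX hP (p := .tm) (t := x) hy
    exact ⟨z, rfl, B', h', c', hc', (X.mem_slice_sub hX hP (p := .tm)).2 hy⟩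

end

end SOps

/-! ### Pieces -/

/-- A context of length `j` of an element of the sort `s` has a type, or `s` is the sort of terms
of length `j`. -/
def Piece (s : Srt) : Cls → ℕ → Prop
  | .ty, j => j < s.2
  | .tm, j => s = tmS j

namespace SOps

variable {K : Srt → Type v} (X : SOps K)

/-- The type in a context of length `nn` that belongs to `u`, or the term `u` itself. -/
def piece {s : Srt} : (p : Cls) → {j : ℕ} → Piece s p j → (m : ℕ) → {nn : ℕ} → nn = m + j →
    K (s.up m) → K (p.sort nn)
  | .ty, _, hp, m, nn, h, u => X.ftTo (nn + 1) (s.2 + m) (by have : _ < s.2 := hp; omega)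
      (X.cxOf (s.up m) u)
  | .tm, j, hp, m, nn, h, u => castS (show s.up m = tmS nn by
      rw [show s = tmS j from hp, h, Nat.add_comm m j]) u

theorem piece_slice {X : SOps K} (hX : X.IsModel) {γ : K (cx 1)}
    {P : ∀ s : Srt, K (s.up 1) → Prop} (hP : ∀ s x, P s x ↔ X.IsOver γ s x)
    {s : Srt} {p : Cls} {j : ℕ} (hp : Piece s p j) {m nn : ℕ} (h : nn = m + j)
    (u : SliceCarrier P (s.up m)) :
    sliceVal p nn ((X.slice hX hP).piece p hp m h u) =
      X.piece p hp (m + 1) (nn := nn + 1) (by omega) u.1 := by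
  cases p with
  | ty =>
    refine (X.slice_ftTo hX hP _ _).trans ?_
    rw [X.slice_cxOf hX hP]
    rfl
  | tm =>
    obtain rfl : s = tmS j := hp
    obtain rfl : nn = j + m := by omega
    rfl

/-- Weakening proceeds type by type along a context, and hence commutes with passing to an initial
segment. A term is weakened together with its context. -/
theorem piece_subUp {X : SOps K} (hX : X.IsModel) {s : Srt} {p : Cls} {j : ℕ} (hp : Piece s p j)
    {τ : K (cx j)} {a : Fin 0 → K (tmS j)} {u : K (s.up 0)} {y : K (s.up j)}
    (h : X.SubUp τ a s u y) {nn kk : ℕ} (hn : nn = j + j) (hk : kk = 0 + j) :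
    X.SubP τ a p j hn hk (X.piece p hp 0 hk u) (X.piece p hp j hn y) := by
  cases p with
  | ty =>
    have hj : j < s.2 := hp
    have h' : ∃ (hn : s.2 + j = j + s.2) (hk : s.2 + 0 = 0 + s.2),
        X.SubC τ a s.2 hn hk (X.cxOf (s.up 0) u) (X.cxOf (s.up j) y) := by
      obtain ⟨⟨⟩, i⟩ := s
      · exact ⟨_, _, h⟩
      · obtain ⟨B', h, c, hc, hy⟩ := h
        refine ⟨Nat.add_comm _ _, Nat.add_comm _ _, ?_⟩
        rw [show X.cxOf (Srt.up (Base.tm, i) j) y = B' from hX.ctxOf_sub hy]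
        exact h
    obtain ⟨_, _, h'⟩ := h'
    exact (X.subC_succ ..).1 (SubC.ftTo hX h' (j := j + 1) (nj := nn + 1) (kj := kk + 1) hj
      (by omega) (by omega))
  | tm =>
    obtain rfl : s = tmS j := hp
    obtain rfl : kk = j + 0 := by omega
    obtain rfl := hn
    exact h

theorem ctxOf_piece {X : SOps K} {s : Srt} {p : Cls} {j : ℕ} (hp : Piece s p j)
    {m nn : ℕ} (h : nn = m + j) (u : K (s.up m)) :
    X.ctxOf p nn (X.piece p hp m h u) =
      X.ftTo nn (s.2 + m) (by cases p <;> [skip; obtain rfl := hp] <;> simp_all [Piece] <;> omega)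
        (X.cxOf (s.up m) u) := by
  cases p with
  | ty => exact X.ft_ftTo _ _
  | tm =>
    obtain rfl : s = tmS j := hp
    obtain rfl : nn = j + m := by omega
    exact (X.ftTo_self (n := j + m) _ _).symm

end SOps

/-! ### Structures with the operations of a model -/

theorem Arity.rep_one_eta {S : Type} {F : S → Type v} {s : S}
    (ys : ∀ i, F ((Arity.rep 1 s).sort i)) : ys = fun _ => ys (0 : Fin 1) :=
  funext fun i : Fin 1 => by rw [Subsingleton.elim i 0]

/-- A valuation of `Ctx.cons s V`. -/
def Ctx.consFam {S : Type} {F : S → Type v} {s : S} {V : Ctx S} (b : F s)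
    (ρ : ∀ x, F (V.sort x)) : ∀ x, F ((Ctx.cons s V).sort x)
  | none => b
  | some x => ρ x

/-- A valuation of `Ctx.append V W`. -/
def Ctx.appendFam {S : Type} {F : S → Type v} {V W : Ctx S} (ρ : ∀ x, F (V.sort x))
    (ρ' : ∀ x, F (W.sort x)) : ∀ x, F ((Ctx.append V W).sort x)
  | .inl x => ρ x
  | .inr x => ρ' x

theorem forall_fin_add {m n : ℕ} {Q : Fin (m + n) → Prop} :
    (∀ i, Q i) ↔ (∀ i : Fin m, Q (i.castAdd n)) ∧ ∀ i : Fin n, Q (i.natAdd m) :=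
  ⟨fun h => ⟨fun _ => h _, fun _ => h _⟩, fun h i => Fin.addCases h.1 h.2 i⟩

namespace Str

variable {K : Srt → Type v}

/-- The operations of `N` are those of `X`. -/
structure Realizes (N : Str substSig K) (X : SOps K) : Prop where
  star ys : N.fn .star ys = Part.some X.star
  ft n x : N.fn (.ft n) (fun _ => x) = Part.some (X.ft n x)
  ty n x : N.fn (.ty n) (fun _ => x) = Part.some (X.ty n x)
  v n i x : N.fn (.v n i) (fun _ => x) = Part.some (X.w n i.rev x)
  subst p n k B t a : N.fn (.subst p n k) (Arity.consFam (F := K) B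
    (Arity.consFam (F := K) (a := Arity.rep k (tmS n)) t a)) = X.sub p n k B t a

theorem mem_ev_cast {S : Type} {A : Signature.{u} S} {K : S → Type v} {M : Str A K} {V : Ctx S}
    {ρ : ∀ x, K (V.sort x)} {s s' : S} (h : s = s') {t : Term A V s} {x : K s'} :
    x ∈ M.ev ρ (t.cast h) ↔ castS h.symm x ∈ M.ev ρ t := by
  subst h
  rfl

namespace Realizes

variable {N : Str substSig K} {X : SOps K} (hR : N.Realizes X) {V : Ctx Srt}
  {ρ : ∀ x, K (V.sort x)}
include hR

theorem mem_ev_star {y : K (cx 0)} : y ∈ N.ev ρ (SubT.star) ↔ y = X.star := by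
  rw [← Part.mem_some_iff, ← hR.star (fun i : Fin 0 => i.elim0)]
  exact Part.ext_iff.1 (N.ev_app ρ (σ := SubstFn.star) fun i : Fin 0 => i.elim0) y

theorem mem_ev_ft {n : ℕ} {t : SubT.Tm V (cx (n + 1))} {y : K (cx n)} :
    y ∈ N.ev ρ (SubT.ft n t) ↔ ∃ x ∈ N.ev ρ t, X.ft n x = y := by
  refine (N.mem_ev_app ρ).trans ⟨fun ⟨ys, h, hy⟩ => ⟨ys (0 : Fin 1), h (0 : Fin 1), ?_⟩,
    fun ⟨x, h, hy⟩ => ⟨fun _ => x, fun _ => h, ?_⟩⟩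
  · rw [Arity.rep_one_eta ys] at hy
    exact (Part.mem_some_iff.1 ((Part.ext_iff.1 (hR.ft n _) y).1 hy)).symm
  · exact (Part.ext_iff.1 (hR.ft n _) y).2 (Part.mem_some_iff.2 hy.symm)

theorem mem_ev_ty {n : ℕ} {t : SubT.Tm V (tmS n)} {y : K (cx (n + 1))} :
    y ∈ N.ev ρ (SubT.ty n t) ↔ ∃ x ∈ N.ev ρ t, X.ty n x = y := by
  refine (N.mem_ev_app ρ).trans ⟨fun ⟨ys, h, hy⟩ => ⟨ys (0 : Fin 1), h (0 : Fin 1), ?_⟩,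
    fun ⟨x, h, hy⟩ => ⟨fun _ => x, fun _ => h, ?_⟩⟩
  · rw [Arity.rep_one_eta ys] at hy
    exact (Part.mem_some_iff.1 ((Part.ext_iff.1 (hR.ty n _) y).1 hy)).symm
  · exact (Part.ext_iff.1 (hR.ty n _) y).2 (Part.mem_some_iff.2 hy.symm)

theorem mem_ev_v {n : ℕ} {i : Fin n} {t : SubT.Tm V (cx n)} {y : K (tmS n)} :
    y ∈ N.ev ρ (SubT.v n i t) ↔ ∃ x ∈ N.ev ρ t, X.w n i.rev x = y := by
  refine (N.mem_ev_app ρ).trans ⟨fun ⟨ys, h, hy⟩ => ⟨ys (0 : Fin 1), h (0 : Fin 1), ?_⟩,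
    fun ⟨x, h, hy⟩ => ⟨fun _ => x, fun _ => h, ?_⟩⟩
  · rw [Arity.rep_one_eta ys] at hy
    exact (Part.mem_some_iff.1 ((Part.ext_iff.1 (hR.v n i _) y).1 hy)).symm
  · exact (Part.ext_iff.1 (hR.v n i _) y).2 (Part.mem_some_iff.2 hy.symm)

theorem mem_ev_subst {p : Cls} {n k : ℕ} {B : SubT.Tm V (cx n)} {t : SubT.Tm V (p.sort k)}
    {a : Fin k → SubT.Tm V (tmS n)} {y : K (p.sort n)} :
    y ∈ N.ev ρ (SubT.subst p n k B t a) ↔ ∃ b ∈ N.ev ρ B, ∃ u ∈ N.ev ρ t,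
      ∃ c : Fin k → K (tmS n), (∀ i, c i ∈ N.ev ρ (a i)) ∧ y ∈ X.sub p n k b u c := by
  refine (N.mem_ev_app ρ).trans (Arity.exists_consFam.trans (exists_congr fun b => ?_))
  refine Arity.exists_consFam.trans ⟨?_, ?_⟩
  · rintro ⟨u, c, h, hy⟩
    exact ⟨h (0 : Fin (k + 2)), u, h (Fin.succ (0 : Fin (k + 1))), c,
      fun i => h i.succ.succ, (Part.ext_iff.1 (hR.subst p n k b u c) y).1 hy⟩
  · rintro ⟨hb, u, hu, c, hc, hy⟩
    exact ⟨u, c, fun i => Fin.cases hb (fun i => Fin.cases hu hc i) i,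
      (Part.ext_iff.1 (hR.subst p n k b u c) y).2 hy⟩

theorem mem_ev_subst_iff {p : Cls} {n k : ℕ} {B : SubT.Tm V (cx n)} {t : SubT.Tm V (p.sort k)}
    {a : Fin k → SubT.Tm V (tmS n)} {b : K (cx n)} {u : K (p.sort k)} {c : Fin k → K (tmS n)}
    (hb : b ∈ N.ev ρ B) (hu : u ∈ N.ev ρ t) (hc : ∀ i, c i ∈ N.ev ρ (a i)) {y : K (p.sort n)} :
    y ∈ N.ev ρ (SubT.subst p n k B t a) ↔ y ∈ X.sub p n k b u c := by
  rw [hR.mem_ev_subst]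
  refine ⟨?_, fun h => ⟨b, hb, u, hu, c, hc, h⟩⟩
  rintro ⟨b', hb', u', hu', c', hc', h⟩
  obtain rfl := Part.mem_unique hb hb'
  obtain rfl := Part.mem_unique hu hu'
  obtain rfl : c = c' := funext fun i => Part.mem_unique (hc i) (hc' i)
  exact h

theorem ft_mem {n : ℕ} {t : SubT.Tm V (cx (n + 1))} {x : K (cx (n + 1))} (h : x ∈ N.ev ρ t) :
    X.ft n x ∈ N.ev ρ (SubT.ft n t) := hR.mem_ev_ft.2 ⟨x, h, rfl⟩

theorem ty_mem {n : ℕ} {t : SubT.Tm V (tmS n)} {x : K (tmS n)} (h : x ∈ N.ev ρ t) :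
    X.ty n x ∈ N.ev ρ (SubT.ty n t) := hR.mem_ev_ty.2 ⟨x, h, rfl⟩

theorem v_mem {n : ℕ} {i : Fin n} {t : SubT.Tm V (cx n)} {x : K (cx n)} (h : x ∈ N.ev ρ t) :
    X.w n i.rev x ∈ N.ev ρ (SubT.v n i t) := hR.mem_ev_v.2 ⟨x, h, rfl⟩

theorem ctxOf_mem {p : Cls} {n : ℕ} {t : SubT.Tm V (p.sort n)} {x : K (p.sort n)}
    (h : x ∈ N.ev ρ t) : X.ctxOf p n x ∈ N.ev ρ (SubT.ctxOf p n t) := by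
  cases p
  · exact hR.ft_mem h
  · exact hR.ft_mem (hR.ty_mem h)

theorem ftIter_mem {n i : ℕ} {t : SubT.Tm V (cx (n + i))} {x : K (cx (n + i))}
    (h : x ∈ N.ev ρ t) : X.ftTo n (n + i) (by omega) x ∈ N.ev ρ (SubT.ftIter n i t) := by
  induction i with
  | zero =>
    have e := X.ftTo_self le_rfl x
    exact e.symm ▸ h
  | succ i ih =>
    have e := X.ftTo_succ (m := n) (n := n + i) (by omega) (by omega) x
    exact e.symm ▸ ih (hR.ft_mem h)

theorem ftOne_mem {n : ℕ} {t : SubT.Tm V (cx (n + 1))} {x : K (cx (n + 1))}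
    (h : x ∈ N.ev ρ t) : X.ftTo 1 (n + 1) (by omega) x ∈ N.ev ρ (SubT.ftOne n t) := by
  induction n with
  | zero =>
    have e := X.ftTo_self le_rfl x
    exact e.symm ▸ h
  | succ i ih =>
    have e := X.ftTo_succ (m := 1) (n := i + 1) (by omega) (by omega) x
    exact e.symm ▸ ih (hR.ft_mem h)

theorem vars_mem {n j : ℕ} (hj : j ≤ n) {A : SubT.Tm V (cx n)} {x : K (cx n)}
    (h : x ∈ N.ev ρ A) (r : Fin j) : X.wv n j hj x r ∈ N.ev ρ (SubT.vars n j hj A r) := by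
  have := hR.v_mem (i := (r.castLE hj).rev) h
  rwa [Fin.rev_rev] at this

theorem sat_hom {n k : ℕ} {B : SubT.Tm V (cx n)} {A : SubT.Tm V (cx k)}
    {a : Fin k → SubT.Tm V (tmS n)} {b : K (cx n)} {u : K (cx k)} {c : Fin k → K (tmS n)}
    (hb : b ∈ N.ev ρ B) (hu : u ∈ N.ev ρ A) (hc : ∀ i, c i ∈ N.ev ρ (a i)) :
    N.sat ρ (SubT.hom n k B A a) ↔ X.Hom n k b u c := by
  induction k with
  | zero => exact Iff.rfl
  | succ k ih =>
    refine and_congr (ih (hR.ft_mem hu) fun i => hc _) ?_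
    rw [sat_eq]
    have h1 := hR.ty_mem (hc (Fin.last k))
    constructor
    · rintro ⟨y, h, h'⟩
      rw [Part.mem_unique h1 h]
      exact (hR.mem_ev_subst_iff (p := .ty) hb hu fun i => hc _).1 h'
    · intro h
      exact ⟨_, h1, (hR.mem_ev_subst_iff (p := .ty) hb hu fun i => hc _).2 h⟩

theorem liftArgs_iff {n k j : ℕ} {B : SubT.Tm V (cx (n + j))} {a : Fin k → SubT.Tm V (tmS n)}
    {b : K (cx (n + j))} {c : Fin k → K (tmS n)} (hb : b ∈ N.ev ρ B)
    (hc : ∀ i, c i ∈ N.ev ρ (a i)) {d : Fin (k + j) → K (tmS (n + j))} :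
    (∀ i, d i ∈ N.ev ρ (SubT.liftArgs n k j B a i)) ↔ X.IsLift c j rfl rfl b d := by
  rw [forall_fin_add]
  simp only [SubT.liftArgs, Fin.addCases_left, Fin.addCases_right]
  refine and_congr (forall_congr' fun i => ?_) (forall_congr' fun i => ?_)
  · exact hR.mem_ev_subst_iff (p := .tm) hb (hc i) fun r => hR.vars_mem _ hb r
  · have h1 := hR.v_mem (i := (Fin.natAdd n i).rev) hb
    rw [Fin.rev_rev] at h1
    exact ⟨fun h => Part.mem_unique h h1, fun h => (show d (i.natAdd k) = _ from h).symm ▸ h1⟩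

theorem mem_ev_subst_lift {p : Cls} {n k j : ℕ} {B : SubT.Tm V (cx (n + j))}
    {a : Fin k → SubT.Tm V (tmS n)} {t : SubT.Tm V (p.sort (k + j))} {c : Fin k → K (tmS n)}
    (hc : ∀ i, c i ∈ N.ev ρ (a i)) {x : K (p.sort (k + j))} (hx : x ∈ N.ev ρ t)
    {y : K (p.sort (n + j))} :
    y ∈ N.ev ρ (SubT.subst p (n + j) (k + j) B t (SubT.liftArgs n k j B a)) ↔
      ∃ b ∈ N.ev ρ B, ∃ d, X.IsLift c j rfl rfl b d ∧ y ∈ X.sub p (n + j) (k + j) b x d := by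
  rw [hR.mem_ev_subst]
  refine exists_congr fun b => and_congr_right fun hb => ?_
  constructor
  · rintro ⟨u, hu, d, hd, h⟩
    obtain rfl := Part.mem_unique hx hu
    exact ⟨d, (hR.liftArgs_iff hb hc).1 hd, h⟩
  · rintro ⟨d, hd, h⟩
    exact ⟨x, hx, d, (hR.liftArgs_iff hb hc).2 hd, h⟩

theorem mem_ev_substCtx {n k : ℕ} {B : SubT.Tm V (cx n)} {a : Fin k → SubT.Tm V (tmS n)}
    {b : K (cx n)} {c : Fin k → K (tmS n)} (hb : b ∈ N.ev ρ B) (hc : ∀ i, c i ∈ N.ev ρ (a i))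
    {j : ℕ} {t : SubT.Tm V (cx (k + j))} {x : K (cx (k + j))} (hx : x ∈ N.ev ρ t)
    {y : K (cx (n + j))} :
    y ∈ N.ev ρ (SubT.substCtx n k B a j t) ↔ X.SubC b c j rfl rfl x y := by
  induction j with
  | zero => exact ⟨fun h => Part.mem_unique h hb, fun h => (show y = b from h) ▸ hb⟩
  | succ j ih =>
    refine (hR.mem_ev_subst_lift (p := .ty) hc hx).trans ?_
    refine Iff.trans ?_ (X.subC_succ ..).symm
    exact exists_congr fun b' => and_congr_left' (ih (hR.ft_mem hx))

theorem mem_ev_substTm {n k : ℕ} {B : SubT.Tm V (cx n)} {a : Fin k → SubT.Tm V (tmS n)}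
    {b : K (cx n)} {c : Fin k → K (tmS n)} (hb : b ∈ N.ev ρ B) (hc : ∀ i, c i ∈ N.ev ρ (a i))
    {j : ℕ} {t : SubT.Tm V (tmS (k + j))} {x : K (tmS (k + j))} (hx : x ∈ N.ev ρ t)
    {y : K (tmS (n + j))} :
    y ∈ N.ev ρ (SubT.substTm n k B a j t) ↔ X.SubP b c .tm j rfl rfl x y := by
  refine (hR.mem_ev_subst_lift (p := .tm) hc hx).trans ?_
  exact exists_congr fun b' => and_congr_left'
    (hR.mem_ev_substCtx hb hc (hR.ctxOf_mem (p := .tm) hx))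

omit hR in
theorem _root_.PHT.SOps.subC_cast (X : SOps K) {n k i nn kk nn' kk' : ℕ} {b : K (cx n)}
    {c : Fin k → K (tmS n)} {hn : nn = n + i} {hk : kk = k + i} (en : nn = nn') (ek : kk = kk')
    {x : K (cx kk)} {y : K (cx nn)} : X.SubC b c i (en ▸ hn) (ek ▸ hk) (castS (congrArg cx ek) x)
      (castS (congrArg cx en) y) ↔ X.SubC b c i hn hk x y := by
  subst en ek
  rfl

omit hR in
theorem _root_.PHT.SOps.subP_cast (X : SOps K) {n k i nn kk nn' kk' : ℕ} {b : K (cx n)}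
    {c : Fin k → K (tmS n)} {hn : nn = n + i} {hk : kk = k + i} (en : nn = nn') (ek : kk = kk')
    {p : Cls} {x : K (p.sort kk)} {y : K (p.sort nn)} :
    X.SubP b c p i (en ▸ hn) (ek ▸ hk) (castS (congrArg p.sort ek) x)
      (castS (congrArg p.sort en) y) ↔ X.SubP b c p i hn hk x y := by
  subst en ek
  rfl

omit hR in
theorem _root_.PHT.castS_castS {S : Type} {K : S → Type v} {s s' s'' : S} (h : s = s')
    (h' : s' = s'') (x : K s) : castS h' (castS h x) = castS (h.trans h') x := by
  subst h h'
  rfl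

theorem mem_ev_substUp {n k : ℕ} {B : SubT.Tm V (cx n)} {a : Fin k → SubT.Tm V (tmS n)}
    {b : K (cx n)} {c : Fin k → K (tmS n)} (hb : b ∈ N.ev ρ B) (hc : ∀ i, c i ∈ N.ev ρ (a i))
    {s : Srt} {t : SubT.Tm V (s.up k)} {x : K (s.up k)} (hx : x ∈ N.ev ρ t) {y : K (s.up n)} :
    y ∈ N.ev ρ (SubT.substUp n k B s t a) ↔ X.SubUp b c s x y := by
  obtain ⟨⟨⟩, j⟩ := s
  · have hx' : castS (congrArg cx (Nat.add_comm j k)) x ∈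
        N.ev ρ (t.cast (congrArg cx (Nat.add_comm j k))) := by
      rw [mem_ev_cast, castS_castS]
      exact hx
    refine (mem_ev_cast _).trans ((hR.mem_ev_substCtx hb hc hx').trans ?_)
    exact X.subC_cast (Nat.add_comm j n) (Nat.add_comm j k)
  · have hx' : castS (congrArg tmS (Nat.add_comm j k)) x ∈
        N.ev ρ (t.cast (congrArg tmS (Nat.add_comm j k))) := by
      rw [mem_ev_cast, castS_castS]
      exact hx
    refine (mem_ev_cast _).trans ((hR.mem_ev_substTm hb hc hx').trans ?_)
    exact X.subP_cast (p := .tm) (Nat.add_comm j n) (Nat.add_comm j k)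

end Realizes

/-! ### Models of the theory of substitutions -/

section

variable {N : Str substSig K} (hN : Models (T := substTheory) N)
include hN

theorem exists_star_mem : ∃ y, y ∈ N.fn .star fun i => Fin.elim0 i := by
  obtain ⟨y, h, -⟩ := hN _ ⟨.star, rfl⟩ (fun i : Fin 0 => i.elim0) trivial
  obtain ⟨ys, -, h⟩ := (N.mem_ev_app _).1 h
  rw [show ys = fun i => Fin.elim0 i from funext fun i => Fin.elim0 i] at h
  exact ⟨y, h⟩

theorem exists_v_mem (n : ℕ) (i : Fin n) (x : K (cx n)) : ∃ y, y ∈ N.fn (.v n i) fun _ => x := by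
  obtain ⟨y, h, -⟩ := hN _ ⟨.def_var n i, rfl⟩ (fun _ : Fin 1 => x) trivial
  obtain ⟨ys, h', h⟩ := (N.mem_ev_app _).1 h
  rw [show ys = fun _ => x from funext fun i => Part.mem_some_iff.1 (h' i)] at h
  exact ⟨y, h⟩

/-- Totality of `ft` is not stated by an axiom. It follows by strictness from the axiom that
substituting the variables of a type into it is the identity, since `ft x` occurs in that equation;
`ty` is total for the same reason. -/
theorem exists_ft_mem (n : ℕ) (x : K (cx (n + 1))) : ∃ y, y ∈ N.fn (.ft n) fun _ => x := by
  obtain ⟨y, h, -⟩ := hN _ ⟨.subst_var .ty n, rfl⟩ (fun _ : Fin 1 => x) trivial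
  obtain ⟨ys, h', -⟩ := (N.mem_ev_app _).1 h
  obtain ⟨zs, h', h⟩ := (N.mem_ev_app _).1 (h' (0 : Fin (n + 2)))
  rw [show zs = fun _ => x from funext fun i => Part.mem_some_iff.1 (h' i)] at h
  exact ⟨_, h⟩

theorem exists_ty_mem (n : ℕ) (x : K (tmS n)) : ∃ y, y ∈ N.fn (.ty n) fun _ => x := by
  obtain ⟨y, h, -⟩ := hN _ ⟨.subst_var .tm n, rfl⟩ (fun _ : Fin 1 => x) trivial
  obtain ⟨ys, h', -⟩ := (N.mem_ev_app _).1 h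
  obtain ⟨zs, h', -⟩ := (N.mem_ev_app _).1 (h' (0 : Fin (n + 2)))
  obtain ⟨us, h', h⟩ := (N.mem_ev_app _).1 (h' (0 : Fin 1))
  rw [show us = fun _ => x from funext fun i => Part.mem_some_iff.1 (h' i)] at h
  exact ⟨_, h⟩

/-- The operations of a model. -/
noncomputable def toSOps : SOps K where
  star := (exists_star_mem hN).choose
  ft n x := (exists_ft_mem hN n x).choose
  ty n x := (exists_ty_mem hN n x).choose
  w n j x := (exists_v_mem hN n j.rev x).choose
  sub p n k B t a := N.fn (.subst p n k) (Arity.consFam (F := K) B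
    (Arity.consFam (F := K) (a := Arity.rep k (tmS n)) t a))

theorem realizes_toSOps : N.Realizes (toSOps hN) where
  star ys := by
    rw [show ys = fun i => Fin.elim0 i from funext fun i => Fin.elim0 i]
    exact Part.eq_some_iff.2 (exists_star_mem hN).choose_spec
  ft n x := Part.eq_some_iff.2 (exists_ft_mem hN n x).choose_spec
  ty n x := Part.eq_some_iff.2 (exists_ty_mem hN n x).choose_spec
  v n i x := Part.eq_some_iff.2 (by
    -- The variable symbols count from the end of the context and `w` counts from the beginning, so
    -- the index is reversed twice.
    have h : ∀ j, j = i → (exists_v_mem hN n j x).choose ∈ N.fn (.v n i) fun _ => x := by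
      rintro _ rfl
      exact (exists_v_mem hN n _ x).choose_spec
    exact h _ (Fin.rev_rev i))
  subst p n k B t a := rfl

/-- A valuation of the variables `B`, `t` and `a₁, …, a_k`. -/
abbrev substVal {n k : ℕ} {s : Srt} (B : K (cx n)) (t : K s) (a : Fin k → K (tmS n)) :
    ∀ x, K ((Ctx.cons (cx n) (Ctx.cons s (Ctx.rep k (tmS n)))).sort x) :=
  Ctx.consFam (F := K) B (Ctx.consFam (F := K) (V := Ctx.rep k (tmS n)) t a)

theorem isModel_of_realizes {X : SOps K} (hR : N.Realizes X) : X.IsModel := by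
  have hdom : ∀ (p : Cls) {n k : ℕ} {B : K (cx n)} {t : K (p.sort k)} {a : Fin k → K (tmS n)},
      (X.sub p n k B t a).Dom ↔ X.Hom n k B (X.ctxOf p k t) a := by
    intro p n k B t a
    have h1 := hN _ ⟨.def_subst p n k, rfl⟩ (substVal B t a)
    have h2 := hN _ ⟨.def_subst_conv p n k, rfl⟩ (substVal B t a)
    have h3 := Iff.intro h1 h2
    have h4 := hR.sat_hom (ρ := substVal B t a) (B := Term.varOf none)
      (a := fun i => Term.varOf (some (some i))) (Part.mem_some B)
      (hR.ctxOf_mem (p := p) (t := Term.varOf (some none)) (Part.mem_some t))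
      (fun i => Part.mem_some (a i))
    refine Part.dom_iff_mem.trans (Iff.trans ?_ (h3.symm.trans h4))
    refine Iff.trans ?_ (N.sat_defd _ _).symm
    exact exists_congr fun y => (hR.mem_ev_subst_iff (Part.mem_some _) (Part.mem_some _)
      fun i => Part.mem_some _).symm
  constructor
  case sub_dom => exact hdom
  case star_unique =>
    intro x
    obtain ⟨y, h, h'⟩ := hN _ ⟨.star_unique, rfl⟩ (fun _ : Fin 1 => x) trivial
    rw [← hR.mem_ev_star.1 h']
    exact (Part.mem_some_iff.1 h).symm
  case ty_w =>
    intro n j A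
    obtain ⟨i, hi⟩ : ∃ i, n = j + 1 + i := ⟨n - (j + 1), by omega⟩
    obtain ⟨j, hj⟩ := j
    simp only at hi
    subst hi
    obtain ⟨y, h, h'⟩ := hN _ ⟨.type_var j i, rfl⟩ (fun _ : Fin 1 => A) trivial
    replace h' := (hR.mem_ev_subst_iff (p := .ty) (Part.mem_some _)
      (hR.ftIter_mem (Part.mem_some _)) fun r => hR.vars_mem _ (Part.mem_some _) r).1 h'
    have h2 := Part.mem_unique h (hR.ty_mem (hR.v_mem (Part.mem_some _)))
    rw [h2] at h'
    rw [show (⟨i, by omega⟩ : Fin (j + 1 + i)).rev = ⟨j, hj⟩ from Fin.ext (by simp; omega)] at h'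
    exact h'
  case sub_ft =>
    intro n k B t a y h
    have h1 := (hdom .ty).1 h.1
    have h4 := (hR.sat_hom (ρ := substVal B t a) (B := Term.varOf none)
      (a := fun i => Term.varOf (some (some i))) (Part.mem_some B)
      (hR.ctxOf_mem (p := .ty) (t := Term.varOf (some none)) (Part.mem_some t))
      (fun i => Part.mem_some (a i))).2 h1
    obtain ⟨z, h2, h3⟩ := hN _ ⟨.type_subst_ty n k, rfl⟩ (substVal B t a) h4
    obtain ⟨y', h5, rfl⟩ := hR.mem_ev_ft.1 h2
    replace h5 := (hR.mem_ev_subst_iff (p := .ty) (Part.mem_some _) (Part.mem_some _)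
      (fun i => Part.mem_some _)).1 h5
    rw [Part.mem_unique h h5]
    exact Part.mem_some_iff.1 h3
  case ty_sub =>
    intro n k B t a y h
    have h1 := (hR.mem_ev_subst_iff (ρ := substVal B t a) (p := .tm) (B := Term.varOf none)
      (t := Term.varOf (some none)) (a := fun i => Term.varOf (some (some i))) (Part.mem_some B)
      (Part.mem_some t) (fun i => Part.mem_some (a i))).2 h
    obtain ⟨z, h2, h3⟩ := hN _ ⟨.type_subst_tm n k, rfl⟩ (substVal B t a)
      ((N.sat_defd _ _).2 ⟨_, hR.ty_mem h1⟩)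
    rw [Part.mem_unique (hR.ty_mem h1) h2]
    exact (hR.mem_ev_subst_iff (p := .ty) (Part.mem_some _) (hR.ty_mem (Part.mem_some _))
      (fun i => Part.mem_some _)).1 h3
  case sub_id =>
    intro p n t
    obtain ⟨y, h, h'⟩ := hN _ ⟨.subst_var p n, rfl⟩ (fun _ : Fin 1 => t) trivial
    have h1 : y = t := Part.mem_some_iff.1 h'
    subst h1
    have h2 := hR.ctxOf_mem (p := p) (N := N) (V := Ctx.rep 1 (p.sort n)) (ρ := fun _ : Fin 1 => y)
      (t := Term.varOf (0 : Fin 1)) (Part.mem_some y)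
    exact (hR.mem_ev_subst_iff h2 (Part.mem_some _) (hR.vars_mem le_rfl h2)).1 h
  case sub_w =>
    intro n k B A a j h
    have h4 := (hR.sat_hom (ρ := substVal B A a) (B := Term.varOf none)
      (A := Term.varOf (some none)) (a := fun i => Term.varOf (some (some i))) (Part.mem_some B)
      (Part.mem_some A) (fun i => Part.mem_some (a i))).2 h
    obtain ⟨y, h, h'⟩ := hN _ ⟨.var_subst n k j.rev, rfl⟩ (substVal B A a) h4
    have h1 : y = a j.rev.rev := Part.mem_some_iff.1 h'
    rw [Fin.rev_rev] at h1
    subst h1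
    have h2 := (hR.mem_ev_subst_iff (p := .tm) (Part.mem_some _) (hR.v_mem (Part.mem_some _))
      (fun i => Part.mem_some _)).1 h
    rwa [Fin.rev_rev] at h2
  case sub_sub =>
    intro p n k m C B t b a y h h'
    let ρ := Ctx.consFam (F := K) C (Ctx.consFam (F := K) B (Ctx.consFam (F := K) t
      (Ctx.appendFam (F := K) (V := Ctx.rep k (tmS n)) (W := Ctx.rep m (tmS k)) b a)))
    have h1 := (hR.sat_hom (ρ := ρ) (B := Term.varOf none)
      (A := Term.varOf (some none)) (a := fun i => Term.varOf (some (some (some (.inl i)))))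
      (Part.mem_some C) (Part.mem_some B) (fun i => Part.mem_some (b i))).2 h
    have h2 := (hR.sat_hom (ρ := ρ) (B := Term.varOf (some none))
      (a := fun i => Term.varOf (some (some (some (.inr i))))) (Part.mem_some B)
      (hR.ctxOf_mem (p := p) (t := Term.varOf (some (some none))) (Part.mem_some t))
      (fun i => Part.mem_some (a i))).2 ((hdom p).1 h'.1)
    obtain ⟨z, h3, h4⟩ := hN _ ⟨.subst_subst p n k m, rfl⟩ ρ ⟨h1, h2⟩
    obtain ⟨C', hC, t', ht, c, hc, hz⟩ := hR.mem_ev_subst.1 h4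
    have e1 := Part.mem_some_iff.1 hC
    have e2 := Part.mem_some_iff.1 ht
    subst e1 e2
    have h5 := (hR.mem_ev_subst_iff (ρ := ρ) (B := Term.varOf (some none))
      (t := Term.varOf (some (some none))) (a := fun i => Term.varOf (some (some (some (.inr i)))))
      (Part.mem_some _) (Part.mem_some _) (fun i => Part.mem_some _)).2 h'
    refine ⟨c, fun i => ?_, z, (hR.mem_ev_subst_iff (Part.mem_some _) h5
      (fun i => Part.mem_some _)).1 h3, hz⟩
    exact (hR.mem_ev_subst_iff (p := .tm) (Part.mem_some _) (Part.mem_some _)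
      (fun i => Part.mem_some _)).1 (hc i)

end

end Str

/-! ## Models of prestable theories under the theory of substitutions -/

/-- The restricted term `σ(x₁, …, x_k)`. -/
abbrev Signature.gen {S : Type} (A : Signature.{u} S) (σ : A.Fn) :
    RTerm A (A.fnArity σ).ctx (A.fnCod σ) :=
  RTerm.ofTerm (.app σ fun i => .var (V := (A.fnArity σ).ctx) i)

namespace Str

variable {A : Signature.{u} Srt} {K : Srt → Type v}

/-- The operations of the theory of contexts in `N` are those of `X`. -/
structure BaseRealizes (N : Str (LSig A) K) (X : SOps K) : Prop where
  ft n x : N.fn (.inl (.ft n)) (fun _ => x) = Part.some (X.ft n x)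
  ctxOf p n x : N.fn (.inl (.ctxOf p n)) (fun _ => x) = Part.some (X.cxOf (p, n) x)

theorem BaseRealizes.ftV {N : Str (LSig A) K} {X : SOps K} (h : N.BaseRealizes X) {n : ℕ}
    (x : K (cx (n + 1))) : N.ftV n x = Part.some (X.ftTo 1 (n + 1) (by omega) x) := by
  induction n with
  | zero => rw [X.ftTo_self]; rfl
  | succ n ih =>
    rw [X.ftTo_succ (n := n + 1) (by omega)]
    refine Eq.trans ?_ (ih _)
    exact (congrArg (·.bind (N.ftV n)) (h.ft (n + 1) x)).trans (Part.bind_some _ _)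

theorem BaseRealizes.isOver_iff {N : Str (LSig A) K} {X : SOps K} (h : N.BaseRealizes X)
    (γ : K (cx 1)) (s : Srt) (x : K (s.up 1)) : N.IsOver γ s x ↔ X.IsOver γ s x := by
  have h1 := h.ctxOf s.1 (s.2 + 1) x
  constructor
  · rintro ⟨c, hc, hγ⟩
    obtain rfl := Part.mem_some_iff.1 ((Part.ext_iff.1 h1 c).1 hc)
    exact (Part.mem_some_iff.1 ((Part.ext_iff.1 (h.ftV _) γ).1 hγ)).symm
  · intro e
    exact ⟨_, (Part.ext_iff.1 h1 _).2 (Part.mem_some _),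
      (Part.ext_iff.1 (h.ftV _) γ).2 (Part.mem_some_iff.2 e.symm)⟩

section

variable {N : Str (LSig A) K} {X : SOps K} {f : SymMap substSig A}
  {E : Str substSig K} (hE : E.Realizes X)
  (hα : E.pull substAlpha = N.pull (LMap f)) (hX : X.IsModel) (hN : N.LRegular)
  {γ : K (cx 1)} {P : ∀ s : Srt, K (s.up 1) → Prop} (hPN : ∀ s x, P s x ↔ N.IsOver γ s x)
  (hP : ∀ s x, P s x ↔ X.IsOver γ s x)

include hα hN hPN in
theorem mem_pull_slice_fn {τ : SubstFn} {ys : ∀ i, SliceCarrier P ((substSig.fnArity τ).sort i)}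
    {z : SliceCarrier P (substSig.fnCod τ)} : z ∈ ((N.slice γ P).pull f).fn τ ys ↔
      z.1 ∈ E.evR (V := ((substSig.fnArity τ).under 1).ctx)
        (Arity.consFam (F := K) (a := (substSig.fnArity τ).up 1) γ fun i => (ys i).1)
        (substAlpha.fn (.inr τ)) := by
  rw [← slice_pull_LMap hN hPN, mem_slice_fn, ← hα]
  rfl

include hE hα hN hPN in
/-- The slice of a structure is the slice of its operations. -/
theorem slice_realizes : ((N.slice γ P).pull f).Realizes (X.slice hX hP) where
  star ys := Part.eq_some_iff.2 <| (mem_pull_slice_fn hα hN hPN).2 <|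
    (E.mem_evR _).2 ⟨Part.mem_some _, trivial⟩
  ft n x := Part.eq_some_iff.2 <| (mem_pull_slice_fn hα hN hPN).2 <| (E.mem_evR _).2 <| by
    have h1 : x.1 ∈ E.ev (V := ((Arity.rep 1 (tyS n)).under 1).ctx)
      (Arity.consFam (F := K) (a := (Arity.rep 1 (tyS n)).up 1) γ fun _ => x.1)
      (argVar (Arity.rep 1 (tyS n)) 1 (0 : Fin 1)) := Part.mem_some _
    refine ⟨hE.ft_mem h1, γ, ?_, Part.mem_some _⟩
    have h2 := hE.ftOne_mem (hE.ft_mem (n := n + 1) h1)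
    rw [← X.ftTo_succ (n := n + 1) (by omega) (by omega),
      show X.ftTo 1 (n + 1 + 1) (by omega) x.1 = γ from (hP (tyS n) _).1 x.2] at h2
    exact h2
  ty n x := Part.eq_some_iff.2 <| (mem_pull_slice_fn hα hN hPN).2 <| (E.mem_evR _).2 <| by
    have h1 : x.1 ∈ E.ev (V := ((Arity.rep 1 (tmS n)).under 1).ctx)
      (Arity.consFam (F := K) (a := (Arity.rep 1 (tmS n)).up 1) γ fun _ => x.1)
      (argVar (Arity.rep 1 (tmS n)) 1 (0 : Fin 1)) := Part.mem_some _
    refine ⟨hE.ty_mem h1, γ, ?_, Part.mem_some _⟩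
    have h2 := hE.ftOne_mem (hE.ctxOf_mem (p := .tm) (n := n + 1) h1)
    rw [show X.ftTo 1 (n + 1) (by omega) (X.ctxOf .tm (n + 1) x.1) = γ from
      (hP (tmS n) _).1 x.2] at h2
    exact h2
  v n i x := Part.eq_some_iff.2 <| (mem_pull_slice_fn hα hN hPN).2 <| (E.mem_evR _).2 <| by
    have h1 : x.1 ∈ E.ev (V := ((Arity.rep 1 (cx n)).under 1).ctx)
      (Arity.consFam (F := K) (a := (Arity.rep 1 (cx n)).up 1) γ fun _ => x.1)
      (argVar (Arity.rep 1 (cx n)) 1 (0 : Fin 1)) := Part.mem_some _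
    refine ⟨?_, γ, ?_, Part.mem_some _⟩
    · have h2 := hE.v_mem (i := i.castSucc) h1
      rw [Fin.rev_castSucc] at h2
      exact h2
    · have h2 := hE.ftOne_mem (n := n) h1
      rw [show X.ftTo 1 (n + 1) (by omega) x.1 = γ from (hP (cx n) _).1 x.2] at h2
      exact h2
  subst p n k B t a := Part.ext fun z => by
    refine (mem_pull_slice_fn hα hN hPN).trans (Iff.trans ?_ (X.mem_slice_sub hX hP).symm)
    refine (E.mem_evR _).trans ?_
    have hB : X.ftTo 1 (n + 1) (by omega) B.1 = γ := (hP (cx n) _).1 B.2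
    cases p with
    | ty =>
      let ar := Arity.cons (cx n) (Arity.cons (tyS k) (Arity.rep k (tmS n)))
      let ρ : ∀ i : Fin (ar.len + 1), K ((ar.under 1).sort i) :=
        Arity.consFam (F := K) (a := ar.up 1) γ fun i => (Arity.consFam (F := SliceCarrier P) B
          (Arity.consFam (F := SliceCarrier P) (a := Arity.rep k (tmS n)) t a) i).1
      have h1 : B.1 ∈ E.ev (V := (ar.under 1).ctx) ρ (argVar ar 1 (0 : Fin (k + 2))) :=
        Part.mem_some _
      have h2 : t.1 ∈ E.ev (V := (ar.under 1).ctx) ρ (argVar ar 1 (0 : Fin (k + 1)).succ) :=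
        Part.mem_some _
      have h3 : ∀ i : Fin k, (a i).1 ∈ E.ev (V := (ar.under 1).ctx) ρ (argVar ar 1 i.succ.succ) :=
        fun i => Part.mem_some _
      have h4 : ∀ i : Fin (k + 1), X.consW B a i ∈ E.ev (V := (ar.under 1).ctx) ρ
          (Fin.cons (α := fun _ => SubT.Tm (ar.under 1).ctx (tmS (n + 1)))
            (SubT.v (n + 1) (Fin.last n) (argVar ar 1 (0 : Fin (k + 2))))
            (fun i => argVar ar 1 i.succ.succ) i) := by
        intro i
        refine Fin.cases ?_ h3 i
        have h5 := hE.v_mem (i := Fin.last n) h1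
        rw [Fin.rev_last] at h5
        exact h5
      refine Iff.trans (and_iff_left ?_) (hE.mem_ev_subst_iff (p := .ty) h1 h2 h4)
      refine ⟨⟨γ, ?_, Part.mem_some _⟩, γ, ?_, Part.mem_some _⟩
      · have h6 := hE.ftOne_mem (n := n) h1
        rw [hB] at h6
        exact h6
      · have h6 := hE.ftOne_mem (hE.ft_mem (n := k + 1) h2)
        rw [← X.ftTo_succ (n := k + 1) (by omega) (by omega),
          show X.ftTo 1 (k + 1 + 1) (by omega) t.1 = γ from (hP (tyS k) _).1 t.2] at h6
        exact h6
    | tm =>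
      let ar := Arity.cons (cx n) (Arity.cons (tmS k) (Arity.rep k (tmS n)))
      let ρ : ∀ i : Fin (ar.len + 1), K ((ar.under 1).sort i) :=
        Arity.consFam (F := K) (a := ar.up 1) γ fun i => (Arity.consFam (F := SliceCarrier P) B
          (Arity.consFam (F := SliceCarrier P) (a := Arity.rep k (tmS n)) t a) i).1
      have h1 : B.1 ∈ E.ev (V := (ar.under 1).ctx) ρ (argVar ar 1 (0 : Fin (k + 2))) :=
        Part.mem_some _
      have h2 : t.1 ∈ E.ev (V := (ar.under 1).ctx) ρ (argVar ar 1 (0 : Fin (k + 1)).succ) :=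
        Part.mem_some _
      have h3 : ∀ i : Fin k, (a i).1 ∈ E.ev (V := (ar.under 1).ctx) ρ (argVar ar 1 i.succ.succ) :=
        fun i => Part.mem_some _
      have h4 : ∀ i : Fin (k + 1), X.consW B a i ∈ E.ev (V := (ar.under 1).ctx) ρ
          (Fin.cons (α := fun _ => SubT.Tm (ar.under 1).ctx (tmS (n + 1)))
            (SubT.v (n + 1) (Fin.last n) (argVar ar 1 (0 : Fin (k + 2))))
            (fun i => argVar ar 1 i.succ.succ) i) := by
        intro i
        refine Fin.cases ?_ h3 i
        have h5 := hE.v_mem (i := Fin.last n) h1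
        rw [Fin.rev_last] at h5
        exact h5
      refine Iff.trans (and_iff_left ?_) (hE.mem_ev_subst_iff (p := .tm) h1 h2 h4)
      refine ⟨⟨γ, ?_, Part.mem_some _⟩, γ, ?_, Part.mem_some _⟩
      · have h6 := hE.ftOne_mem (n := n) h1
        rw [hB] at h6
        exact h6
      · have h6 := hE.ftOne_mem (hE.ctxOf_mem (p := .tm) (n := k + 1) h2)
        rw [show X.ftTo 1 (k + 1) (by omega) (X.ctxOf .tm (k + 1) t.1) = γ from
          (hP (tmS k) _).1 t.2] at h6
        exact h6

end

end Str

/-! ### Models of an algebraic dependent type theory -/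

section

variable {T : PrestableData.{u}} {f : SymMap substSig T.thy.sig}

namespace IsADTT

variable (hT : IsADTT T f) {K : Srt → Type u} {M : Str T.thy.sig K} (hM : M.Models)
include hT hM

theorem pull_models : Str.Models (T := substTheory) (M.pull f) :=
  Theory.models_detects.isInterp_iff.1 hT.hom.interp K M hM

theorem alpha_lRegular : (M.pull T.alpha).LRegular :=
  Str.lRegular_of_models (Theory.models_detects.isInterp_iff.1 hT.prestable.alpha_interp K M hM)

theorem pull_base : M.pull T.base = (M.pull f).pull substBase := by
  rw [← Str.pull_comp]
  exact (Theory.models_detects.symEquiv_iff.1 hT.hom.base K M hM).symm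

theorem alpha_inl (b : BaseFn) :
    (M.pull T.alpha).fn (.inl b) = ((M.pull f).pull substBase).fn b := by
  rw [← hT.pull_base hM]
  funext ys
  exact Theory.models_detects.rEquiv_iff.1 (hT.prestable.alpha_base b) K M hM ys

theorem pull_substAlpha : (M.pull f).pull substAlpha = (M.pull T.alpha).pull (LMap f) := by
  rw [← Str.pull_comp, ← Str.pull_comp]
  exact Theory.models_detects.symEquiv_iff.1 hT.hom.alpha K M hM

theorem baseRealizes {X : SOps K} (hR : (M.pull f).Realizes X) :
    (M.pull T.alpha).BaseRealizes X where
  ft n x := by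
    rw [hT.alpha_inl hM]
    refine Part.eq_some_iff.2 (((M.pull f).mem_evR _).2 ⟨?_, trivial⟩)
    exact hR.ft_mem (Part.mem_some _)
  ctxOf p n x := by
    rw [hT.alpha_inl hM]
    refine Part.eq_some_iff.2 ?_
    cases p with
    | ctx => exact ((M.pull f).mem_evR _).2 ⟨Part.mem_some _, trivial⟩
    | tm => exact ((M.pull f).mem_evR _).2 ⟨hR.ctxOf_mem (p := .tm) (Part.mem_some _), trivial⟩

section

variable {X : SOps K} (hR : (M.pull f).Realizes X) {γ : K (cx 1)}
  {P : ∀ s : Srt, K (s.up 1) → Prop} (hP : ∀ s x, P s x ↔ X.IsOver γ s x)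
include hR hP

theorem isOver_iff (s x) : P s x ↔ (M.pull T.alpha).IsOver γ s x :=
  (hP s x).trans ((hT.baseRealizes hM hR).isOver_iff γ s x).symm

omit hP in
theorem headCtx_mem {a : Arity Srt} {m : ℕ} {Δ : K (cx (m + 1))}
    (hΔ : X.ftTo 1 (m + 1) (by omega) Δ = γ) {xs : ∀ i, K ((a.sort i).up (m + 1))} :
    γ ∈ (M.pull T.alpha).ev (V := (a.under (m + 1)).ctx)
      (Arity.consFam (F := K) (a := a.up (m + 1)) Δ xs)
      (PrestableData.headCtx T.thy.sig a m) := by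
  refine ((M.pull T.alpha).mem_ev_lftIter).2 ⟨Δ, Part.mem_some _, ?_⟩
  rw [(hT.baseRealizes hM hR).ftV, hΔ]
  exact Part.mem_some _

/-- `Δ × r` at length `m + 1` is obtained by applying `αL(ft^m(Δ), -)` to the expression at length
`m`, and `L` evaluates in slices. Statements at length `m + 1` in a model thus reduce to statements
at length `m` in the slice over `ft^m(Δ)`. -/
theorem mem_times_succ {a : Arity Srt} {s : Srt} (r : RTerm T.thy.sig a.ctx s) {m : ℕ}
    {Δ : SliceCarrier P (cx m)} {xs : ∀ i, SliceCarrier P ((a.sort i).up m)}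
    {y : K (s.up (m + 1))} :
    y ∈ M.evR (V := (a.under (m + 1)).ctx)
        (Arity.consFam (F := K) (a := a.up (m + 1)) Δ.1 fun i => (xs i).1) (T.times r (m + 1)) ↔
      ∃ h : P (s.up m) y, (⟨y, h⟩ : SliceCarrier P (s.up m)) ∈
        ((M.pull T.alpha).slice γ P).evR (V := (a.under m).ctx)
          (Arity.consFam (F := SliceCarrier P) (a := a.up m) Δ xs) (T.times r m) := by
  rw [PrestableData.times, Str.evR_rterm]
  refine Str.mem_evR_liftRTerm (hT.alpha_lRegular hM) (hT.isOver_iff hM hR hP)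
    (V := (a.under m).ctx) (hT.headCtx_mem hM hR ((hP _ _).1 Δ.2))
    (ρ' := Arity.consFam (F := SliceCarrier P) (a := a.up m) Δ xs) fun x => ?_
  exact Fin.cases (Part.mem_some _) (fun i => Part.mem_some _) x

theorem sat_timesFormula_succ {a : Arity Srt} (φ : Formula T.thy.sig a.ctx) {m : ℕ}
    {Δ : SliceCarrier P (cx m)} {xs : ∀ i, SliceCarrier P ((a.sort i).up m)} :
    M.sat (V := (a.under (m + 1)).ctx)
        (Arity.consFam (F := K) (a := a.up (m + 1)) Δ.1 fun i => (xs i).1)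
        (T.timesFormula φ (m + 1)) ↔
      ((M.pull T.alpha).slice γ P).sat (V := (a.under m).ctx)
          (Arity.consFam (F := SliceCarrier P) (a := a.up m) Δ xs) (T.timesFormula φ m) := by
  rw [PrestableData.timesFormula, Str.sat_formula]
  refine Str.sat_liftFormula (hT.alpha_lRegular hM) (hT.isOver_iff hM hR hP)
    (V := (a.under m).ctx) (hT.headCtx_mem hM hR ((hP _ _).1 Δ.2))
    (ρ' := Arity.consFam (F := SliceCarrier P) (a := a.up m) Δ xs) (fun x => ?_) _
  exact Fin.cases (Part.mem_some _) (fun i => Part.mem_some _) x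

end

end IsADTT

theorem evR_times_zero {A : PrestableData.{u}} {K : Srt → Type v} (D : Str A.thy.sig K)
    {a : Arity Srt} {s : Srt} (r : RTerm A.thy.sig a.ctx s) (Δ : K (cx 0))
    (xs : ∀ i, K (a.sort i)) :
    D.evR (V := (a.under 0).ctx) (Arity.consFam (F := K) (a := a.up 0) Δ xs) (A.times r 0) =
      D.evR (V := a.ctx) xs r := by
  refine Part.ext fun y => ?_
  have h : ∀ i : a.ctx.Var, xs i ∈ D.ev (V := (a.under 0).ctx)
    (Arity.consFam (F := K) (a := a.up 0) Δ xs) (argVar a 0 i) := fun i => Part.mem_some _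
  rw [Str.mem_evR, Str.mem_evR]
  refine and_congr ?_ (Str.sat_subst (V := a.ctx) h _)
  exact Part.ext_iff.1 (Str.ev_subst (V := a.ctx) h _) y

theorem sat_timesFormula_zero {A : PrestableData.{u}} {K : Srt → Type v} (D : Str A.thy.sig K)
    {a : Arity Srt} (φ : Formula A.thy.sig a.ctx) (Δ : K (cx 0)) (xs : ∀ i, K (a.sort i)) :
    D.sat (V := (a.under 0).ctx) (Arity.consFam (F := K) (a := a.up 0) Δ xs)
        (A.timesFormula φ 0) ↔ D.sat (V := a.ctx) xs φ := by
  have h : ∀ i : a.ctx.Var, xs i ∈ D.ev (V := (a.under 0).ctx)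
    (Arity.consFam (F := K) (a := a.up 0) Δ xs) (argVar a 0 i) := fun i => Part.mem_some _
  exact Str.sat_subst (V := a.ctx) h _

/-- Substitution commutes with `σ` in models. -/
theorem IsADTT.exists_subst_mem (hT : IsADTT T f) {K : Srt → Type u} {M : Str T.thy.sig K}
    (hM : M.Models) {X : SOps K} (hR : (M.pull f).Realizes X) (σ : T.thy.sig.Fn) {l m : ℕ}
    {Γ : K (cx l)} {Δ : K (cx m)} {a : Fin m → K (tmS l)} (ha : X.Hom l m Γ Δ a)
    {b : ∀ i, K (((T.thy.sig.fnArity σ).sort i).up m)} {y : K ((T.thy.sig.fnCod σ).up m)}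
    (hy : y ∈ M.evR (V := ((T.thy.sig.fnArity σ).under m).ctx) (Arity.consFam (F := K) Δ b)
      (T.times (T.thy.sig.gen σ) m)) :
    ∃ (b' : ∀ i, K (((T.thy.sig.fnArity σ).sort i).up l)) (y' : K ((T.thy.sig.fnCod σ).up l)),
      (∀ i, X.SubUp Γ a _ (b i) (b' i)) ∧ X.SubUp Γ a _ y y' ∧
      y' ∈ M.evR (V := ((T.thy.sig.fnArity σ).under l).ctx) (Arity.consFam (F := K) Γ b')
        (T.times (T.thy.sig.gen σ) l) := by
  let ar := T.thy.sig.fnArity σ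
  let ρ : ∀ x, K ((commCtx ar l m).sort x) := Ctx.consFam (F := K) Γ (Ctx.consFam (F := K) Δ
    (Ctx.appendFam (F := K) (V := Ctx.rep m (tmS l)) (W := (ar.up m).ctx) a b))
  have hargs : ∀ i, (Arity.consFam (F := K) (a := ar.up m) Δ b) i ∈
      M.evR ρ (Comm.args ar l m i) := by
    intro i
    refine Fin.cases ?_ (fun i => ?_) i
    · exact (M.mem_evR _).2 ⟨Part.mem_some _, trivial⟩
    · exact (M.mem_evR _).2 ⟨Part.mem_some _, trivial⟩
  have hyp1 : M.sat ρ ((T.times (T.thy.sig.gen σ) m).subst (Comm.args ar l m)).defd :=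
    (M.sat_rdefd _ _).2 ⟨y, (M.mem_evR_subst _).2 ⟨_, hargs, hy⟩⟩
  have hyp2 : M.sat ρ (f.formula (SubT.hom l m (Comm.Γ ar l m) (Comm.Δ ar l m)
      (Comm.a ar l m))) := by
    rw [Str.sat_formula]
    exact (hR.sat_hom (Part.mem_some _) (Part.mem_some _) fun i => Part.mem_some _).2 ha
  -- The common value `z` of the two sides of the commutation axiom: `h1` presents it as a
  -- substitution into `Δ × σ(b)`, and `h2` as the value of `Γ × σ` at the substituted arguments.
  obtain ⟨z, h1, h2⟩ := (M.sat_req _ _ _).1 ((hT.comm_fn σ l m).sound hM ρ ⟨hyp1, hyp2⟩)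
  obtain ⟨ys, h3, h4⟩ := (M.mem_evR_subst _).1 h2
  obtain ⟨Γ', b', rfl⟩ : ∃ Γ' b', ys = Arity.consFam (F := K) (a := ar.up l) Γ' b' :=
    ⟨_, _, Arity.consFam_eta ys⟩
  have e : Γ' = Γ := Part.mem_some_iff.1 ((M.mem_evR _).1 (h3 (0 : Fin (ar.len + 1)))).1
  subst e
  have h5 : ∀ i, X.SubUp Γ' a _ (b i) (b' i) := fun i => by
    have h6 : b' i ∈ M.evR ρ (f.term (SubT.substUp l m (Comm.Γ ar l m) (ar.sort i)
      (Comm.b ar l m i) (Comm.a ar l m))) := h3 i.succ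
    rw [Str.evR_term] at h6
    exact (hR.mem_ev_substUp (Part.mem_some _) (fun i => Part.mem_some _)
      (Part.mem_some _)).1 h6
  refine ⟨b', z, h5, ?_, h4⟩
  let s := T.thy.sig.fnCod σ
  obtain ⟨ys, h6, h7⟩ := (M.mem_evR_subst (a := Arity.cons (cx l) (Arity.cons (s.up m)
    (Arity.rep m (tmS l)))) _).1 h1
  have e1 : ys (0 : Fin (m + 2)) = Γ' :=
    Part.mem_some_iff.1 ((M.mem_evR _).1 (h6 (0 : Fin (m + 2)))).1
  have e2 : ys (Fin.succ (0 : Fin (m + 1))) = y :=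
    Part.mem_unique (h6 (Fin.succ (0 : Fin (m + 1)))) ((M.mem_evR_subst _).2 ⟨_, hargs, hy⟩)
  have e3 : (fun i : Fin m => ys i.succ.succ) = a :=
    funext fun i => Part.mem_some_iff.1 ((M.mem_evR _).1 (h6 i.succ.succ)).1
  rw [Str.evR_term] at h7
  have h8 := (hR.mem_ev_substUp (V := (Arity.cons (cx l) (Arity.cons (s.up m)
    (Arity.rep m (tmS l)))).ctx) (ρ := ys) (Part.mem_some _) (fun i => Part.mem_some _)
      (Part.mem_some _)).1 h7
  have h9 : X.SubUp (ys (0 : Fin (m + 2))) (fun i : Fin m => ys i.succ.succ) s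
    (ys (Fin.succ (0 : Fin (m + 1)))) z := h8
  rwa [e1, e2, e3] at h9

/-! ### Structures with weakening -/

/-- The structure `D` has the substitution operations of `X`, and its operations commute with
weakening. -/
structure Good (T : PrestableData.{u}) (f : SymMap substSig T.thy.sig) {K : Srt → Type u}
    (D : Str T.thy.sig K) (X : SOps K) : Prop where
  realizes : (D.pull f).Realizes X
  isModel : X.IsModel
  weaken (σ : T.thy.sig.Fn) (xs : ∀ i, K ((T.thy.sig.fnArity σ).sort i))
    (y : K (T.thy.sig.fnCod σ)) : y ∈ D.fn σ xs → ∀ (j : ℕ) (τ : K (cx j)),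
    ∃ (xs' : ∀ i, K (((T.thy.sig.fnArity σ).sort i).up j)) (y' : K ((T.thy.sig.fnCod σ).up j)),
      (∀ i, X.SubUp (k := 0) τ Fin.elim0 _ (xs i) (xs' i)) ∧
      X.SubUp (k := 0) τ Fin.elim0 _ y y' ∧
      y' ∈ D.evR (V := ((T.thy.sig.fnArity σ).under j).ctx) (Arity.consFam (F := K) τ xs')
        (T.times (T.thy.sig.gen σ) j)

namespace IsADTT

variable (hT : IsADTT T f) {K : Srt → Type u} {M : Str T.thy.sig K} (hM : M.Models)
include hT hM

/-- The operations of a model. -/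
theorem exists_good : ∃ X : SOps K, Good T f M X := by
  have h := hT.pull_models hM
  refine ⟨Str.toSOps h, Str.realizes_toSOps h, Str.isModel_of_realizes h (Str.realizes_toSOps h),
    fun σ xs y hy j τ => ?_⟩
  -- Weakening is substitution along the morphism to the empty context, for which `Hom` is the empty
  -- conjunction.
  refine hT.exists_subst_mem hM (Str.realizes_toSOps h) σ (m := 0) (Δ := (Str.toSOps h).star)
    trivial ?_
  rw [evR_times_zero]
  exact (Part.ext_iff.1 ((M.evR_ofTerm _ _).trans (M.ev_app_vars σ xs)) y).2 hy

/-- The slice need not be a model of `T`, so its weakening property cannot be taken from the axioms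
directly. It comes from the commutation axiom of `T` in `M`, applied to a morphism from a context
over `γ` to `γ` itself. -/
theorem slice_good {X : SOps K} (hG : Good T f M X) {γ : K (cx 1)}
    {P : ∀ s : Srt, K (s.up 1) → Prop} (hP : ∀ s x, P s x ↔ X.IsOver γ s x) :
    Good T f ((M.pull T.alpha).slice γ P) (X.slice hG.isModel hP) where
  realizes := Str.slice_realizes hG.realizes (hT.pull_substAlpha hM) hG.isModel
    (hT.alpha_lRegular hM) (hT.isOver_iff hM hG.realizes hP) hP
  isModel := X.slice_isModel hG.isModel hP
  weaken σ xs y hy j τ := by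
    have h1 : y.1 ∈ M.evR (V := ((T.thy.sig.fnArity σ).under 1).ctx)
        (Arity.consFam (F := K) γ fun i => (xs i).1) (T.times (T.thy.sig.gen σ) 1) := by
      have hγ : P (cx 0) γ := (hP _ _).2 (X.ftTo_self _ _)
      refine (hT.mem_times_succ hM hG.realizes hP _ (m := 0) (Δ := ⟨γ, hγ⟩) (xs := xs)).2
        ⟨y.2, ?_⟩
      rw [evR_times_zero]
      exact (Part.ext_iff.1 ((Str.evR_ofTerm _ _ _).trans (Str.ev_app_vars _ σ xs)) y).2 hy
    have hτ : X.ftTo 1 (j + 1) (by omega) τ.1 = γ := (hP (cx j) _).1 τ.2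
    -- The first variable of `τ` is a morphism from `τ` to its truncation `γ` of length one.
    have h2 : X.Hom (j + 1) 1 τ.1 γ fun _ => X.w (j + 1) 0 τ.1 := by
      have := hG.isModel.hom_wv (n := j + 1) (m := 1) (by omega) τ.1
      rw [hτ] at this
      convert this using 1
      funext i
      rw [Subsingleton.elim i 0]
      rfl
    obtain ⟨xs', y', h3, h4, h5⟩ := hT.exists_subst_mem hM hG.realizes σ (l := j + 1) (m := 1) h2 h1
    choose xs'' e h6 using fun i => SOps.SubUp.slice hG.isModel hP (x := xs i) (h3 i)
    obtain ⟨y'', rfl, h7⟩ := SOps.SubUp.slice hG.isModel hP (x := y) h4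
    obtain rfl : xs' = fun i => (xs'' i).1 := funext fun i => (e i).symm
    obtain ⟨_, h5⟩ := (hT.mem_times_succ hM hG.realizes hP _ (m := j) (Δ := τ) (xs := xs'')).1 h5
    exact ⟨xs'', y'', h6, h7, h5⟩

end IsADTT

end

/-! ## Arities with additional arguments -/

theorem castS_natural {S : Type} {F : S → Type v} {G : S → Type w} (φ : ∀ s, F s → G s) {s s' : S}
    (h : s = s') (x : F s) : φ s' (castS h x) = castS h (φ s x) := by
  subst h
  rfl

theorem castS_rel {S : Type} {F : S → Type v} {G : S → Type w} {Q : ∀ s, F s → G s → Prop}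
    {s s' : S} (h : s = s') {x : F s} {y : G s} : Q s' (castS h x) (castS h y) ↔ Q s x y := by
  subst h
  rfl

theorem castS_pred {S : Type} {F : S → Type v} {Q : ∀ s, F s → Prop}
    {s s' : S} (h : s = s') {x : F s} : Q s' (castS h x) ↔ Q s x := by
  subst h
  rfl

namespace Arity

variable {S : Type} (a : Arity S) (j : ℕ) (s : S)

/-- The arity `a` followed by `j` copies of `s`. -/
def app : Arity S := ⟨a.len + j, Fin.addCases (motive := fun _ => S) a.sort fun _ => s⟩

variable {a j s} {F : S → Type v} {G : S → Type w}

theorem app_left (i : Fin a.len) : (a.app j s).sort (Fin.castAdd j i) = a.sort i :=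
  Fin.addCases_left (motive := fun _ => S) (left := a.sort) (right := fun _ => s) i

theorem app_right (r : Fin j) : (a.app j s).sort (Fin.natAdd a.len r) = s :=
  Fin.addCases_right (motive := fun _ => S) (left := a.sort) (right := fun _ => s) r

def appL (zs : ∀ i, F ((a.app j s).sort i)) (i : Fin a.len) : F (a.sort i) :=
  castS (app_left i) (zs (Fin.castAdd j i))

def appR (zs : ∀ i, F ((a.app j s).sort i)) (r : Fin j) : F s :=
  castS (app_right r) (zs (Fin.natAdd a.len r))

def appFam (xs : ∀ i, F (a.sort i)) (as : Fin j → F s) : ∀ i, F ((a.app j s).sort i) :=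
  Fin.addCases (motive := fun i => F ((a.app j s).sort i))
    (fun i => castS (app_left i).symm (xs i)) fun r => castS (app_right r).symm (as r)

theorem appL_appFam (xs : ∀ i, F (a.sort i)) (as : Fin j → F s) :
    appL (appFam xs as) = xs := by
  funext i
  simp only [appL, appFam, Fin.addCases_left, castS_castS]
  rfl

theorem appR_appFam (xs : ∀ i, F (a.sort i)) (as : Fin j → F s) :
    appR (appFam xs as) = as := by
  funext i
  simp only [appR, appFam, Fin.addCases_right, castS_castS]
  rfl

theorem appFam_pred {Q : ∀ s, F s → Prop} {xs : ∀ i, F (a.sort i)} {as : Fin j → F s}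
    (h : ∀ i, Q _ (xs i)) (h' : ∀ r, Q _ (as r)) (i) : Q _ (appFam xs as i) := by
  refine Fin.addCases (fun i => ?_) (fun i => ?_) i
  · simp only [appFam, Fin.addCases_left]
    exact (castS_pred _).2 (h i)
  · simp only [appFam, Fin.addCases_right]
    exact (castS_pred _).2 (h' i)

theorem appFam_rel {Q : ∀ s, F s → G s → Prop} {xs : ∀ i, F (a.sort i)} {as : Fin j → F s}
    {ys : ∀ i, G (a.sort i)} {bs : Fin j → G s} (h : ∀ i, Q _ (xs i) (ys i))
    (h' : ∀ r, Q _ (as r) (bs r)) (i) : Q _ (appFam xs as i) (appFam ys bs i) := by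
  refine Fin.addCases (fun i => ?_) (fun i => ?_) i
  · simp only [appFam, Fin.addCases_left]
    exact (castS_rel _).2 (h i)
  · simp only [appFam, Fin.addCases_right]
    exact (castS_rel _).2 (h' i)

theorem appL_natural (φ : ∀ s, F s → G s) (zs : ∀ i, F ((a.app j s).sort i)) (i) :
    φ _ (appL zs i) = appL (fun i => φ _ (zs i)) i := castS_natural φ _ _

theorem appR_natural (φ : ∀ s, F s → G s) (zs : ∀ i, F ((a.app j s).sort i)) (r) :
    φ _ (appR zs r) = appR (fun i => φ _ (zs i)) r := castS_natural φ _ _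

theorem appL_rel {Q : ∀ s, F s → G s → Prop} {zs : ∀ i, F ((a.app j s).sort i)}
    {us : ∀ i, G ((a.app j s).sort i)} (h : ∀ i, Q _ (zs i) (us i)) (i) :
    Q _ (appL zs i) (appL us i) := (castS_rel _).2 (h _)

theorem appR_rel {Q : ∀ s, F s → G s → Prop} {zs : ∀ i, F ((a.app j s).sort i)}
    {us : ∀ i, G ((a.app j s).sort i)} (h : ∀ i, Q _ (zs i) (us i)) (r) :
    Q _ (appR zs r) (appR us r) := (castS_rel _).2 (h _)

end Arity

/-! ## Terms for pieces and for being over a context -/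

namespace SubT

variable {V : Ctx Srt}

def cxOf : (s : Srt) → Tm V s → Tm V (cx s.2)
  | (.ctx, _), t => t
  | (.tm, n), t => ft n (ty n t)

def ftTo (m : ℕ) : (n : ℕ) → m ≤ n → Tm V (cx n) → Tm V (cx m)
  | 0, h, t => t.cast (congrArg cx (Nat.le_zero.1 h).symm)
  | n + 1, h, t => if h' : m ≤ n then ftTo m n h' (ft n t)
    else t.cast (congrArg cx (show n + 1 = m by omega))

/-- The terms of the operation `SOps.args`. -/
def args (m j : ℕ) {nn : ℕ} (h : nn = m + j) (Δ : Tm V (cx m)) (a : Fin j → Tm V (tmS m))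
    (r : Fin nn) : Tm V (tmS m) :=
  if hr : r < m then v m (Fin.rev ⟨r, hr⟩) Δ else a ⟨r - m, by omega⟩

/-- The term of the operation `SOps.piece`. -/
def piece {s : Srt} : (p : Cls) → {j : ℕ} → Piece s p j → (m : ℕ) → {nn : ℕ} → nn = m + j →
    Tm V (s.up m) → Tm V (p.sort nn)
  | .ty, _, hp, m, nn, h, u => ftTo (nn + 1) (s.2 + m) (by have : _ < s.2 := hp; omega)
      (cxOf (s.up m) u)
  | .tm, j, hp, m, nn, h, u => Term.cast (show s.up m = tmS nn by
      rw [show s = tmS j from hp, h, Nat.add_comm m j]) u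

end SubT

namespace Str.Realizes

variable {K : Srt → Type v} {N : Str substSig K} {X : SOps K} (hR : N.Realizes X) {V : Ctx Srt}
  {ρ : ∀ x, K (V.sort x)}
include hR

theorem cxOf_mem {s : Srt} {t : SubT.Tm V s} {x : K s} (h : x ∈ N.ev ρ t) :
    X.cxOf s x ∈ N.ev ρ (SubT.cxOf s t) := by
  obtain ⟨⟨⟩, n⟩ := s
  · exact h
  · exact hR.ft_mem (hR.ty_mem h)

omit hR in
theorem cast_mem {s s' : Srt} (e : s = s') {t : SubT.Tm V s} {x : K s} (h : x ∈ N.ev ρ t) :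
    castS e x ∈ N.ev ρ (t.cast e) := by
  subst e
  exact h

theorem ftTo_mem {m n : ℕ} (hm : m ≤ n) {t : SubT.Tm V (cx n)} {x : K (cx n)}
    (h : x ∈ N.ev ρ t) : X.ftTo m n hm x ∈ N.ev ρ (SubT.ftTo m n hm t) := by
  induction n, hm using Nat.le_induction with
  | base =>
    rw [X.ftTo_self]
    cases m with
    | zero => exact cast_mem rfl h
    | succ m =>
      rw [SubT.ftTo, dif_neg (by omega)]
      exact cast_mem rfl h
  | succ n hm ih =>
    rw [X.ftTo_succ hm, SubT.ftTo, dif_pos hm]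
    exact ih (hR.ft_mem h)

theorem args_mem {m j nn : ℕ} (hn : nn = m + j) {Δ : SubT.Tm V (cx m)}
    {a : Fin j → SubT.Tm V (tmS m)} {d : K (cx m)} {c : Fin j → K (tmS m)} (hΔ : d ∈ N.ev ρ Δ)
    (ha : ∀ r, c r ∈ N.ev ρ (a r)) (r : Fin nn) :
    X.args m j hn d c r ∈ N.ev ρ (SubT.args m j hn Δ a r) := by
  rw [SOps.args, SubT.args]
  split
  · have := hR.v_mem (i := Fin.rev ⟨r, by assumption⟩) hΔ
    rwa [Fin.rev_rev] at this
  · exact ha _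

theorem piece_mem {s : Srt} {p : Cls} {j : ℕ} (hp : Piece s p j) {m nn : ℕ} (hn : nn = m + j)
    {t : SubT.Tm V (s.up m)} {x : K (s.up m)} (h : x ∈ N.ev ρ t) :
    X.piece p hp m hn x ∈ N.ev ρ (SubT.piece p hp m hn t) := by
  cases p with
  | ty => exact hR.ftTo_mem _ (hR.cxOf_mem h)
  | tm => exact cast_mem _ h

end Str.Realizes

namespace SOps

variable {K : Srt → Type v} (X : SOps K)

/-- `x` is over `Δ`. -/
def OverAt (m : ℕ) (Δ : K (cx m)) (s : Srt) (x : K s) : Prop :=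
  ∃ h : m ≤ s.2, X.ftTo m s.2 h (X.cxOf s x) = Δ

end SOps

/-- The formula saying that all `x_i` are over `Δ`. -/
def overFormula (a : Arity Srt) (m : ℕ) : Formula substSig (a.under m).ctx :=
  Formula.all fun i => .eq (SubT.ftTo m ((a.sort i).2 + m) (Nat.le_add_left _ _)
    (SubT.cxOf ((a.sort i).up m) (argVar a m i))) (ctxVar a m)

theorem Str.Realizes.sat_overFormula {K : Srt → Type v} {N : Str substSig K} {X : SOps K}
    (hR : N.Realizes X) {a : Arity Srt} {m : ℕ} {Δ : K (cx m)}
    {xs : ∀ i, K ((a.sort i).up m)} :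
    N.sat (V := (a.under m).ctx) (Arity.consFam (F := K) (a := a.up m) Δ xs) (overFormula a m) ↔
      ∀ i, X.OverAt m Δ ((a.sort i).up m) (xs i) := by
  rw [overFormula, sat_all]
  refine forall_congr' fun i => ?_
  have h1 := hR.ftTo_mem (V := (a.under m).ctx)
    (ρ := Arity.consFam (F := K) (a := a.up m) Δ xs) (Nat.le_add_left m (a.sort i).2)
    (hR.cxOf_mem (s := (a.sort i).up m) (t := argVar a m i) (Part.mem_some (xs i)))
  rw [sat_eq]
  constructor
  · rintro ⟨y, h, h'⟩
    refine ⟨Nat.le_add_left _ _, (Part.mem_unique h1 h).trans ?_⟩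
    exact Part.mem_some_iff.1 h'
  · rintro ⟨_, h⟩
    exact ⟨_, h1, Part.mem_some_iff.2 h⟩

/-! ## The contextual theory of an algebraic dependent type theory -/

/-- For every function symbol `σ` and every part of a value of `σ`, the basic function symbol for
this part at given terms; the predicate symbols, and the domains of the function symbols. -/
abbrev partSig (A : Signature.{u} Srt) : Signature.{u} Srt where
  Fn := {q : A.Fn × Cls × ℕ // Piece (A.fnCod q.1) q.2.1 q.2.2}
  fnArity q := (A.fnArity q.1.1).app q.1.2.2 (tmS 0)
  fnCod q := q.1.2.1.sort 0
  Pr := A.Pr ⊕ A.Fn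
  prArity := Sum.elim A.prArity A.fnArity

/-- The signature of the contextual theory with the basic symbols `partSig A`. -/
abbrev contextualSig (A : Signature.{u} Srt) : Signature.{u} Srt :=
  substSig.sum (indexedSig (partSig A))

theorem Cls.sort_up (p : Cls) (m : ℕ) : p.sort m = (p.sort 0).up m := by
  cases p
  · exact congrArg cx (by simp; omega)
  · exact congrArg tmS (by simp)

theorem tmS_up (m : ℕ) : (tmS 0).up m = tmS m := congrArg tmS (Nat.zero_add m)

/-- The variables of `subst_{p,m,m+j}(Δ, u, v_{m-1}(Δ), …, v_0(Δ), a₁, …, a_j)`. -/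
abbrev partArity (s : Srt) (m j : ℕ) : Arity Srt :=
  Arity.cons (cx m) (Arity.cons (s.up m) (Arity.rep j ((tmS 0).up m)))

/-- The term `subst_{p,m,m+j}(Δ, u', v_{m-1}(Δ), …, v_0(Δ), a₁, …, a_j)`, where `u'` is a part
of `u`. -/
def partTerm {s : Srt} {p : Cls} {j : ℕ} (hp : Piece s p j) (m : ℕ) :
    SubT.Tm (partArity s m j).ctx ((p.sort 0).up m) :=
  let V := partArity s m j
  let Δ : SubT.Tm V.ctx (cx m) := Term.varOf (V := V.ctx) (0 : Fin (j + 2))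
  let u : SubT.Tm V.ctx (s.up m) := Term.varOf (V := V.ctx) (0 : Fin (j + 1)).succ
  let a : Fin j → SubT.Tm V.ctx ((tmS 0).up m) := fun r => Term.varOf (V := V.ctx) r.succ.succ
  (SubT.subst p m (m + j) Δ (SubT.piece p hp m rfl u)
    (SubT.args m j rfl Δ fun r => (a r).cast (tmS_up m))).cast (p.sort_up m)

section

variable (T : PrestableData.{u}) (f : SymMap substSig T.thy.sig)

/-- The arguments of `times σ m` inside the arity of a basic symbol. -/
def partArgs (σ : T.thy.sig.Fn) (j m : ℕ) :
    ∀ i, RTerm T.thy.sig (((T.thy.sig.fnArity σ).app j (tmS 0)).under m).ctx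
      (((T.thy.sig.fnArity σ).under m).sort i) :=
  let b := (T.thy.sig.fnArity σ).app j (tmS 0)
  Arity.consFam (F := RTerm T.thy.sig (b.under m).ctx) (a := (T.thy.sig.fnArity σ).up m)
    (RTerm.ofTerm (ctxVar b m))
    (Arity.appL (F := fun s => RTerm T.thy.sig (b.under m).ctx (s.up m))
      fun i => RTerm.ofTerm (argVar b m i))

/-- The interpretation of the contextual theory in `T`. -/
def partMap : SymMap (contextualSig T.thy.sig) T.thy.sig where
  fn
    | .inl τ => f.fn τ
    | .inr (q, m) =>
      let σ := q.1.1
      let j := q.1.2.2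
      let b := (T.thy.sig.fnArity σ).app j (tmS 0)
      ((f.term (partTerm q.2 m)).subst (a := partArity (T.thy.sig.fnCod σ) m j)
        (Arity.consFam (F := RTerm T.thy.sig (b.under m).ctx) (RTerm.ofTerm (ctxVar b m))
          (Arity.consFam (F := RTerm T.thy.sig (b.under m).ctx)
            (a := Arity.rep j ((tmS 0).up m))
            ((T.times (T.thy.sig.gen σ) m).subst (partArgs T σ j m))
            (Arity.appR (F := fun s => RTerm T.thy.sig (b.under m).ctx (s.up m))
              fun i => RTerm.ofTerm (argVar b m i))))).restrict
        -- The axioms of `L` force all arguments of `L(σ_m)` to be over `Γ`, whereas `α` of a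
        -- contextual theory only imposes `ft^m(Δ) = Γ`. The interpretation of the symbol must
        -- therefore itself require its arguments to be over `Δ`.
        (f.formula (overFormula b m))
  pr
    | .inl e => f.pr e
    | .inr (.inl R, m) => .and
        (T.timesFormula (.rel R fun i => .var (V := (T.thy.sig.prArity R).ctx) i) m)
        (f.formula (overFormula (T.thy.sig.prArity R) m))
    -- The domain of `σ` must be recorded separately: the weakened values of `σ` may exist where `σ`
    -- is undefined, and if the codomain is `(ctx, 0)`, there is no piece at all.
    | .inr (.inr σ, m) => .and (T.times (T.thy.sig.gen σ) m).defd
        (f.formula (overFormula (T.thy.sig.fnArity σ) m))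

variable {T f} {K : Srt → Type u} {D : Str T.thy.sig K} {X : SOps K} (hR : (D.pull f).Realizes X)
include hR

theorem mem_partTerm {s : Srt} {p : Cls} {j m nn : ℕ} (hp : Piece s p j) (hn : nn = m + j)
    {Δ : K (cx m)} {u : K (s.up m)} {a : Fin j → K ((tmS 0).up m)} {y : K ((p.sort 0).up m)} :
    y ∈ (D.pull f).ev (V := (partArity s m j).ctx) (Arity.consFam (F := K) Δ
      (Arity.consFam (F := K) (a := Arity.rep j ((tmS 0).up m)) u a)) (partTerm hp m) ↔
    ∃ z ∈ X.sub p m nn Δ (X.piece p hp m hn u) (X.args m j hn Δ fun r => castS (tmS_up m) (a r)),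
      castS (p.sort_up m) z = y := by
  subst hn
  refine (Str.mem_ev_cast _).trans ?_
  refine (hR.mem_ev_subst_iff (b := Δ) (Part.mem_some _) (hR.piece_mem hp rfl (x := u)
    (Part.mem_some _)) (hR.args_mem rfl (Part.mem_some _) (c := fun r => castS (tmS_up m) (a r))
    fun r => Str.Realizes.cast_mem _ (Part.mem_some _))).trans ?_
  constructor
  · intro h
    exact ⟨_, h, by rw [castS_castS]; rfl⟩
  · rintro ⟨z, hz, rfl⟩
    rw [castS_castS]
    exact hz

theorem mem_partMap_fn {q : (partSig T.thy.sig).Fn} {m nn : ℕ} (hn : nn = m + q.1.2.2)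
    {Δ : K (cx m)} {zs : ∀ i, K ((((partSig T.thy.sig).fnArity q).sort i).up m)}
    {y : K ((q.1.2.1.sort 0).up m)} :
    y ∈ (D.pull (partMap T f)).fn (.inr (q, m)) (Arity.consFam (F := K) Δ zs) ↔
      (∀ i, X.OverAt m Δ _ (zs i)) ∧
      ∃ u ∈ D.evR (V := ((T.thy.sig.fnArity q.1.1).under m).ctx)
          (Arity.consFam (F := K) Δ (Arity.appL (F := fun s : Srt => K (s.up m)) zs))
          (T.times (T.thy.sig.gen q.1.1) m),
        ∃ z ∈ X.sub q.1.2.1 m nn Δ (X.piece q.1.2.1 q.2 m hn u)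
          (X.args m q.1.2.2 hn Δ fun r => castS (tmS_up m)
            (Arity.appR (F := fun s : Srt => K (s.up m)) zs r)),
        castS (q.1.2.1.sort_up m) z = y := by
  let b := (partSig T.thy.sig).fnArity q
  let ρ : ∀ x, K ((b.under m).ctx.sort x) := Arity.consFam (F := K) Δ zs
  have hz : ∀ i, zs i ∈ D.evR ρ (RTerm.ofTerm (argVar b m i)) :=
    fun i => (D.mem_evR _).2 ⟨Part.mem_some _, trivial⟩
  have hL := Arity.appL_rel (F := fun s : Srt => K (s.up m))
    (G := fun s : Srt => RTerm T.thy.sig (b.under m).ctx (s.up m))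
    (Q := fun _ x t => x ∈ D.evR ρ t) hz
  have hA := Arity.appR_rel (F := fun s : Srt => K (s.up m))
    (G := fun s : Srt => RTerm T.thy.sig (b.under m).ctx (s.up m))
    (Q := fun _ x t => x ∈ D.evR ρ t) hz
  have hΔ : Δ ∈ D.evR ρ (RTerm.ofTerm (ctxVar b m)) :=
    (D.mem_evR _).2 ⟨Part.mem_some _, trivial⟩
  have ht : D.evR ρ ((T.times (T.thy.sig.gen q.1.1) m).subst (partArgs T q.1.1 q.1.2.2 m)) =
      D.evR (V := ((T.thy.sig.fnArity q.1.1).under m).ctx)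
          (Arity.consFam (F := K) Δ (Arity.appL (F := fun s : Srt => K (s.up m)) zs))
          (T.times (T.thy.sig.gen q.1.1) m) :=
    D.evR_subst _ fun i => by exact Fin.cases hΔ hL i
  refine (D.mem_evR_restrict _).trans ((and_comm.trans (and_congr ?_ ?_)))
  · exact (D.sat_formula f _ _).trans hR.sat_overFormula
  · rw [← ht]
    refine (D.mem_evR_subst _).trans (Arity.exists_consFam.trans ?_)
    constructor
    · rintro ⟨Δ', ys, h, hy⟩
      obtain rfl := Part.mem_unique hΔ (h (0 : Fin (_ + 2)))
      obtain ⟨u, a, rfl⟩ : ∃ u a, ys = Arity.consFam (F := K)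
        (a := Arity.rep q.1.2.2 ((tmS 0).up m)) u a := ⟨_, _, Arity.consFam_eta ys⟩
      have ea : a = Arity.appR (F := fun s : Srt => K (s.up m)) zs :=
        funext fun r => Part.mem_unique (h r.succ.succ) (hA r)
      subst ea
      exact ⟨u, h (Fin.succ (0 : Fin (_ + 1))),
        (mem_partTerm hR q.2 hn).1 ((Part.ext_iff.1 (D.evR_term f _ _) y).1 hy)⟩
    · rintro ⟨u, hu, h⟩
      refine ⟨Δ, Arity.consFam (F := K) (a := Arity.rep q.1.2.2 ((tmS 0).up m)) u
        (Arity.appR (F := fun s : Srt => K (s.up m)) zs), fun i => ?_, ?_⟩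
      · exact Fin.cases hΔ (fun i => Fin.cases hu hA i) i
      · exact (Part.ext_iff.1 (D.evR_term f _ _) y).2 ((mem_partTerm hR q.2 hn).2 h)

theorem partMap_pr_inl {R : T.thy.sig.Pr} {m : ℕ} {Δ : K (cx m)}
    {xs : ∀ i, K (((T.thy.sig.prArity R).sort i).up m)} :
    (D.pull (partMap T f)).pr (.inr (.inl R, m)) (Arity.consFam (F := K) Δ xs) ↔
      D.sat (V := ((T.thy.sig.prArity R).under m).ctx) (Arity.consFam (F := K) Δ xs)
        (T.timesFormula (.rel R fun i => .var (V := (T.thy.sig.prArity R).ctx) i) m) ∧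
      ∀ i, X.OverAt m Δ _ (xs i) := by
  exact and_congr Iff.rfl ((D.sat_formula f _ _).trans hR.sat_overFormula)

theorem partMap_pr_inr {σ : T.thy.sig.Fn} {m : ℕ} {Δ : K (cx m)}
    {xs : ∀ i, K (((T.thy.sig.fnArity σ).sort i).up m)} :
    (D.pull (partMap T f)).pr (.inr (.inr σ, m)) (Arity.consFam (F := K) Δ xs) ↔
      (∃ y, y ∈ D.evR (V := ((T.thy.sig.fnArity σ).under m).ctx) (Arity.consFam (F := K) Δ xs)
        (T.times (T.thy.sig.gen σ) m)) ∧
      ∀ i, X.OverAt m Δ _ (xs i) := by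
  exact and_congr (D.sat_rdefd _ _) ((D.sat_formula f _ _).trans hR.sat_overFormula)

end

/-! ### Slices of the contextual structure -/

theorem castS_comp {S S' : Type} {F : S' → Type v} (g : S → S') {s s' : S} (h : s = s')
    (x : F (g s)) : castS (K := fun s => F (g s)) h x = castS (congrArg g h) x := by
  subst h
  rfl

namespace SOps

variable {K : Srt → Type v} {X : SOps K} (hX : X.IsModel) {γ : K (cx 1)}
  {P : ∀ s : Srt, K (s.up 1) → Prop} (hP : ∀ s x, P s x ↔ X.IsOver γ s x)

theorem slice_overAt {m : ℕ} {Δ : SliceCarrier P (cx m)} {s : Srt} {x : SliceCarrier P s} :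
    (X.slice hX hP).OverAt m Δ s x ↔ X.OverAt (m + 1) Δ.1 (s.up 1) x.1 := by
  have e (h : m ≤ s.2) : (X.slice hX hP).ftTo m s.2 h ((X.slice hX hP).cxOf s x) = Δ ↔
      X.ftTo (m + 1) (s.2 + 1) (by omega) (X.cxOf (s.up 1) x.1) = Δ.1 := by
    rw [Subtype.ext_iff, X.slice_ftTo hX hP, X.slice_cxOf hX hP]
  exact ⟨fun ⟨h, h'⟩ => ⟨Nat.succ_le_succ h, (e h).1 h'⟩,
    fun ⟨h, h'⟩ => ⟨Nat.le_of_succ_le_succ h, (e (Nat.le_of_succ_le_succ h)).2 h'⟩⟩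

omit hX hP in
theorem OverAt.isOver {m : ℕ} {Δ : K (cx (m + 1))} (hΔ : X.ftTo 1 (m + 1) (by omega) Δ = γ)
    {s : Srt} {x : K (s.up 1)} (h : X.OverAt (m + 1) Δ (s.up 1) x) : X.IsOver γ s x := by
  obtain ⟨h', h⟩ := h
  rw [IsOver, ← X.ftTo_ftTo (show 1 ≤ m + 1 by omega) h', h, hΔ]

theorem castS_sliceVal (p : Cls) (m : ℕ) (z : SliceCarrier P (p.sort m)) :
    (castS (p.sort_up m) z).1 = castS (p.sort_up (m + 1)) (sliceVal p m z) := by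
  cases p
  all_goals
    rw [castS_natural (F := SliceCarrier P) (G := fun s : Srt => K (s.up 1)) (fun _ x => x.1),
      castS_comp (fun s : Srt => s.up 1)]
    rfl

end SOps

section

variable {T : PrestableData.{u}} {f : SymMap substSig T.thy.sig}

namespace IsADTT

variable (hT : IsADTT T f) {K : Srt → Type u} {M : Str T.thy.sig K} (hM : M.Models)
  {X : SOps K} (hG : Good T f M X) {γ : K (cx 1)}
  {P : ∀ s : Srt, K (s.up 1) → Prop} (hP : ∀ s x, P s x ↔ X.IsOver γ s x)
include hT hM hG hP

/-- Every ingredient is compatible with slicing: `Δ × σ` by `mem_times_succ`, pieces by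
`piece_slice`, the list of terms by `consW_args`, and substitution by `mem_slice_sub`. This is the
semantic content of `α` sending `L(σ_m)` to `σ_{m+1}`. -/
theorem mem_partMap_fn_succ {q : (partSig T.thy.sig).Fn} {m : ℕ} {Δ : SliceCarrier P (cx m)}
    {zs : ∀ i, SliceCarrier P ((((partSig T.thy.sig).fnArity q).sort i).up m)}
    {y : K ((q.1.2.1.sort 0).up (m + 1))} :
    y ∈ (M.pull (partMap T f)).fn (.inr (q, m + 1))
        (Arity.consFam (F := K) (a := ((partSig T.thy.sig).fnArity q).up (m + 1))
          Δ.1 fun i => (zs i).1) ↔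
      ∃ h : P ((q.1.2.1.sort 0).up m) y, (⟨y, h⟩ : SliceCarrier P ((q.1.2.1.sort 0).up m)) ∈
        (((M.pull T.alpha).slice γ P).pull (partMap T f)).fn (.inr (q, m))
          (Arity.consFam (F := SliceCarrier P) (a := ((partSig T.thy.sig).fnArity q).up m) Δ zs) := by
  have hS := hT.slice_good hM hG hP
  have hL : (Arity.appL (F := fun s : Srt => K (s.up (m + 1))) fun i => (zs i).1) =
      fun i => (Arity.appL (F := fun s : Srt => SliceCarrier P (s.up m)) zs i).1 :=
    funext fun i => (Arity.appL_natural (F := fun s : Srt => SliceCarrier P (s.up m))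
      (G := fun s : Srt => K (s.up (m + 1))) (fun _ x => x.1) zs i).symm
  have hA : (fun r => castS (tmS_up (m + 1))
        (Arity.appR (F := fun s : Srt => K (s.up (m + 1))) (fun i => (zs i).1) r)) =
      fun r => (castS (tmS_up m)
        (Arity.appR (F := fun s : Srt => SliceCarrier P (s.up m)) zs r)).1 := by
    funext r
    rw [← Arity.appR_natural (F := fun s : Srt => SliceCarrier P (s.up m))
      (G := fun s : Srt => K (s.up (m + 1))) (fun _ x => x.1) zs r,
      castS_natural (F := SliceCarrier P) (G := fun s : Srt => K (s.up 1)) (fun _ x => x.1),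
      castS_comp (fun s : Srt => s.up 1)]
  have hO : (∀ i, X.OverAt (m + 1) Δ.1 _ (zs i).1) ↔
      ∀ i, (X.slice hG.isModel hP).OverAt m Δ _ (zs i) :=
    forall_congr' fun i => (SOps.slice_overAt hG.isModel hP).symm
  have h1 := fun u : SliceCarrier P ((T.thy.sig.fnCod q.1.1).up m) =>
    SOps.piece_slice hG.isModel hP q.2 (m := m) rfl u
  have h2 := SOps.consW_args hP hG.isModel (m := m) (j := q.1.2.2) rfl Δ fun r =>
    castS (tmS_up m) (Arity.appR (F := fun s : Srt => SliceCarrier P (s.up m)) zs r)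
  refine (mem_partMap_fn hG.realizes (nn := m + q.1.2.2 + 1) (by omega)).trans ?_
  refine Iff.trans ?_ (exists_congr fun h => (mem_partMap_fn hS.realizes rfl).symm)
  rw [hL, hA]
  constructor
  · rintro ⟨ho, u, hu, z, hz, hy⟩
    obtain ⟨hu', hu⟩ := (hT.mem_times_succ hM hG.realizes hP _).1 hu
    rw [← h2] at hz
    erw [← h1 ⟨u, hu'⟩] at hz
    obtain ⟨z, rfl⟩ := X.exists_slice_sub hG.isModel hP hz
    have e := (SOps.castS_sliceVal q.1.2.1 m z).trans hy
    subst e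
    exact ⟨(castS (q.1.2.1.sort_up m) z).2, hO.1 ho, ⟨u, hu'⟩, hu, z,
      (X.mem_slice_sub hG.isModel hP).2 hz, rfl⟩
  · rintro ⟨h, ho, u, hu, z, hz, hy⟩
    refine ⟨hO.2 ho, u.1, (hT.mem_times_succ hM hG.realizes hP _).2 ⟨u.2, hu⟩,
      SOps.sliceVal _ _ z, ?_, ?_⟩
    · rw [← h2]
      erw [← h1 u]
      exact (X.mem_slice_sub hG.isModel hP).1 hz
    · rw [← SOps.castS_sliceVal, hy]

theorem partMap_pr_succ {R : (partSig T.thy.sig).Pr} {m : ℕ} {Δ : SliceCarrier P (cx m)}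
    {zs : ∀ i, SliceCarrier P ((((partSig T.thy.sig).prArity R).sort i).up m)} :
    (M.pull (partMap T f)).pr (.inr (R, m + 1))
        (Arity.consFam (F := K) (a := ((partSig T.thy.sig).prArity R).up (m + 1))
          Δ.1 fun i => (zs i).1) ↔
      (((M.pull T.alpha).slice γ P).pull (partMap T f)).pr (.inr (R, m))
          (Arity.consFam (F := SliceCarrier P) (a := ((partSig T.thy.sig).prArity R).up m) Δ zs) := by
  have hS := hT.slice_good hM hG hP
  have hO : (∀ i, X.OverAt (m + 1) Δ.1 _ (zs i).1) ↔
      ∀ i, (X.slice hG.isModel hP).OverAt m Δ _ (zs i) :=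
    forall_congr' fun i => (SOps.slice_overAt hG.isModel hP).symm
  cases R with
  | inl R =>
    refine (partMap_pr_inl hG.realizes).trans (Iff.trans ?_ (partMap_pr_inl hS.realizes).symm)
    exact and_congr (hT.sat_timesFormula_succ hM hG.realizes hP _) hO
  | inr σ =>
    refine (partMap_pr_inr hG.realizes).trans (Iff.trans ?_ (partMap_pr_inr hS.realizes).symm)
    refine and_congr ?_ hO
    constructor
    · rintro ⟨y, hy⟩
      obtain ⟨h, hy⟩ := (hT.mem_times_succ hM hG.realizes hP _).1 hy
      exact ⟨_, hy⟩
    · rintro ⟨y, hy⟩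
      exact ⟨y.1, (hT.mem_times_succ hM hG.realizes hP _).2 ⟨y.2, hy⟩⟩

end IsADTT

end

/-! ### The contextual theory -/

namespace ContextualData

variable (C : ContextualData.{u}) {K : Srt → Type u} (N : Str C.sig K)

theorem pull_alpha_inl (b : BaseFn) :
    (N.pull C.alpha).fn (.inl b) = (N.inl.pull substBase).fn b :=
  funext fun _ => N.evR_incl _ _

theorem pull_alpha_subst (τ : SubstFn) :
    (N.pull C.alpha).fn (.inr (.inl τ)) = (N.inl.pull substAlpha).fn (.inr τ) :=
  funext fun _ => N.evR_incl _ _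

variable {N} {X : SOps K} (hR : N.inl.Realizes X) {a : Arity Srt} {m : ℕ} {γ : K (cx 1)}
  {Δ : K (cx (m + 1))} {zs : ∀ i, K ((a.sort i).up (m + 1))}

/-- A valuation of the variables `Γ`, `Δ` and `x₁, …, x_k` of `L(σ_m)`. -/
abbrev liftVal (a : Arity Srt) {m : ℕ} (γ : K (cx 1)) (Δ : K (cx (m + 1)))
    (zs : ∀ i, K ((a.sort i).up (m + 1))) : ∀ i, K (((a.under m).under 1).sort i) :=
  Arity.consFam (F := K) (a := (a.under m).up 1) γ
    (Arity.consFam (F := fun s : Srt => K (s.up 1)) (a := a.up m) Δ zs)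

theorem mem_ev_liftArgs (i) :
    (Arity.consFam (F := K) (a := a.up (m + 1)) Δ zs) i ∈
      N.ev (V := ((a.under m).under 1).ctx) (liftVal a γ Δ zs) (C.liftArgs a m i) := by
  refine Fin.cases ?_ (fun i => ?_) i
  · exact Part.mem_some _
  · exact Part.mem_some _

include hR in
theorem sat_liftCond :
    N.sat (V := ((a.under m).under 1).ctx) (liftVal a γ Δ zs) (C.liftCond a m) ↔
      X.ftTo 1 (m + 1) (by omega) Δ = γ := by
  refine (N.sat_incl _ _).trans ?_
  have h := hR.ftOne_mem (V := ((a.under m).under 1).ctx) (ρ := liftVal a γ Δ zs)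
    (t := liftΔ a m) (x := Δ) (Part.mem_some _)
  constructor
  · rintro ⟨y, h1, h2⟩
    rw [Part.mem_unique h h1]
    exact Part.mem_some_iff.1 h2
  · intro e
    exact ⟨_, h, Part.mem_some_iff.2 e⟩

include hR in
theorem mem_pull_alpha_fn {σ : C.basic.sig.Fn}
    {zs : ∀ i, K (((C.basic.sig.fnArity σ).sort i).up (m + 1))}
    {y : K ((C.basic.sig.fnCod σ).up (m + 1))} :
    y ∈ (N.pull C.alpha).fn (.inr (.inr (σ, m))) (liftVal (C.basic.sig.fnArity σ) γ Δ zs) ↔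
      y ∈ N.fn (.inr (σ, m + 1)) (Arity.consFam (F := K)
        (a := (C.basic.sig.fnArity σ).up (m + 1)) Δ zs) ∧ X.ftTo 1 (m + 1) (by omega) Δ = γ := by
  refine (N.mem_evR _).trans (and_congr ?_ (C.sat_liftCond hR))
  exact Part.ext_iff.1 (N.ev_app (V := ((C.basic.sig.fnArity σ).under m).under 1 |>.ctx)
    (σ := .inr (σ, m + 1)) (liftVal _ γ Δ zs) (C.mem_ev_liftArgs (a := C.basic.sig.fnArity σ))) y

include hR in
theorem pull_alpha_pr {R : C.basic.sig.Pr}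
    {zs : ∀ i, K (((C.basic.sig.prArity R).sort i).up (m + 1))} :
    (N.pull C.alpha).pr (.inr (.inr (R, m))) (liftVal (C.basic.sig.prArity R) γ Δ zs) ↔
      N.pr (.inr (R, m + 1)) (Arity.consFam (F := K)
        (a := (C.basic.sig.prArity R).up (m + 1)) Δ zs) ∧ X.ftTo 1 (m + 1) (by omega) Δ = γ := by
  refine and_congr ?_ (C.sat_liftCond hR)
  exact N.sat_rel_iff (V := ((C.basic.sig.prArity R).under m).under 1 |>.ctx)
    (R := .inr (R, m + 1)) (liftVal _ γ Δ zs) (C.mem_ev_liftArgs (a := C.basic.sig.prArity R))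

theorem _root_.PHT.Arity.consFam_subtype {P : ∀ s : Srt, K (s.up 1) → Prop} {a : Arity Srt} {m : ℕ}
    {Δ : K (cx (m + 1))} {zs : ∀ i, K ((a.sort i).up (m + 1))}
    (h : ∀ i, P ((a.under m).sort i)
      (Arity.consFam (F := fun s : Srt => K (s.up 1)) (a := a.up m) Δ zs i)) :
    Arity.consFam (F := SliceCarrier P) (a := a.up m) ⟨Δ, h (0 : Fin (a.len + 1))⟩
        (fun i => ⟨zs i, h i.succ⟩) =
      fun i => ⟨Arity.consFam (F := fun s : Srt => K (s.up 1)) (a := a.up m) Δ zs i, h i⟩ :=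
  funext fun i => Fin.cases rfl (fun _ => rfl) i

theorem inclusion_pull : N.pull C.inclusion = N.inl := by
  refine Str.ext (funext fun τ => funext fun ys => ?_) (funext fun e => e.elim)
  exact (N.evR_ofTerm (V := (substSig.fnArity τ).ctx) ys _).trans (N.ev_app_vars (.inl τ) ys)

end ContextualData

section

variable {T : PrestableData.{u}} {f : SymMap substSig T.thy.sig}

namespace IsADTT

variable (hT : IsADTT T f)
include hT

/-- On the symbols of the theory of substitutions `partMap` is `f`, so the corresponding part of the
reduct of a model is the reduct along `f`. -/
theorem subst_derivable (c : SubstAxName) :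
    T.thy.Derivable ((partMap T f).formula ((substAx c).incl (indexedSig (partSig T.thy.sig))).hyp)
      ((partMap T f).formula ((substAx c).incl (indexedSig (partSig T.thy.sig))).concl) := by
  refine Theory.derivable_iff.2 fun K M hM ρ h => ?_
  refine (M.sat_formula (partMap T f) ρ _).2 (((M.pull (partMap T f)).sat_incl ρ _).2 ?_)
  refine hT.pull_models hM _ ⟨c, rfl⟩ ρ ?_
  exact ((M.pull (partMap T f)).sat_incl ρ _).1 ((M.sat_formula (partMap T f) ρ _).1 h)

/-- The contextual theory of an algebraic dependent type theory. -/
def contextual : ContextualData.{u} where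
  basic := ⟨partSig T.thy.sig, fun q h => by
    obtain ⟨⟨σ, p, j⟩, hq⟩ := q
    cases p <;> simp [Cls.sort] at h⟩
  -- All sequents that become theorems of `T`. This choice makes the interpretation in `T`
  -- conservative by construction.
  axms := {q | T.thy.Derivable ((partMap T f).formula q.hyp) ((partMap T f).formula q.concl)}
  subst_axms := hT.subst_derivable

theorem fnCod_contextual (σ : hT.contextual.basic.sig.Fn) :
    hT.contextual.basic.sig.fnCod σ = tyS 0 ∨ hT.contextual.basic.sig.fnCod σ = tmS 0 := by
  obtain ⟨⟨σ, p, j⟩, hq⟩ := σ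
  cases p
  · exact .inl rfl
  · exact .inr rfl

/-- The interpretation of the contextual theory. -/
def partInterp : SymMap hT.contextual.toPrestable.thy.sig T.thy.sig := partMap T f

/-- The reducts satisfy the axioms by their choice. A sequent valid in all reducts has, by
completeness for `T`, a derivable interpretation, and is therefore itself an axiom. -/
theorem detects : hT.contextual.toPrestable.thy.Detects fun K N =>
    ∃ M : Str T.thy.sig K, M.Models ∧ N = M.pull hT.partInterp := by
  intro V φ ψ
  constructor
  · rintro h K N ⟨M, hM, rfl⟩
    refine h.sound fun q hq ρ hρ => ?_
    have hq' : T.thy.Derivable (hT.partInterp.formula q.hyp) (hT.partInterp.formula q.concl) := hq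
    exact (M.sat_formula hT.partInterp ρ _).1
      (hq'.sound hM ρ ((M.sat_formula hT.partInterp ρ _).2 hρ))
  · intro h
    refine Theory.Derivable.ax (T := hT.contextual.toPrestable.thy) ⟨V, φ, ψ⟩ ?_
    refine Theory.derivable_iff.2 fun K M hM ρ hρ => ?_
    exact (M.sat_formula hT.partInterp ρ _).2
      (h K _ ⟨M, hM, rfl⟩ ρ ((M.sat_formula hT.partInterp ρ _).1 hρ))

variable {K : Srt → Type u} {M : Str T.thy.sig K} (hM : M.Models)
include hM

omit hM in
theorem isInterp_partInterp : IsInterp hT.contextual.toPrestable.thy T.thy hT.partInterp :=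
  fun _ hq => hq

/-- For the symbols of contexts and of substitutions this is the compatibility of `f`. For an
indexed symbol both sides are the symbol with index `m` in the slice over `γ`, by the comparison of
indices `m + 1` and `m`. -/
theorem pull_partInterp_alpha :
    (M.pull hT.partInterp).pull hT.contextual.alpha =
      (M.pull T.alpha).pull (LMap hT.partInterp) := by
  obtain ⟨X, hG⟩ := hT.exists_good hM
  have hR : (M.pull hT.partInterp).inl.Realizes X := hG.realizes
  have hγ : ∀ {m γ} {Δ : K (cx (m + 1))}, X.IsOver γ (cx m) Δ ↔
    X.ftTo 1 (m + 1) (by omega) Δ = γ := Iff.rfl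
  refine Str.ext (funext fun σ => funext fun ys => ?_)
    (funext fun R => funext fun ys => propext ?_)
  · obtain b | τ | ⟨q, m⟩ := σ
    · refine (congrFun (hT.contextual.pull_alpha_inl _ b) ys).trans (Eq.symm ?_)
      exact (congrFun (Str.pull_LMap_inl (N := M.pull T.alpha) hT.partInterp b) ys).trans (congrFun (hT.alpha_inl hM b) ys)
    · refine (congrFun (hT.contextual.pull_alpha_subst _ τ) ys).trans ?_
      exact congrFun (congrFun (congrArg Str.fn (hT.pull_substAlpha hM)) (.inr τ)) ys
    · obtain ⟨γ, Δ, zs, rfl⟩ : ∃ γ Δ zs, ys = ContextualData.liftVal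
          ((partSig T.thy.sig).fnArity q) γ Δ zs := ⟨ys (0 : Fin (_ + 2)),
        ys (Fin.succ (0 : Fin (_ + 1))), fun i => ys (Fin.succ (Fin.succ i)), by
          funext i
          exact Fin.cases rfl (fun i => Fin.cases rfl (fun i => rfl) i) i⟩
      let P : ∀ s : Srt, K (s.up 1) → Prop := X.IsOver γ
      have hP : ∀ s x, P s x ↔ X.IsOver γ s x := fun _ _ => Iff.rfl
      refine Part.ext fun y => (hT.contextual.mem_pull_alpha_fn hR).trans (Iff.trans ?_
        (Str.mem_pull_LMap_inr (hT.alpha_lRegular hM) (hT.isOver_iff hM hG.realizes hP)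
          (σ := Sum.inr (q, m)) hT.partInterp).symm)
      constructor
      · rintro ⟨h, hΔ⟩
        -- The arguments are over `Δ` by the restriction in `partMap`, hence over `γ`, and so belong
        -- to the slice.
        have hz : ∀ i, P ((((partSig T.thy.sig).fnArity q).sort i).up m) (zs i) := fun i =>
          SOps.OverAt.isOver (s := (((partSig T.thy.sig).fnArity q).sort i).up m) hΔ
            (((mem_partMap_fn hG.realizes rfl).1 h).1 i)
        obtain ⟨hy, h⟩ := (hT.mem_partMap_fn_succ hM hG hP (Δ := ⟨Δ, hγ.2 hΔ⟩)
          (zs := fun i => ⟨zs i, hz i⟩)).1 h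
        refine ⟨fun i => Fin.cases (hγ.2 hΔ) hz i, hy, ?_⟩
        exact (iff_of_eq (congrArg (fun ws => (⟨y, hy⟩ : SliceCarrier P _) ∈
          (((M.pull T.alpha).slice γ P).pull hT.partInterp).fn (.inr (q, m)) ws)
          (Arity.consFam_subtype fun i => Fin.cases (hγ.2 hΔ) hz i))).1 h
      · rintro ⟨hx, hy, h⟩
        refine ⟨(hT.mem_partMap_fn_succ hM hG hP (Δ := ⟨Δ, hx (0 : Fin (_ + 1))⟩)
          (zs := fun i => ⟨zs i, hx i.succ⟩)).2 ⟨hy, ?_⟩, hγ.1 (hx (0 : Fin (_ + 1)))⟩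
        exact (iff_of_eq (congrArg (fun ws => (⟨y, hy⟩ : SliceCarrier P _) ∈
          (((M.pull T.alpha).slice γ P).pull hT.partInterp).fn (.inr (q, m)) ws)
          (Arity.consFam_subtype hx))).2 h
  · obtain e | e | ⟨R, m⟩ := R
    · exact e.elim
    · exact e.elim
    · obtain ⟨γ, Δ, zs, rfl⟩ : ∃ γ Δ zs, ys = ContextualData.liftVal
          ((partSig T.thy.sig).prArity R) γ Δ zs := ⟨ys (0 : Fin (_ + 2)),
        ys (Fin.succ (0 : Fin (_ + 1))), fun i => ys (Fin.succ (Fin.succ i)), by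
          funext i
          exact Fin.cases rfl (fun i => Fin.cases rfl (fun i => rfl) i) i⟩
      let P : ∀ s : Srt, K (s.up 1) → Prop := X.IsOver γ
      have hP : ∀ s x, P s x ↔ X.IsOver γ s x := fun _ _ => Iff.rfl
      refine (hT.contextual.pull_alpha_pr hR).trans (Iff.trans ?_
        (Str.pull_LMap_inr_pr (hT.alpha_lRegular hM) (hT.isOver_iff hM hG.realizes hP)
          (R := Sum.inr (R, m)) hT.partInterp).symm)
      constructor
      · rintro ⟨h, hΔ⟩
        have hz : ∀ i, P ((((partSig T.thy.sig).prArity R).sort i).up m) (zs i) := fun i =>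
          SOps.OverAt.isOver hΔ (by
          cases R with
          | inl R => exact ((partMap_pr_inl hG.realizes).1 h).2 i
          | inr σ => exact ((partMap_pr_inr hG.realizes).1 h).2 i)
        have h := (hT.partMap_pr_succ hM hG hP (Δ := ⟨Δ, hγ.2 hΔ⟩)
          (zs := fun i => ⟨zs i, hz i⟩)).1 h
        refine ⟨fun i => Fin.cases (hγ.2 hΔ) hz i, ?_⟩
        exact (iff_of_eq (congrArg
          ((((M.pull T.alpha).slice γ P).pull hT.partInterp).pr (.inr (R, m)))
          (Arity.consFam_subtype fun i => Fin.cases (hγ.2 hΔ) hz i))).1 h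
      · rintro ⟨hx, h⟩
        refine ⟨(hT.partMap_pr_succ hM hG hP (Δ := ⟨Δ, hx (0 : Fin (_ + 1))⟩)
          (zs := fun i => ⟨zs i, hx i.succ⟩)).2 ?_, hγ.1 (hx (0 : Fin (_ + 1)))⟩
        exact (iff_of_eq (congrArg
          ((((M.pull T.alpha).slice γ P).pull hT.partInterp).pr (.inr (R, m)))
          (Arity.consFam_subtype hx))).2 h

end IsADTT

end

/-! ### The operations of an algebraic dependent type theory in its contextual theory -/

theorem SOps.ftTo_cxOf {K : Srt → Type v} (X : SOps K) {s : Srt} {n : ℕ} (hs : s = cx n) (u : K s)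
    (h : n ≤ s.2) : X.ftTo n s.2 h (X.cxOf s u) = castS hs u := by
  subst hs
  exact X.ftTo_self _ _

theorem SOps.IsModel.overAt_zero {K : Srt → Type v} {X : SOps K} (hX : X.IsModel) {s : Srt}
    {Δ : K (cx 0)} {x : K s} : X.OverAt 0 Δ s x :=
  ⟨Nat.zero_le _, (hX.star_unique _).trans (hX.star_unique _).symm⟩

section

variable {T : PrestableData.{u}} {σ : T.thy.sig.Fn} {j : ℕ}

/-- Terms of the theory of substitutions in a context `t` and the arguments of `σ`. -/
def weakTerm (t : Term (contextualSig T.thy.sig) (T.thy.sig.fnArity σ).ctx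
    (cx j)) {s : Srt} (e : SubT.Tm (Ctx.cons (cx j) (T.thy.sig.fnArity σ).ctx) s) :
    Term (contextualSig T.thy.sig) (T.thy.sig.fnArity σ).ctx s :=
  (e.incl _).subst (Ctx.consFam (F := Term (contextualSig T.thy.sig)
    (T.thy.sig.fnArity σ).ctx) t fun i => .var (V := (T.thy.sig.fnArity σ).ctx) i)

/-- A part of `σ(x₁, …, x_k)` from its context. -/
def pieceTerm {p : Cls} (hp : Piece (T.thy.sig.fnCod σ) p j)
    (t : Term (contextualSig T.thy.sig) (T.thy.sig.fnArity σ).ctx (cx j)) :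
    Term (contextualSig T.thy.sig) (T.thy.sig.fnArity σ).ctx (p.sort j) :=
  let W := Ctx.cons (cx j) (T.thy.sig.fnArity σ).ctx
  let τ : SubT.Tm W (cx j) := Term.varOf (V := W) none
  Term.cast (p.sort_up j).symm <| .app (A := substSig.sum (indexedSig (partSig T.thy.sig)))
    (Sum.inr (⟨(σ, p, j), hp⟩, j)) <|
    Arity.consFam (F := Term (contextualSig T.thy.sig)
        (T.thy.sig.fnArity σ).ctx) (a := ((T.thy.sig.fnArity σ).app j (tmS 0)).up j) t <|
      Arity.appFam (F := fun s : Srt => Term (contextualSig T.thy.sig)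
        (T.thy.sig.fnArity σ).ctx (s.up j))
      (fun i => weakTerm t (SubT.substUp j 0 τ ((T.thy.sig.fnArity σ).sort i)
        (Term.varOf (V := W) (some i)) Fin.elim0))
      (fun r => (weakTerm t (SubT.v j r.rev τ)).cast (tmS_up j).symm)

variable {f : SymMap substSig T.thy.sig} {K : Srt → Type u} {D : Str T.thy.sig K} {X : SOps K}
  (hG : Good T f D X) {xs : ∀ i, K ((T.thy.sig.fnArity σ).sort i)}

theorem ev_weakTerm
    {t : Term (contextualSig T.thy.sig) (T.thy.sig.fnArity σ).ctx (cx j)}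
    {τ : K (cx j)} (ht : τ ∈ (D.pull (partMap T f)).ev (V := (T.thy.sig.fnArity σ).ctx) xs t)
    {s : Srt} (e : SubT.Tm (Ctx.cons (cx j) (T.thy.sig.fnArity σ).ctx) s) :
    (D.pull (partMap T f)).ev (V := (T.thy.sig.fnArity σ).ctx) xs (weakTerm t e) =
      (D.pull f).ev (Ctx.consFam (F := K) (V := (T.thy.sig.fnArity σ).ctx) τ xs) e := by
  refine (Str.ev_subst (V := Ctx.cons (cx j) (T.thy.sig.fnArity σ).ctx)
    (ρ' := Ctx.consFam (F := K) (V := (T.thy.sig.fnArity σ).ctx) τ xs) (fun x => ?_) _).trans ?_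
  · cases x with
    | none => exact ht
    | some i => exact Part.mem_some _
  · exact (D.pull (partMap T f)).ev_incl _ _

-- The reconstruction of one piece from the segment `τ` of its context: at the weakened arguments `τ
-- × σ` has the weakening of `u` as a value, and the variables of `τ`, used as additional terms,
-- undo the weakening.
include hG in
theorem piece_mem_pieceTerm {p : Cls} (hp : Piece (T.thy.sig.fnCod σ) p j)
    {t : Term (contextualSig T.thy.sig) (T.thy.sig.fnArity σ).ctx (cx j)}
    {u : K (T.thy.sig.fnCod σ)} (hu : u ∈ D.fn σ xs) (hj : j ≤ (T.thy.sig.fnCod σ).2)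
    (ht : X.ftTo j _ hj (X.cxOf _ u) ∈
      (D.pull (partMap T f)).ev (V := (T.thy.sig.fnArity σ).ctx) xs t) :
    X.piece p hp 0 (nn := j) (by omega) u ∈
      (D.pull (partMap T f)).ev (V := (T.thy.sig.fnArity σ).ctx) xs (pieceTerm hp t) := by
  obtain ⟨xs', u', hxs, hu', hm⟩ := hG.weaken σ xs u hu j (X.ftTo j _ hj (X.cxOf _ u))
  let τ := X.ftTo j _ hj (X.cxOf _ u)
  have h1 := SOps.piece_subUp hG.isModel hp hu' (nn := j + j) (kk := j) rfl (by omega)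
  -- The weakened piece, with the variables of `τ` inserted twice, is the original piece.
  have h2 := SOps.mem_sub_of_subP hG.isModel rfl h1 (SOps.ctxOf_piece hp (m := 0) (by omega) u)
  have hvar : τ ∈ (D.pull f).ev (V := Ctx.cons (cx j) (T.thy.sig.fnArity σ).ctx)
    (Ctx.consFam (F := K) (V := (T.thy.sig.fnArity σ).ctx) τ xs)
    (Term.varOf (V := Ctx.cons (cx j) (T.thy.sig.fnArity σ).ctx) none) := Part.mem_some _
  refine (Str.mem_ev_cast _).2 ?_
  let vs : Fin j → K ((tmS 0).up j) := fun r => castS (tmS_up j).symm (X.w j r τ)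
  let zs := Arity.appFam (F := fun s : Srt => K (s.up j)) xs' vs
  have hargs := Arity.appFam_rel (F := fun s : Srt => K (s.up j))
    (G := fun s : Srt => Term (contextualSig T.thy.sig)
        (T.thy.sig.fnArity σ).ctx (s.up j))
    (Q := fun _ x t => x ∈ (D.pull (partMap T f)).ev (V := (T.thy.sig.fnArity σ).ctx) xs t)
    (xs := xs') (as := vs)
    (ys := fun i => weakTerm t (SubT.substUp j 0
      (Term.varOf (V := Ctx.cons (cx j) (T.thy.sig.fnArity σ).ctx) none)
      ((T.thy.sig.fnArity σ).sort i)
      (Term.varOf (V := Ctx.cons (cx j) (T.thy.sig.fnArity σ).ctx) (some i)) Fin.elim0))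
    (bs := fun r => (weakTerm t (SubT.v j r.rev
      (Term.varOf (V := Ctx.cons (cx j) (T.thy.sig.fnArity σ).ctx) none))).cast (tmS_up j).symm)
    (fun i => by
      rw [ev_weakTerm ht]
      exact (hG.realizes.mem_ev_substUp hvar (fun i => i.elim0) (Part.mem_some _)).2 (hxs i))
    (fun r => by
      rw [Str.mem_ev_cast, castS_castS, ev_weakTerm ht]
      have := hG.realizes.v_mem (i := r.rev) hvar
      rwa [Fin.rev_rev] at this)
  refine ((D.pull (partMap T f)).mem_ev_app (V := (T.thy.sig.fnArity σ).ctx) xs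
    (σ := Sum.inr (⟨(σ, p, j), hp⟩, j))).2 ⟨Arity.consFam (F := K)
      (a := ((T.thy.sig.fnArity σ).app j (tmS 0)).up j) τ zs, fun i => ?_, ?_⟩
  · exact Fin.cases ht hargs i
  -- The basic symbol is evaluated in the context `τ` of length `j` with `j` additional terms,
  -- whence a list of `j + j` terms. Weakened arguments and variables of `τ` are over `τ`, as the
  -- symbol requires.
  refine (mem_partMap_fn hG.realizes (nn := j + j) rfl).2 ⟨?_, u', ?_, _, ?_, rfl⟩
  · refine Arity.appFam_pred (F := fun s : Srt => K (s.up j))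
      (Q := fun s x => X.OverAt j τ (s.up j) x) (fun i => ?_) fun r => ?_
    · exact ⟨Nat.le_add_left _ _, (hxs i).ftTo_eq hG.isModel⟩
    · refine (castS_pred (Q := fun s x => X.OverAt j τ s x) _).2 ⟨le_rfl, ?_⟩
      exact (X.ftTo_self _ _).trans (hG.isModel.ft_ty_w _ _)
  · rw [Arity.appL_appFam]
    exact hm
  · have e : (fun r => castS (tmS_up j) (Arity.appR (F := fun s : Srt => K (s.up j)) zs r)) =
        X.wv j j le_rfl τ := by
      funext r
      rw [Arity.appR_appFam, castS_castS]
      rfl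
    refine Eq.mp ?_ h2
    rw [← e]
    rfl

/-- The initial segments of the context of `σ(x)` are built one type at a time: the empty one is
`*`, and the segment of length `j + 1` is the type piece over the segment of length `j`. The term is
chosen before the structure, so that it can define an interpretation. -/
theorem exists_ctxTerm (f : SymMap substSig T.thy.sig) (σ : T.thy.sig.Fn) (j : ℕ)
    (hj : j ≤ (T.thy.sig.fnCod σ).2) :
    ∃ t : Term (contextualSig T.thy.sig) (T.thy.sig.fnArity σ).ctx (cx j),
      ∀ (K : Srt → Type u) (D : Str T.thy.sig K) (X : SOps K), Good T f D X → ∀ xs, ∀ u ∈ D.fn σ xs,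
        X.ftTo j _ hj (X.cxOf _ u) ∈
          (D.pull (partMap T f)).ev (V := (T.thy.sig.fnArity σ).ctx) xs t := by
  induction j with
  | zero =>
    refine ⟨SubT.star.incl _, fun K D X hG xs u _ => ?_⟩
    rw [hG.isModel.star_unique (X.ftTo _ _ _ _)]
    refine (Part.ext_iff.1 (Str.ev_incl (D.pull (partMap T f)) _ _) _).2 ?_
    exact hG.realizes.mem_ev_star.2 rfl
  | succ j ih =>
    obtain ⟨t, ht⟩ := ih (by omega)
    have hp : Piece (T.thy.sig.fnCod σ) .ty j := hj
    exact ⟨pieceTerm hp t, fun K D X hG xs u hu =>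
      piece_mem_pieceTerm hG hp hu (by omega) (ht K D X hG xs u hu)⟩

/-- A context is its own longest initial segment. A term is the last piece, over its full context.
-/
theorem exists_fnTerm (f : SymMap substSig T.thy.sig) (σ : T.thy.sig.Fn) :
    ∃ t : Term (contextualSig T.thy.sig) (T.thy.sig.fnArity σ).ctx
        (T.thy.sig.fnCod σ),
      ∀ (K : Srt → Type u) (D : Str T.thy.sig K) (X : SOps K), Good T f D X → ∀ xs, ∀ u ∈ D.fn σ xs,
        u ∈ (D.pull (partMap T f)).ev (V := (T.thy.sig.fnArity σ).ctx) xs t := by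
  obtain ⟨n, hs | hs⟩ : ∃ n, T.thy.sig.fnCod σ = cx n ∨ T.thy.sig.fnCod σ = tmS n := by
    rcases T.thy.sig.fnCod σ with ⟨⟨⟩, n⟩
    · exact ⟨n, .inl rfl⟩
    · exact ⟨n, .inr rfl⟩
  · obtain ⟨t, ht⟩ := exists_ctxTerm f σ n (congrArg Prod.snd hs).ge
    refine ⟨t.cast hs.symm, fun K D X hG xs u hu => (Str.mem_ev_cast _).2 ?_⟩
    rw [← X.ftTo_cxOf hs u (congrArg Prod.snd hs).ge]
    exact ht K D X hG xs u hu
  · obtain ⟨t, ht⟩ := exists_ctxTerm f σ n (congrArg Prod.snd hs).ge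
    exact ⟨(pieceTerm (p := .tm) hs t).cast hs.symm, fun K D X hG xs u hu =>
      (Str.mem_ev_cast _).2 (piece_mem_pieceTerm (p := .tm) hG hs hu _ (ht K D X hG xs u hu))⟩

end

/-! ### The interpretation of `T` in the contextual theory -/

section

variable (T : PrestableData.{u}) (f : SymMap substSig T.thy.sig)

/-- The interpretation of `T` in the contextual theory. -/
noncomputable def fnMap : SymMap T.thy.sig (contextualSig T.thy.sig) where
  -- The chosen term is only known to be correct where `σ` is defined, so it is restricted to the
  -- domain predicate of `σ`, taken over the empty context.
  fn σ := ⟨(exists_fnTerm f σ).choose, .rel (A := contextualSig T.thy.sig) (.inr (.inr σ, 0))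
    (Arity.consFam (F := Term (contextualSig T.thy.sig) (T.thy.sig.fnArity σ).ctx)
      (a := (T.thy.sig.fnArity σ).up 0) (SubT.star.incl _)
      fun i => .var (V := (T.thy.sig.fnArity σ).ctx) i)⟩
  pr R := .rel (A := contextualSig T.thy.sig) (.inr (.inl R, 0))
    (Arity.consFam (F := Term (contextualSig T.thy.sig) (T.thy.sig.prArity R).ctx)
      (a := (T.thy.sig.prArity R).up 0) (SubT.star.incl _)
      fun i => .var (V := (T.thy.sig.prArity R).ctx) i)

variable {T f} {K : Srt → Type u} {D : Str T.thy.sig K} {X : SOps K} (hG : Good T f D X)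
include hG

theorem mem_ev_starArgs {a : Arity Srt} {xs : ∀ i, K (a.sort i)} (i) :
    Arity.consFam (F := K) (a := a.up 0) X.star xs i ∈
      (D.pull (partMap T f)).ev (V := a.ctx) xs
        (Arity.consFam (F := Term (contextualSig T.thy.sig) a.ctx) (a := a.up 0)
          (SubT.star.incl _) (fun i => .var (V := a.ctx) i) i) := by
  refine Fin.cases ?_ (fun i => ?_) i
  · refine (Part.ext_iff.1 (Str.ev_incl (D.pull (partMap T f)) _ _) _).2 ?_
    exact hG.realizes.mem_ev_star.2 rfl
  · exact Part.mem_some _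

/-- The domain predicate restricts the reconstructing term to the domain of `σ`, where its value is
the right one. Over the empty context the requirement that arguments lie over it is void. Only
`Good` is used, so the conclusion applies to slices as well. -/
theorem pull_pull_fnMap : (D.pull (partMap T f)).pull (fnMap T f) = D := by
  refine Str.ext (funext fun σ => funext fun xs => Part.ext fun u => ?_)
    (funext fun R => funext fun xs => propext ?_)
  · have hdom := ((D.pull (partMap T f)).sat_rel_iff (V := (T.thy.sig.fnArity σ).ctx)
      (R := .inr (.inr σ, 0)) xs (mem_ev_starArgs hG (a := T.thy.sig.fnArity σ))).trans
        (partMap_pr_inr hG.realizes)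
    have h0 := evR_times_zero D (T.thy.sig.gen σ) X.star xs
    have h1 := (D.evR_ofTerm (V := (T.thy.sig.fnArity σ).ctx) xs _).trans (D.ev_app_vars σ xs)
    have hs := (exists_fnTerm f σ).choose_spec K D X hG xs
    refine ((D.pull (partMap T f)).mem_evR (V := (T.thy.sig.fnArity σ).ctx) xs).trans ?_
    constructor
    · rintro ⟨h, hd⟩
      obtain ⟨⟨y, hy⟩, -⟩ := hdom.1 hd
      have hy' : y ∈ D.fn σ xs := by
        rw [← h1]
        exact (Part.ext_iff.1 h0 y).1 hy
      exact Part.mem_unique (hs y hy') h ▸ hy'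
    · intro h
      refine ⟨hs u h, hdom.2 ⟨⟨u, ?_⟩, fun i => hG.isModel.overAt_zero⟩⟩
      refine (Part.ext_iff.1 h0 u).2 ?_
      rw [h1]
      exact h
  · refine ((D.pull (partMap T f)).sat_rel_iff (V := (T.thy.sig.prArity R).ctx)
      (R := .inr (.inl R, 0)) xs (mem_ev_starArgs hG (a := T.thy.sig.prArity R))).trans
        ((partMap_pr_inl hG.realizes).trans ?_)
    refine (and_iff_left fun i => hG.isModel.overAt_zero).trans ?_
    exact (sat_timesFormula_zero D _ _ _).trans
      (D.sat_rel_iff (V := (T.thy.sig.prArity R).ctx) xs fun i => Part.mem_some _)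

end

/-! ### The isomorphism -/

namespace Str

variable {A : Signature.{u} Srt} {B : Signature.{w} Srt} {K : Srt → Type v}

theorem LRegular.pull_LMap {N : Str (LSig B) K} (hN : N.LRegular) (f : SymMap A B) :
    (N.pull (LMap f)).LRegular where
  fn_cod σ γ xs z h := by
    rw [pull_LMap_over]
    exact ((mem_pull_LMap_inr hN (P := N.IsOver γ) (fun _ _ => Iff.rfl) f).1 h).2.1
  fn_arg σ γ xs z i h := by
    rw [pull_LMap_over]
    exact ((mem_pull_LMap_inr hN (P := N.IsOver γ) (fun _ _ => Iff.rfl) f).1 h).1 i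
  pr_arg R γ xs i h := by
    rw [pull_LMap_over]
    exact ((pull_LMap_inr_pr hN (P := N.IsOver γ) (fun _ _ => Iff.rfl) f).1 h).1 i

/-- Structures of lifted signatures are compared on slices. -/
theorem eq_pull_LMap {N : Str (LSig A) K} {N' : Str (LSig B) K} (hN : N.LRegular)
    (hN' : N'.LRegular) {f : SymMap A B} (hb : ∀ b : BaseFn, N.fn (.inl b) = N'.fn (.inl b))
    (hS : ∀ γ P, (∀ s x, P s x ↔ N'.IsOver γ s x) → N.slice γ P = (N'.slice γ P).pull f) :
    N = N'.pull (LMap f) := by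
  have ho : N.IsOver = N'.IsOver := by
    have e : N.ftV = N'.ftV := by
      funext n
      induction n with
      | zero => rfl
      | succ n ih =>
        funext x
        simp only [ftV, ih]
        exact congrArg (·.bind (N'.ftV n)) (congrFun (hb (.ft (n + 1))) fun _ => x)
    funext γ s x
    simp only [IsOver, e]
    rw [show N.fn (.inl (.ctxOf s.1 (s.2 + 1))) (fun _ => x) = _ from
      congrFun (hb (.ctxOf s.1 (s.2 + 1))) fun _ => x]
    rfl
  refine Str.ext (funext fun σ => ?_) (funext fun R => ?_)
  · obtain b | σ := σ
    · exact (hb b).trans (pull_LMap_inl f b).symm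
    · funext ys
      obtain ⟨γ, xs, rfl⟩ : ∃ γ xs, ys = Arity.consFam (F := K) (a := (A.fnArity σ).up 1) γ xs :=
        ⟨_, _, Arity.consFam_eta ys⟩
      refine Part.ext fun y => Iff.trans ?_ (mem_pull_LMap_inr hN' (P := N'.IsOver γ)
        (fun _ _ => Iff.rfl) f).symm
      rw [← hS γ (N'.IsOver γ) fun _ _ => Iff.rfl]
      constructor
      · intro h
        have hx := fun i => hN.fn_arg σ γ xs y i h
        have hy := hN.fn_cod σ γ xs y h
        rw [ho] at hx hy
        exact ⟨hx, hy, mem_slice_fn.2 h⟩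
      · rintro ⟨hx, hy, h⟩
        exact mem_slice_fn.1 h
  · obtain e | R := R
    · exact e.elim
    · funext ys
      obtain ⟨γ, xs, rfl⟩ : ∃ γ xs, ys = Arity.consFam (F := K) (a := (A.prArity R).up 1) γ xs :=
        ⟨_, _, Arity.consFam_eta ys⟩
      refine propext (Iff.trans ?_ (pull_LMap_inr_pr hN' (P := N'.IsOver γ)
        (fun _ _ => Iff.rfl) f).symm)
      rw [← hS γ (N'.IsOver γ) fun _ _ => Iff.rfl]
      constructor
      · intro h
        have hx := fun i => hN.pr_arg R γ xs i h
        rw [ho] at hx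
        exact ⟨hx, h⟩
      · rintro ⟨hx, h⟩
        exact h

end Str

namespace IsADTT

variable {T : PrestableData.{u}} {f : SymMap substSig T.thy.sig} (hT : IsADTT T f)
include hT

/-- The interpretation of `T` in the contextual theory. -/
noncomputable def fnInterp : SymMap T.thy.sig hT.contextual.toPrestable.thy.sig := fnMap T f

theorem pull_partInterp_base {K : Srt → Type u} (M : Str T.thy.sig K) :
    (M.pull hT.partInterp).pull hT.contextual.toPrestable.base = (M.pull f).pull substBase :=
  Str.ext (funext fun _ => funext fun _ => (M.pull hT.partInterp).evR_incl _ _)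
    (funext fun e => e.elim)

theorem pull_partInterp_inclusion {K : Srt → Type u} (M : Str T.thy.sig K) :
    (M.pull hT.partInterp).pull hT.contextual.inclusion = M.pull f :=
  (hT.contextual.inclusion_pull (N := M.pull hT.partInterp)).trans
    (Str.ext rfl (funext fun e => e.elim))

variable {K : Srt → Type u} {M : Str T.thy.sig K} (hM : M.Models)
include hM

theorem pull_fnInterp : (M.pull hT.partInterp).pull hT.fnInterp = M := by
  obtain ⟨X, hG⟩ := hT.exists_good hM
  exact pull_pull_fnMap hG

/-- Needed for compatibility with `α`: `L` of the interpretation is compared on slices, and these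
are good structures without being known to be models of `T`. -/
theorem slice_pull_fnInterp {γ : K (cx 1)} {P : ∀ s : Srt, K (s.up 1) → Prop}
    (hP : ∀ s x, P s x ↔ (M.pull T.alpha).IsOver γ s x) :
    (((M.pull T.alpha).slice γ P).pull hT.partInterp).pull hT.fnInterp =
      (M.pull T.alpha).slice γ P := by
  obtain ⟨X, hG⟩ := hT.exists_good hM
  exact pull_pull_fnMap (hT.slice_good hM hG fun s x =>
    (hP s x).trans ((hT.baseRealizes hM hG.realizes).isOver_iff γ s x))

/-- By `pull_partInterp_alpha` this structure is the reduct along `α` of the contextual theory, so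
its being a model makes that `α` an interpretation. The operations of the theory of contexts are
those of `T`, the axiom on `ctx_{p,n+1}` is checked in the slice over `γ`, and the remaining axioms
are regularity. -/
theorem models_LTheory : Str.Models
    (T := LTheory hT.contextual.toPrestable.thy hT.contextual.toPrestable.base)
    ((M.pull T.alpha).pull (LMap hT.partInterp)) := by
  obtain ⟨X, hG⟩ := hT.exists_good hM
  let N := (M.pull T.alpha).pull (LMap hT.partInterp)
  have hN : N.LRegular := (hT.alpha_lRegular hM).pull_LMap _
  have hNO : N.IsOver = (M.pull T.alpha).IsOver := Str.pull_LMap_over _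
  have hfn : ∀ {σ : (contextualSig T.thy.sig).Fn} {ρ},
      N.sat (V := (((contextualSig T.thy.sig).fnArity σ).under 1).ctx) ρ (Term.app
        (A := LSig (contextualSig T.thy.sig)) (Sum.inr σ)
          (fun i => .var (V := (((contextualSig T.thy.sig).fnArity σ).under 1).ctx) i)).defd →
      ∃ z, z ∈ N.fn (.inr σ) ρ ∧
        z ∈ N.ev (V := (((contextualSig T.thy.sig).fnArity σ).under 1).ctx) ρ (Term.app
          (A := LSig (contextualSig T.thy.sig)) (Sum.inr σ)
          (fun i => .var (V := (((contextualSig T.thy.sig).fnArity σ).under 1).ctx) i)) := by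
    intro σ ρ h
    obtain ⟨z, hz⟩ := (N.sat_defd _ _).1 h
    exact ⟨z, (Part.ext_iff.1 (N.ev_app_vars (Sum.inr σ) ρ) z).1 hz, hz⟩
  intro q hq
  cases hq with
  | base q hq =>
    intro ρ h
    refine (N.sat_incl _ _).2 ?_
    replace h := (N.sat_incl _ _).1 h
    have e : N.inl = M.pull T.base := by
      rw [hT.pull_base hM]
      exact Str.ext (funext fun b =>
        (Str.pull_LMap_inl (N := M.pull T.alpha) hT.partInterp b).trans (hT.alpha_inl hM b))
        (funext fun e => e.elim)
    rw [e] at h ⊢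
    exact Theory.models_detects.isInterp_iff.1 hT.prestable.base_interp K M hM q hq ρ h
  | ctx p n =>
    intro ρ h
    obtain ⟨γ, x, rfl⟩ : ∃ γ x, ρ = Arity.consFam (F := K)
        (a := (Arity.rep 1 ((p, n) : Srt)).up 1) γ fun _ => x :=
      ⟨ρ (0 : Fin 2), ρ (1 : Fin 2), by
        funext i
        exact Fin.cases rfl (fun i => Subsingleton.elim (0 : Fin 1) i ▸ rfl) i⟩
    let P : ∀ s : Srt, K (s.up 1) → Prop := X.IsOver γ
    have hP : ∀ s x, P s x ↔ X.IsOver γ s x := fun _ _ => Iff.rfl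
    have hPO := hT.isOver_iff hM hG.realizes hP
    have hPN : ∀ s x, P s x ↔ N.IsOver γ s x := by rwa [hNO]
    replace h := (N.sat_isOver (s := (p, n)) (Part.mem_some _) (Part.mem_some _)).1 h
    have hx : P (p, n) x := (hPN _ _).2 h
    have hS := hT.slice_good hM hG hP
    let c := (X.slice hG.isModel hP).cxOf (p, n) ⟨x, hx⟩
    have hc : c.1 = X.cxOf (p, n + 1) x := X.slice_cxOf hG.isModel hP _
    refine (N.sat_req _ _ _).2 ⟨c.1, ?_, ?_⟩
    · refine (Part.ext_iff.1 (N.evR_ofTerm _ _) _).2 ?_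
      refine (Part.ext_iff.1 (Str.mem_ev_lctx (Part.mem_some _)) _).2 ?_
      refine (Part.ext_iff.1 (congrFun (Str.pull_LMap_inl (N := M.pull T.alpha)
        hT.partInterp (.ctxOf p (n + 1))) _) _).2 ?_
      refine (Part.ext_iff.1 ((hT.baseRealizes hM hG.realizes).ctxOf p (n + 1) x) _).2 ?_
      rw [hc]
      exact Part.mem_some _
    · refine (Str.mem_evR_liftRTerm hN hPN (V := (Arity.rep 1 ((p, n) : Srt)).ctx)
        (ρ' := fun _ => (⟨x, hx⟩ : SliceCarrier P (p, n))) (Part.mem_some _)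
        fun _ => Part.mem_some _).2 ⟨c.2, ?_⟩
      rw [Str.slice_pull_LMap (hT.alpha_lRegular hM) hPO]
      refine (Part.ext_iff.1 (Str.evR_incl _ _ _) _).2 ?_
      cases p with
      | ctx => exact (Str.mem_evR _ _).2 ⟨Part.mem_some _, trivial⟩
      | tm =>
        exact (Str.mem_evR _ _).2
          ⟨hS.realizes.ctxOf_mem (p := .tm) (Part.mem_some _), trivial⟩
  | fn_cod σ =>
    intro ρ h
    obtain ⟨z, hz, hz'⟩ := hfn h
    rw [Arity.consFam_eta ρ] at hz
    exact (N.sat_isOver (Part.mem_some _) hz').2 (hN.fn_cod _ _ _ _ hz)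
  | fn_arg σ i =>
    intro ρ h
    obtain ⟨z, hz, -⟩ := hfn h
    rw [Arity.consFam_eta ρ] at hz
    exact (N.sat_isOver (Part.mem_some _) (Part.mem_some _)).2 (hN.fn_arg _ _ _ _ i hz)
  | pr_arg R i =>
    intro ρ h
    replace h := (N.sat_rel_iff (V := (((contextualSig T.thy.sig).prArity R).under 1).ctx)
      (R := .inr R) ρ fun i => Part.mem_some _).1 h
    rw [Arity.consFam_eta ρ] at h
    exact (N.sat_isOver (Part.mem_some _) (Part.mem_some _)).2 (hN.pr_arg _ _ _ i h)

omit hM in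
theorem isContextual_contextual : hT.contextual.IsContextual where
  prestable := {
    base_interp := hT.detects.isInterp_iff.2 (by
      rintro K _ ⟨M, hM, rfl⟩
      rw [hT.pull_partInterp_base, ← hT.pull_base hM]
      exact Theory.models_detects.isInterp_iff.1 hT.prestable.base_interp K M hM)
    alpha_interp := hT.detects.isInterp_iff.2 (by
      rintro K _ ⟨M, hM, rfl⟩
      have h := hT.models_LTheory hM
      rw [← hT.pull_partInterp_alpha hM] at h
      exact h)
    alpha_base := fun b => hT.detects.rEquiv_iff.2 fun K M hM ρ => rfl }
  hom := {
    interp := hT.detects.isInterp_iff.2 (by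
      rintro K _ ⟨M, hM, rfl⟩
      have h := hT.pull_models hM
      rw [← hT.pull_partInterp_inclusion] at h
      exact h)
    base := hT.detects.symEquiv_iff.2 (by
      rintro K _ ⟨M, hM, rfl⟩
      refine (Str.pull_comp _ _ _).trans (Eq.trans ?_ (hT.pull_partInterp_base M).symm)
      exact congrArg (fun N => N.pull substBase) (hT.pull_partInterp_inclusion M))
    alpha := hT.detects.symEquiv_iff.2 (by
      rintro K _ ⟨M, hM, rfl⟩
      have hN := hT.alpha_lRegular hM
      refine (Str.pull_comp _ _ _).trans (Eq.trans ?_ (Str.pull_comp _ _ _).symm)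
      refine (congrArg (fun N => N.pull substAlpha) (hT.pull_partInterp_inclusion M)).trans ?_
      refine (hT.pull_substAlpha hM).trans ?_
      refine Eq.trans ?_ (congrArg (fun N => N.pull (LMap hT.contextual.inclusion))
        (hT.pull_partInterp_alpha hM)).symm
      -- Both sides are reducts along some `L(g)`, hence determined by their slices, where they are
      -- reducts along `g`; on every structure, restricting `partInterp` along the inclusion gives
      -- `f`.
      refine Str.eq_pull_LMap (hN.pull_LMap f) (hN.pull_LMap _) (fun b => ?_) fun γ P hP => ?_
      · rw [Str.pull_LMap_inl, Str.pull_LMap_inl]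
      · rw [Str.pull_LMap_over] at hP
        rw [Str.slice_pull_LMap hN hP, Str.slice_pull_LMap hN hP, hT.pull_partInterp_inclusion]) }

omit hM in
-- On the detecting reducts the interpretation of `T` gives back the model `M`. All conditions
-- become facts about `M`, except compatibility with `α`, which also needs this recovery for the
-- slices of `M`.
theorem isPrestableHom_fnInterp : IsPrestableHom T hT.contextual.toPrestable hT.fnInterp where
  interp := hT.detects.isInterp_iff.2 (by
    rintro K _ ⟨M, hM, rfl⟩
    rw [hT.pull_fnInterp hM]
    exact hM)
  base := hT.detects.symEquiv_iff.2 (by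
    rintro K _ ⟨M, hM, rfl⟩
    rw [Str.pull_comp, hT.pull_fnInterp hM, hT.pull_partInterp_base, hT.pull_base hM])
  alpha := hT.detects.symEquiv_iff.2 (by
    rintro K _ ⟨M, hM, rfl⟩
    have hN := hT.alpha_lRegular hM
    refine (Str.pull_comp _ _ _).trans (Eq.trans ?_ (Str.pull_comp _ _ _).symm)
    rw [hT.pull_fnInterp hM]
    refine Eq.trans ?_ (congrArg (fun N => N.pull (LMap hT.fnInterp))
      (hT.pull_partInterp_alpha hM)).symm
    refine Str.eq_pull_LMap hN (hN.pull_LMap _) (fun b => ?_) fun γ P hP => ?_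
    · rw [Str.pull_LMap_inl]
    · rw [Str.pull_LMap_over] at hP
      rw [Str.slice_pull_LMap hN hP, hT.slice_pull_fnInterp hM hP])

omit hM in
theorem isPrestableHom_partInterp :
    IsPrestableHom hT.contextual.toPrestable T hT.partInterp where
  interp := hT.isInterp_partInterp
  base := Theory.models_detects.symEquiv_iff.2 fun K M hM => by
    rw [Str.pull_comp, hT.pull_partInterp_base, hT.pull_base hM]
  alpha := Theory.models_detects.symEquiv_iff.2 fun K M hM => by
    refine (Str.pull_comp _ _ _).trans (Eq.trans ?_ (Str.pull_comp _ _ _).symm)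
    exact hT.pull_partInterp_alpha hM

end IsADTT

end PHT

/-- For the composite on the contextual side it suffices to consider a reduct of a model `M` of `T`:
its reduct along `fnInterp` is `M`, and taking the reduct along `partInterp` once more returns the
same structure. Thus a single retraction property yields both inverse laws. -/
theorem mainTheorem5 (T : PHT.PrestableData.{u}) (f : PHT.SymMap PHT.substSig T.thy.sig)
    (hT : PHT.IsADTT T f) :
    ∃ C : PHT.ContextualData.{u}, C.IsContextual ∧
      (∀ σ : C.basic.sig.Fn,
        C.basic.sig.fnCod σ = PHT.tyS 0 ∨ C.basic.sig.fnCod σ = PHT.tmS 0) ∧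
      PHT.IsoUnderSubst T f C.toPrestable C.inclusion := by
  refine ⟨hT.contextual, hT.isContextual_contextual, hT.fnCod_contextual, hT.fnInterp,
    hT.partInterp, hT.isPrestableHom_fnInterp, hT.isPrestableHom_partInterp,
    hT.detects.symEquiv_iff.2 ?_, PHT.Theory.models_detects.symEquiv_iff.2 fun K M hM => ?_,
    PHT.Theory.models_detects.symEquiv_iff.2 fun K M hM => ?_, hT.detects.symEquiv_iff.2 ?_⟩
  · rintro K _ ⟨M, hM, rfl⟩
    rw [PHT.Str.pull_comp, hT.pull_fnInterp hM, hT.pull_partInterp_inclusion]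
  · rw [PHT.Str.pull_comp, hT.pull_partInterp_inclusion]
  · rw [PHT.Str.pull_comp, hT.pull_fnInterp hM, PHT.Str.pull_id]
  · rintro K _ ⟨M, hM, rfl⟩
    rw [PHT.Str.pull_comp, hT.pull_fnInterp hM, PHT.Str.pull_id]
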